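/- Let $F$ be a field of characteristic $0$ and let $q,t\in F$ be algebraically independent over $\mathbb{Q}$ (for example $F=\mathbb{Q}(q,t)$ with indeterminates $q,t$). Let $\Lambda_F=F[p_1,p_2,\ldots]$ be the ring of symmetric functions over $F$, where $p_n$ is the $n$-th power sum, and let $\langle\cdot,\cdot\rangle$ be the Macdonald inner product, i.e. the bilinear form on $\Lambda_F$ with $$\langle p_\lambda,p_\mu\rangle=\delta_{\lambda,\mu}\,z_\lambda\prod_{i=1}^{\ell(\lambda)}\frac{1-q^{\lambda_i}}{1-t^{\lambda_i}},\qquad z_\lambda=\prod_{i\ge1}i^{m_i}\,m_i!,$$ where $m_i$ is the multiplicity of $i$ in $\lambda$. The Macdonald symmetric functions $P_\lambda=P_\lambda(q,t)$ are the elements of $\Lambda_F$ determined by $P_\lambda\in m_\lambda+\sum_{\mu<\lambda}F\,m_\mu$ (monomial symmetric functions $m_\mu$, dominance order) and $\langle P_\lambda,P_\mu\rangle=0$ for $\lambda\ne\mu$. Their integral forms are $$J_\lambda=c_\lambda P_\lambda,\qquad c_\lambda=\prod_{s\in\lambda}\bigl(1-q^{a_\lambda(s)}t^{\,l_\lambda(s)+1}\bigr),$$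 where for a box $s=(i,j)$ of the diagram of $\lambda$ (row $i$, column $j$) we put $a_\lambda(s)=\lambda_i-j$ and $l_\lambda(s)=\lambda'_j-i$, and $\lambda'$ is the conjugate partition. Put $n(\lambda)=\sum_i(i-1)\lambda_i$ and, for $n\ge0$, $$v_n^{(0)}=\sum_{\lambda\vdash n}J_\lambda\,\frac{q^{n(\lambda')}}{\langle J_\lambda,J_\lambda\rangle}.$$ Let the operators $D_d$ ($d\ge0$) on $\Lambda_F$ be defined by $$\sum_{d\ge0}D_d\,z^{-d}=\exp\Bigl(\sum_{n>0}(1-q^n)\,\frac{\partial}{\partial p_n}\,z^{-n}\Bigr).$$ Then for every integer $n\ge0$ $$D_1v_{n+1}^{(0)}=v_n^{(0)},\qquad D_dv_n^{(0)}=0\quad(d\ge2).$$ -/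

import Mathlib

namespace MacdonaldFock

noncomputable section

/-! ### Partitions and their diagrams -/

/-- The Young diagram of a partition `λ = (λ₁ ≥ λ₂ ≥ ⋯)`. Boxes are the pairs `(i, j)` of
row and column indices, both counted from `0`, with `j < λ_{i+1}`; `rowLen i` is `λ_{i+1}` and
`colLen j` is the part `λ'_{j+1}` of the conjugate partition. -/
def diagram {n : ℕ} (lam : n.Partition) : YoungDiagram :=
  YoungDiagram.ofRowLens (lam.parts.sort (· ≥ ·)) (Multiset.pairwise_sort lam.parts (· ≥ ·)).sortedGE

/-- The arm length `a(s) = λ_i - j` of the box `s` (which has `1`-based coordinates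
`(s.1 + 1, s.2 + 1)`). -/
def arm (Y : YoungDiagram) (s : ℕ × ℕ) : ℕ := Y.rowLen s.1 - (s.2 + 1)

/-- The leg length `l(s) = λ'_j - i` of the box `s`. -/
def leg (Y : YoungDiagram) (s : ℕ × ℕ) : ℕ := Y.colLen s.2 - (s.1 + 1)

/-- `n(λ) = ∑_{i ≥ 1} (i - 1) λ_i`. -/
def nStat (Y : YoungDiagram) : ℕ := ∑ i ∈ Finset.range (Y.colLen 0), i * Y.rowLen i

/-- The dominance order on partitions of `n`: `μ ≤ λ` if and only if
`μ₁ + ⋯ + μ_k ≤ λ₁ + ⋯ + λ_k` for all `k`. -/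
def DominanceLE {n : ℕ} (mu lam : n.Partition) : Prop :=
  ∀ k : ℕ, ∑ i ∈ Finset.range k, (diagram mu).rowLen i ≤
    ∑ i ∈ Finset.range k, (diagram lam).rowLen i

variable {F : Type*} [Field F]

/-- `c_λ(q,t) = ∏_{s ∈ λ} (1 - q^{a(s)} t^{l(s)+1})`. -/
def cCoeff (q t : F) {n : ℕ} (lam : n.Partition) : F :=
  ∏ s ∈ (diagram lam).cells, (1 - q ^ arm (diagram lam) s * t ^ (leg (diagram lam) s + 1))

/-! ### The Fock space of symmetric functions -/

variable (F) in
/-- The space `Λ_F` of symmetric functions over a field `F` of characteristic zero, presented as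
the polynomial ring in the power sums: the variable `X n` is the power sum `p_n`, `n ≥ 1`. -/
abbrev SymFun : Type _ := MvPolynomial ℕ+ F

/-- A symmetric function written in the variables `x_1, …, x_N`: the ring homomorphism sending
`p_n` to `x_1^n + ⋯ + x_N^n`. -/
def evalVars (N : ℕ) : SymFun F →ₐ[F] MvPolynomial (Fin N) F :=
  MvPolynomial.aeval fun n : ℕ+ => MvPolynomial.psum (Fin N) F n

/-- For `λ = (1^{m_1} 2^{m_2} ⋯)` encoded by its multiplicities `m`, the value
`⟨p_λ, p_λ⟩ = z_λ ∏_i (1 - q^{λ_i}) / (1 - t^{λ_i})`, where `z_λ = ∏_{i ≥ 1} i^{m_i} m_i!`. -/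
def normPowerSum (q t : F) (m : ℕ+ →₀ ℕ) : F :=
  m.prod fun i k => ((i : ℕ) : F) ^ k * (k.factorial : F) *
    ((1 - q ^ (i : ℕ)) / (1 - t ^ (i : ℕ))) ^ k

/-- The Macdonald inner product `⟨·,·⟩_{q,t}`: the bilinear form for which the products of
power sums are orthogonal, with `⟨p_λ, p_λ⟩` as in `normPowerSum`. -/
def macInner (q t : F) (f g : SymFun F) : F :=
  ∑ m ∈ f.support, f.coeff m * g.coeff m * normPowerSum q t m

/-! ### Macdonald symmetric functions -/

/-- The defining properties of the family `P_λ(q,t)`, `λ ⊢ n`, of Macdonald symmetric functions: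
`P_λ = m_λ + ∑_{μ < λ} u_{λμ} m_μ` with `<` the dominance order and `m_μ` the monomial symmetric
functions (an identity of symmetric functions, i.e. one that holds in any number `N` of
variables, the coefficients not depending on `N`), and `⟨P_λ, P_μ⟩_{q,t} = 0` for `λ ≠ μ`. -/
structure IsMacdonaldFamily (q t : F) (n : ℕ) (P : n.Partition → SymFun F) : Prop where
  triangular : ∀ lam : n.Partition, ∃ u : n.Partition → F,
    u lam = 1 ∧ (∀ mu, u mu ≠ 0 → DominanceLE mu lam) ∧
    ∀ N : ℕ, evalVars N (P lam) = ∑ mu : n.Partition, u mu • MvPolynomial.msymm (Fin N) F mu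
  orthogonal : ∀ lam mu : n.Partition, lam ≠ mu → macInner q t (P lam) (P mu) = 0

/-- The Macdonald symmetric functions `P_λ(q,t)`, `λ ⊢ n`: the family with the properties
`IsMacdonaldFamily`. -/
def macdonaldP (q t : F) (n : ℕ) : n.Partition → SymFun F :=
  Classical.epsilon (IsMacdonaldFamily q t n)

/-- The integral form `J_λ(q,t) = c_λ(q,t) P_λ(q,t)`. -/
def macdonaldJ (q t : F) {n : ℕ} (lam : n.Partition) : SymFun F :=
  cCoeff q t lam • macdonaldP q t n lam

/-- `v_n^{(0)} = ∑_{λ ⊢ n} J_λ q^{n(λ')} / ⟨J_λ, J_λ⟩_{q,t}`. -/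
def v0 (q t : F) (n : ℕ) : SymFun F :=
  ∑ lam : n.Partition,
    (q ^ nStat (diagram lam).transpose / macInner q t (macdonaldJ q t lam) (macdonaldJ q t lam)) •
      macdonaldJ q t lam

/-! ### The current `D(z)` -/

/-- The exponential `∑_k A^k / k!` of a formal power series `A` without constant term, over a
possibly non-commutative `F`-algebra `R`: since `A^k` has no terms of degree less than `k`, only
`k ≤ d` contribute to the coefficient of degree `d`. -/
def formalExp (F : Type*) [Field F] {R : Type*} [Ring R] [Algebra F R] (A : PowerSeries R) :
    PowerSeries R :=
  PowerSeries.mk fun d =>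
    ∑ k ∈ Finset.range (d + 1), ((k.factorial : F)⁻¹) • PowerSeries.coeff d (A ^ k)

/-- The operator `∂/∂p_n` on `Λ_F`. -/
def partialP (n : ℕ+) : Module.End F (SymFun F) :=
  (MvPolynomial.pderiv n : Derivation F (SymFun F) (SymFun F)).toLinearMap

/-- The formal series `∑_{n > 0} (1 - q^n) ∂_{p_n} z^{-n}` in the variable `z⁻¹`. -/
def logD (q : F) : PowerSeries (Module.End F (SymFun F)) :=
  PowerSeries.mk fun n => if h : 0 < n then (1 - q ^ n) • partialP ⟨n, h⟩ else 0

/-- The operator `D_d`: the coefficient of `z^{-d}` in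
`D(z) = exp (∑_{n > 0} (1 - q^n) ∂_{p_n} z^{-n})`. -/
def D (q : F) (d : ℕ) : Module.End F (SymFun F) := PowerSeries.coeff d (formalExp F (logD q))

end

end MacdonaldFock

/-!
The vector `v_n` turns out to be the `n`-th coefficient `w_n` of
`exp (∑ (-1) ^ (k - 1) / (1 - q ^ k) * p_k * z ^ k / k)`. Granting this, the proposition is immediate:
`(1 - q ^ k) ∂/∂p_k` maps `w_n` to `(-1) ^ (k - 1) / k * w_{n-k}`, so the generating function of
the operators `D_d` acts on `w_n` as `exp (log (1 + z⁻¹)) = 1 + z⁻¹` (`D_wFun`).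

To identify `v_n` with `w_n` (`wFun_eq_v0`), expand `w_n` in the orthogonal basis `P_λ`. The pairing
`⟨w_n, f⟩` is the value of `f` under the specialization `p_k ↦ (-1) ^ (k - 1) / (1 - t ^ k)`
(`macForm_wFun`), so what is needed is the formula `q ^ n(λ') / c_λ` for the specialization of
`P_λ` (`specInf_macP`). Up to sign it is the leading coefficient in `u` of the principal
specialization `φ_u : p_k ↦ (1 - u ^ k) / (1 - t ^ k)`, and `φ_u(P_λ)` is determined as follows.

* `P_λ` vanishes in fewer than `ℓ(λ)` variables, which gives the zeros `u = t ^ i`, `i < ℓ(λ)`. As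
  `φ_u = ∑ (-u) ^ r φ_{qu} ∘ e_r^⊥`, where `e_r^⊥` is the adjoint of the multiplication by `e_r`,
  and `e_r^⊥` removes vertical strips, `φ_u(P_λ)` vanishes at `u = q ^ (-j) t ^ i` for every box
  `(i, j)` (`specAt_macP_eq_zero`). For degree reasons these are all its zeros (`specAt_macP`).
* In `N = ℓ(λ)` variables `P_λ` is `x_1 ⋯ x_N` times the function of the diagram without its first
  column (`evalVars_macP_removeCol`). Comparing both sides at `u = t ^ N` gives a recursion for the
  leading coefficient.

Both steps use the Pieri rule (`pieri`): multiplication by `e_r` adds vertical strips. It is derived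
from the Macdonald operator `E`, the zero mode of a vertex operator acting on `Λ` (`macOp`), with
first mode `E₁`. The operator `E` is self-adjoint (`macForm_vertexOp`) and triangular
(`mCoeff_macOp`) with distinct eigenvalues `e_λ`, affine in `∑ q ^ j t ^ (-i)` over the boxes of `λ`;
this gives existence, orthogonality and uniqueness of the `P_λ`. The commutator `[E, p₁]` is a
multiple of `E₁`, and the commutator of `E₁` with the operator for `(q⁻¹, t⁻¹)` is a multiple of `p₁`
(`macOp_p1_comm`, `macOp_inv_comm`). Hence if `P_λ` occurs in `p₁ P_μ`, the difference `f` of the box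
sums of `λ` and `μ` satisfies `f(q, t) f(q⁻¹, t⁻¹) = 1`, which for generic `q, t` forces `f` to be a
single monomial: a box is added (`pieri_one`). The case of `e_r` follows by induction from the
relation `macOp_eFun_mul` between `E`, `E₁` and the multiplications by `e_r` and `e_{r+1}`.
-/

namespace MacdonaldFock

noncomputable section

open Finset.HasAntidiagonal (antidiagonal)

/-! ### Exponentials of power sums -/

section

section PowerExp

variable {R : Type*} [CommRing R]

/-- `IsPowerExp a f` says that `f = exp (∑_{n ≥ 1} a n X ^ n / n)`. It is expressed by the
differential equation `f' = (∑_{n ≥ 1} a n X ^ (n - 1)) f`, `f(0) = 1`, which avoids the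
denominators; the value `a 0` plays no role. -/
def IsPowerExp (a : ℕ → R) (f : PowerSeries R) : Prop :=
  PowerSeries.constantCoeff f = 1 ∧
    PowerSeries.derivative R f = PowerSeries.mk (fun n => a (n + 1)) * f

theorem IsPowerExp.coeff_zero {a : ℕ → R} {f : PowerSeries R} (h : IsPowerExp a f) :
    PowerSeries.coeff 0 f = 1 := by
  simpa using h.1

theorem IsPowerExp.coeff_succ {a : ℕ → R} {f : PowerSeries R} (h : IsPowerExp a f) (n : ℕ) :
    PowerSeries.coeff (n + 1) f * (n + 1) =
      ∑ x ∈ antidiagonal n, a (x.1 + 1) * PowerSeries.coeff x.2 f := by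
  have := congrArg (PowerSeries.coeff n) h.2
  simpa [PowerSeries.coeff_derivative, PowerSeries.coeff_mul] using this

theorem isPowerExp_iff {a : ℕ → R} {f : PowerSeries R} :
    IsPowerExp a f ↔ PowerSeries.coeff 0 f = 1 ∧ ∀ n, PowerSeries.coeff (n + 1) f * (n + 1) =
      ∑ x ∈ antidiagonal n, a (x.1 + 1) * PowerSeries.coeff x.2 f := by
  refine ⟨fun h => ⟨h.coeff_zero, h.coeff_succ⟩, fun h => ⟨by simpa using h.1, ?_⟩⟩
  ext n
  simpa [PowerSeries.coeff_derivative, PowerSeries.coeff_mul] using h.2 n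

theorem IsPowerExp.congr {a b : ℕ → R} {f : PowerSeries R} (h : IsPowerExp a f)
    (hab : ∀ n, a (n + 1) = b (n + 1)) : IsPowerExp b f := by
  refine ⟨h.1, ?_⟩
  rw [h.2]
  congr 1
  ext n
  simp [hab]

theorem IsPowerExp.mul {a b : ℕ → R} {f g : PowerSeries R} (hf : IsPowerExp a f)
    (hg : IsPowerExp b g) : IsPowerExp (fun n => a n + b n) (f * g) := by
  refine ⟨by simp [hf.1, hg.1], ?_⟩
  have : PowerSeries.mk (fun n => a (n + 1) + b (n + 1)) =
      PowerSeries.mk (fun n => a (n + 1)) + PowerSeries.mk (fun n => b (n + 1)) := by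
    ext n; simp
  rw [Derivation.leibniz, hf.2, hg.2, this, smul_eq_mul, smul_eq_mul]
  ring

theorem isPowerExp_one : IsPowerExp (fun _ => (0 : R)) 1 := by
  refine ⟨by simp, ?_⟩
  have : PowerSeries.mk (fun _ : ℕ => (0 : R)) = 0 := by ext n; simp
  rw [this]
  simp

theorem IsPowerExp.prod {ι : Type*} (s : Finset ι) {a : ι → ℕ → R} {f : ι → PowerSeries R}
    (h : ∀ i ∈ s, IsPowerExp (a i) (f i)) :
    IsPowerExp (fun n => ∑ i ∈ s, a i n) (∏ i ∈ s, f i) := by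
  classical
  induction s using Finset.induction_on with
  | empty => simpa using isPowerExp_one
  | insert i s hi ih =>
    simp only [Finset.sum_insert hi, Finset.prod_insert hi]
    exact (h i (by simp)).mul (ih fun j hj => h j (by simp [hj]))

theorem isPowerExp_one_sub (α : R) :
    IsPowerExp (fun n => -α ^ n) (1 - PowerSeries.C α * PowerSeries.X) := by
  refine ⟨by simp, ?_⟩
  ext n
  rw [mul_sub, mul_one, ← mul_assoc]
  cases n with
  | zero => simp
  | succ n =>
    rw [PowerSeries.coeff_derivative, map_sub, map_sub, PowerSeries.coeff_succ_mul_X,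
      PowerSeries.coeff_succ_mul_X, PowerSeries.coeff_mul_C]
    simp [PowerSeries.coeff_one]
    ring

theorem isPowerExp_geom (α : R) : IsPowerExp (fun n => α ^ n) (PowerSeries.mk fun n => α ^ n) := by
  rw [isPowerExp_iff]
  refine ⟨by simp, fun n => ?_⟩
  simp only [PowerSeries.coeff_mk]
  rw [Finset.sum_congr rfl (g := fun _ => α ^ (n + 1))]
  · simp; ring
  · rintro ⟨i, j⟩ hx
    rw [Finset.HasAntidiagonal.mem_antidiagonal] at hx
    simp only at hx ⊢
    rw [← hx, ← pow_add]; congr 1; omega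

theorem IsPowerExp.map {S : Type*} [CommRing S] (φ : R →+* S) {a : ℕ → R} {f : PowerSeries R}
    (h : IsPowerExp a f) : IsPowerExp (fun n => φ (a n)) (PowerSeries.map φ f) := by
  rw [isPowerExp_iff]
  refine ⟨by rw [PowerSeries.coeff_map, h.coeff_zero, map_one], fun n => ?_⟩
  have := congrArg φ (h.coeff_succ n)
  simpa using this

theorem IsPowerExp.rescale {a : ℕ → R} {f : PowerSeries R} (α : R)
    (h : IsPowerExp a f) : IsPowerExp (fun n => α ^ n * a n) (PowerSeries.rescale α f) := by
  rw [isPowerExp_iff]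
  refine ⟨by simpa using h.1, fun n => ?_⟩
  rw [PowerSeries.coeff_rescale, mul_assoc, h.coeff_succ, Finset.mul_sum]
  refine Finset.sum_congr rfl ?_
  rintro ⟨i, j⟩ hx
  rw [Finset.HasAntidiagonal.mem_antidiagonal] at hx
  simp only at hx ⊢
  rw [PowerSeries.coeff_rescale, ← hx, add_right_comm, pow_add]
  ring

theorem IsPowerExp.unique [IsDomain R] [CharZero R] {a : ℕ → R} {f g : PowerSeries R}
    (hf : IsPowerExp a f) (hg : IsPowerExp a g) : f = g := by
  ext n
  induction n using Nat.strong_induction_on with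
  | _ n ih =>
    cases n with
    | zero => rw [hf.coeff_zero, hg.coeff_zero]
    | succ n =>
      have hn : ((n : R) + 1) ≠ 0 := by exact_mod_cast Nat.succ_ne_zero n
      apply mul_right_cancel₀ hn
      rw [hf.coeff_succ, hg.coeff_succ]
      refine Finset.sum_congr rfl ?_
      rintro ⟨i, j⟩ hx
      rw [Finset.HasAntidiagonal.mem_antidiagonal] at hx
      simp only at hx ⊢
      rw [ih j (by omega)]

variable (F : Type*) [Field F] [Algebra F R]

/-- The coefficients of `exp (∑_{n ≥ 1} a n X ^ n / n)`, by recursion. -/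
def powerExpCoeff (a : ℕ → R) : ℕ → R
  | 0 => 1
  | n + 1 => ((n + 1 : F)⁻¹) • ∑ i : Fin (n + 1), a (n - i + 1) * powerExpCoeff a i

theorem isPowerExp_powerExpCoeff [CharZero F] (a : ℕ → R) :
    IsPowerExp a (PowerSeries.mk (powerExpCoeff F a)) := by
  rw [isPowerExp_iff]
  refine ⟨by simp [powerExpCoeff], fun n => ?_⟩
  have hn : ((n : F) + 1) ≠ 0 := by exact_mod_cast Nat.succ_ne_zero n
  have h1 : ((n : R) + 1) = algebraMap F R (n + 1) := by simp
  rw [PowerSeries.coeff_mk, powerExpCoeff, h1, mul_comm, ← Algebra.smul_def, smul_smul,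
    mul_inv_cancel₀ hn, one_smul, ← Finset.Nat.sum_antidiagonal_swap,
    Finset.Nat.sum_antidiagonal_eq_sum_range_succ_mk, Finset.sum_range]
  simp

end PowerExp

variable {F : Type*} [Field F]

/-! ### Complete-type series and shifts of the power sums -/

/-- The power sum `p_n` as an element of `SymFun F`; by convention it vanishes for `n = 0`. -/
def pSum (F : Type*) [Field F] (n : ℕ) : SymFun F :=
  if h : 0 < n then MvPolynomial.X ⟨n, h⟩ else 0

theorem pSum_coe (n : ℕ+) : pSum F n = MvPolynomial.X n := by
  simp only [pSum, n.pos, dif_pos]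
  rfl

/-- The coefficient of `w ^ r` in `exp (∑_{n ≥ 1} c n p_n w ^ n / n)`. -/
def hSeries (c : ℕ → F) (r : ℕ) : SymFun F :=
  powerExpCoeff F (fun n => MvPolynomial.C (c n) * pSum F n) r

theorem isPowerExp_hSeries [CharZero F] (c : ℕ → F) :
    IsPowerExp (fun n => MvPolynomial.C (c n) * pSum F n) (PowerSeries.mk (hSeries c)) :=
  isPowerExp_powerExpCoeff F _

@[simp] theorem hSeries_zero (c : ℕ → F) : hSeries c 0 = 1 := by
  simp [hSeries, powerExpCoeff]

theorem hSeries_succ [CharZero F] (c : ℕ → F) (n : ℕ) :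
    hSeries c (n + 1) * (n + 1) =
      ∑ x ∈ antidiagonal n, MvPolynomial.C (c (x.1 + 1)) * pSum F (x.1 + 1) *
        hSeries c x.2 := by
  have := (isPowerExp_hSeries c).coeff_succ n
  simpa using this

theorem hSeries_one [CharZero F] (c : ℕ → F) :
    hSeries c 1 = MvPolynomial.C (c 1) * pSum F 1 := by
  have := hSeries_succ c 0
  simpa using this

/-- The ring homomorphism `p_n ↦ p_n + d n X ^ n`. -/
def shift (d : ℕ → F) : SymFun F →ₐ[F] Polynomial (SymFun F) :=
  MvPolynomial.aeval fun n : ℕ+ =>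
    Polynomial.C (MvPolynomial.X n) + Polynomial.C (MvPolynomial.C (d n)) * Polynomial.X ^ (n : ℕ)

theorem shift_X (d : ℕ → F) (n : ℕ+) : shift d (MvPolynomial.X n) =
    Polynomial.C (MvPolynomial.X n) +
      Polynomial.C (MvPolynomial.C (d n)) * Polynomial.X ^ (n : ℕ) := by
  simp [shift]

/-- The coefficient of `X ^ r` in `shift d f`. -/
def shiftCoeff (d : ℕ → F) (r : ℕ) : SymFun F →ₗ[F] SymFun F where
  toFun f := (shift d f).coeff r
  map_add' f g := by simp
  map_smul' a f := by simp

theorem shiftCoeff_apply (d : ℕ → F) (r : ℕ) (f : SymFun F) :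
    shiftCoeff d r f = (shift d f).coeff r := rfl

theorem shift_rescale (d : ℕ → F) (α : F) (f : SymFun F) :
    shift (fun n => α ^ n * d n) f =
      (shift d f).comp (Polynomial.C (MvPolynomial.C α) * Polynomial.X) := by
  have : shift (fun n => α ^ n * d n) =
      ((Polynomial.aeval (R := SymFun F)
        (Polynomial.C (MvPolynomial.C α) * Polynomial.X : Polynomial (SymFun F))).restrictScalars
        F).comp (shift d) := by
    apply MvPolynomial.algHom_ext
    intro n
    simp [shift_X, mul_pow]
    ring
  rw [this]
  rfl

theorem shiftCoeff_rescale (d : ℕ → F) (α : F) (r : ℕ) (f : SymFun F) :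
    shiftCoeff (fun n => α ^ n * d n) r f = α ^ r • shiftCoeff d r f := by
  rw [shiftCoeff_apply, shift_rescale, Polynomial.comp_C_mul_X_coeff, shiftCoeff_apply, mul_comm,
    ← map_pow, MvPolynomial.C_mul']

theorem shift_shift (c d : ℕ → F) (f : SymFun F) :
    shift (fun n => c n + d n) f =
      (shift d f).eval₂ (shift c : SymFun F →+* Polynomial (SymFun F)) Polynomial.X := by
  induction f using MvPolynomial.induction_on with
  | C a =>
    simp [← MvPolynomial.algebraMap_eq, Polynomial.algebraMap_eq,
      IsScalarTower.algebraMap_apply F (SymFun F) (Polynomial (SymFun F))]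
  | add f g hf hg => simp [hf, hg]
  | mul_X f n hf =>
    rw [map_mul, hf, map_mul, Polynomial.eval₂_mul, shift_X, shift_X]
    congr 1
    simp [shift_X]
    ring

theorem shift_zero (f : SymFun F) : shift (fun _ => (0 : F)) f = Polynomial.C f := by
  have : shift (fun _ => (0 : F)) = (IsScalarTower.toAlgHom F (SymFun F) (Polynomial (SymFun F))) := by
    apply MvPolynomial.algHom_ext
    intro n
    simp [shift_X]
  rw [this]
  simp

@[simp] theorem shiftCoeff_zero_right (d : ℕ → F) (f : SymFun F) : shiftCoeff d 0 f = f := by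
  rw [shiftCoeff_apply]
  induction f using MvPolynomial.induction_on with
  | C a =>
    rw [← MvPolynomial.algebraMap_eq, AlgHom.commutes,
        IsScalarTower.algebraMap_apply F (SymFun F) (Polynomial (SymFun F)),
        Polynomial.algebraMap_eq, Polynomial.coeff_C_zero]
  | add f g hf hg => simp [hf, hg]
  | mul_X f n hf =>
    rw [map_mul, Polynomial.mul_coeff_zero, hf, shift_X]
    simp [n.ne_zero.symm]

/-- Shifting the variables of `exp (∑ c n p_n w ^ n / n)` multiplies it by the scalar series
`exp (∑ c n d n (X w) ^ n / n)`. -/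
theorem shift_hSeries [CharZero F] (c d : ℕ → F) {κ : PowerSeries F}
    (hκ : IsPowerExp (fun n => c n * d n) κ) (n : ℕ) :
    shift d (hSeries c n) = ∑ x ∈ antidiagonal n,
      Polynomial.C (MvPolynomial.C (PowerSeries.coeff x.1 κ) * hSeries c x.2) *
        Polynomial.X ^ x.1 := by
  have h1 := (isPowerExp_hSeries c).map (shift d : SymFun F →+* Polynomial (SymFun F))
  have h2 := ((hκ.map (algebraMap F (Polynomial (SymFun F)))).rescale Polynomial.X).mul
    ((isPowerExp_hSeries c).map (Polynomial.C : SymFun F →+* Polynomial (SymFun F)))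
  have hC : ∀ a : F, algebraMap F (Polynomial (SymFun F)) a =
      Polynomial.C (MvPolynomial.C a) := fun a => by
    rw [IsScalarTower.algebraMap_apply F (SymFun F) (Polynomial (SymFun F))]; rfl
  have h3 := h1.unique (h2.congr fun n => ?_)
  · have := congrArg (PowerSeries.coeff n) h3
    rw [PowerSeries.coeff_map, PowerSeries.coeff_mk, PowerSeries.coeff_mul] at this
    rw [RingHom.coe_coe] at this
    rw [this]
    refine Finset.sum_congr rfl fun x _ => ?_
    rw [PowerSeries.coeff_rescale, PowerSeries.coeff_map, PowerSeries.coeff_map,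
      PowerSeries.coeff_mk, hC, Polynomial.C_mul]
    ring
  · rw [RingHom.coe_coe, map_mul, hC]
    have hs : shift d (MvPolynomial.C (c (n + 1))) = Polynomial.C (MvPolynomial.C (c (n + 1))) := by
      rw [← MvPolynomial.algebraMap_eq, AlgHom.commutes, hC]; rfl
    have hp : pSum F (n + 1) = MvPolynomial.X n.succPNat := pSum_coe n.succPNat
    rw [hp, map_mul (shift d), hs, shift_X, hC]
    simp
    ring

end

/-! ### Derivatives and the inner product -/

section

variable {F : Type*} [Field F]

theorem pderiv_pSum (k : ℕ+) (n : ℕ) : MvPolynomial.pderiv k (pSum F n) =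
    if n = k then 1 else 0 := by
  classical
  rcases Nat.eq_zero_or_pos n with rfl | hn
  · simp [pSum, k.ne_zero.symm]
  · obtain ⟨m, rfl⟩ : ∃ m : ℕ+, (m : ℕ) = n := ⟨⟨n, hn⟩, rfl⟩
    rw [pSum_coe, MvPolynomial.pderiv_X]
    by_cases h : m = k
    · subst h; simp
    · rw [Pi.single_eq_of_ne h, if_neg (by simpa using h)]

theorem pderiv_hSeries [CharZero F] (c : ℕ → F) (k : ℕ+) (n : ℕ) :
    MvPolynomial.pderiv k (hSeries c n) =
      if (k : ℕ) ≤ n then MvPolynomial.C (c k / k) * hSeries c (n - k) else 0 := by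
  induction n using Nat.strong_induction_on with
  | _ n ih =>
    cases n with
    | zero => simp
    | succ n =>
      have hn : ((n : SymFun F) + 1) ≠ 0 := by exact_mod_cast Nat.succ_ne_zero n
      have hk : ((k : ℕ) : F) ≠ 0 := by exact_mod_cast k.ne_zero
      have hk1 := k.pos
      have hsum : ∀ x ∈ antidiagonal n, MvPolynomial.pderiv k (MvPolynomial.C (c (x.1 + 1)) *
            pSum F (x.1 + 1) * hSeries c x.2) =
          (if x.1 = (k : ℕ) - 1 then MvPolynomial.C (c k) * hSeries c (n + 1 - k) else 0) +
          (if (k : ℕ) ≤ x.2 then MvPolynomial.C (c k / k) * (MvPolynomial.C (c (x.1 + 1)) *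
            pSum F (x.1 + 1) * hSeries c (x.2 - k)) else 0) := by
        rintro ⟨i, j⟩ hx
        rw [Finset.HasAntidiagonal.mem_antidiagonal] at hx
        simp only at hx ⊢
        rw [Derivation.leibniz, Derivation.leibniz, ih j (by omega), pderiv_pSum]
        simp only [MvPolynomial.pderiv_C, smul_eq_mul, mul_zero, add_zero]
        have e1 : (i + 1 = (k : ℕ)) ↔ (i = (k : ℕ) - 1) := by omega
        simp only [e1]
        rw [add_comm]
        congr 1
        · split_ifs with h
          · rw [show n + 1 - (k : ℕ) = j by omega, show i + 1 = (k : ℕ) by omega]; ring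
          · simp
        · split_ifs with h
          · ring
          · simp
      have h0 := congrArg (MvPolynomial.pderiv k) (hSeries_succ c n)
      rw [Derivation.leibniz, map_sum, Finset.sum_congr rfl hsum, Finset.sum_add_distrib] at h0
      have hz : MvPolynomial.pderiv k ((n : SymFun F) + 1) = 0 := by
        rw [map_add, Derivation.map_natCast, Derivation.map_one_eq_zero, add_zero]
      rw [hz, smul_zero, zero_add, smul_eq_mul] at h0
      apply mul_left_cancel₀ hn
      rw [h0]
      by_cases hkn : (k : ℕ) ≤ n + 1
      · rw [if_pos hkn, Finset.sum_eq_single_of_mem ((k : ℕ) - 1, n + 1 - k) (by simp; omega)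
          (by
            rintro ⟨i, j⟩ hx hne
            rw [Finset.HasAntidiagonal.mem_antidiagonal] at hx
            simp only at hx ⊢
            rw [if_neg]
            rintro rfl
            exact hne (by simp; omega)), if_pos rfl]
        have h2 : ∑ x ∈ antidiagonal n, (if (k : ℕ) ≤ x.2 then MvPolynomial.C (c k / k) *
            (MvPolynomial.C (c (x.1 + 1)) * pSum F (x.1 + 1) * hSeries c (x.2 - k)) else 0) =
            MvPolynomial.C (c k / k) * (hSeries c (n + 1 - k) * ((n + 1 - k : ℕ) : SymFun F)) := by
          rcases Nat.lt_or_ge n k with hlt | hge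
          · rw [show n + 1 - (k : ℕ) = 0 by omega]
            simp only [Nat.cast_zero, mul_zero]
            refine Finset.sum_eq_zero ?_
            rintro ⟨i, j⟩ hx
            rw [Finset.HasAntidiagonal.mem_antidiagonal] at hx
            simp only at hx ⊢
            rw [if_neg (by omega)]
          · rw [show n + 1 - (k : ℕ) = (n - k) + 1 by omega, Nat.cast_succ, hSeries_succ,
              Finset.mul_sum, Finset.Nat.sum_antidiagonal_eq_sum_range_succ_mk,
              Finset.Nat.sum_antidiagonal_eq_sum_range_succ_mk]
            symm
            refine Finset.sum_subset_zero_on_sdiff ?_ ?_ ?_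
            · intro i; simp; omega
            · intro i hi
              simp at hi
              rw [if_neg]
              simp only
              omega
            · intro i hi
              simp at hi
              simp only
              rw [if_pos (by omega), show n - (k : ℕ) - i = n - i - k by omega]
        rw [h2]
        have h3 : MvPolynomial.C (c k) = MvPolynomial.C (c k / k) * ((k : ℕ) : SymFun F) := by
          rw [← MvPolynomial.C_eq_coe_nat, ← map_mul, div_mul_cancel₀ _ hk]
        have h4 : ((n : SymFun F) + 1) = ((n + 1 - k : ℕ) : SymFun F) + ((k : ℕ) : SymFun F) := by
          rw [← Nat.cast_add]
          rw [Nat.sub_add_cancel hkn]; simp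
        rw [h3, h4]
        ring
      · rw [if_neg hkn, Finset.sum_eq_zero, Finset.sum_eq_zero, add_zero, mul_zero]
        · rintro ⟨i, j⟩ hx
          rw [Finset.HasAntidiagonal.mem_antidiagonal] at hx
          simp only at hx ⊢
          rw [if_neg (by omega)]
        · rintro ⟨i, j⟩ hx
          rw [Finset.HasAntidiagonal.mem_antidiagonal] at hx
          simp only at hx ⊢
          rw [if_neg (by omega)]

/-- The factor `(1 - q ^ n) / (1 - t ^ n)` by which the Macdonald inner product differs from the
Hall inner product. -/
def kap (q t : F) (n : ℕ) : F := (1 - q ^ n) / (1 - t ^ n)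

/-- The Macdonald inner product as a bilinear form. -/
def macForm (q t : F) : LinearMap.BilinForm F (SymFun F) :=
  LinearMap.mk₂ F (macInner q t)
    (by
      intro f g h
      simp only [macInner]
      rw [Finset.sum_subset (MvPolynomial.support_add (p := f) (q := g)),
        Finset.sum_subset (Finset.subset_union_left (s₁ := f.support) (s₂ := g.support)),
        Finset.sum_subset (Finset.subset_union_right (s₁ := f.support) (s₂ := g.support)),
        ← Finset.sum_add_distrib]
      · refine Finset.sum_congr rfl fun m _ => ?_
        rw [MvPolynomial.coeff_add]; ring
      all_goals
        intro m _ hm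
        rw [MvPolynomial.notMem_support_iff.mp hm]; ring)
    (by
      intro a f g
      simp only [macInner, smul_eq_mul]
      rw [Finset.sum_subset (MvPolynomial.support_smul (a := a) (f := f)), Finset.mul_sum]
      · refine Finset.sum_congr rfl fun m _ => ?_
        rw [MvPolynomial.coeff_smul, smul_eq_mul]; ring
      · intro m _ hm
        rw [MvPolynomial.notMem_support_iff.mp hm]; ring)
    (by
      intro f g h
      simp only [macInner, MvPolynomial.coeff_add]
      rw [← Finset.sum_add_distrib]
      exact Finset.sum_congr rfl fun m _ => by ring)
    (by
      intro a f g
      simp only [macInner, MvPolynomial.coeff_smul, smul_eq_mul]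
      rw [Finset.mul_sum]
      exact Finset.sum_congr rfl fun m _ => by ring)

theorem macForm_apply (q t : F) (f g : SymFun F) : macForm q t f g = macInner q t f g := rfl

theorem macForm_monomial (q t : F) (m : ℕ+ →₀ ℕ) (a : F) (g : SymFun F) :
    macForm q t (MvPolynomial.monomial m a) g = a * g.coeff m * normPowerSum q t m := by
  classical
  rw [macForm_apply, macInner, Finset.sum_subset (MvPolynomial.support_monomial_subset)]
  · simp
  · intro x _ hx
    rw [MvPolynomial.notMem_support_iff.mp hx]; ring

theorem macForm_comm (q t : F) (f g : SymFun F) : macForm q t f g = macForm q t g f := by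
  rw [macForm_apply, macForm_apply, macInner, macInner,
    Finset.sum_subset (Finset.subset_union_left (s₁ := f.support) (s₂ := g.support)),
    Finset.sum_subset (Finset.subset_union_right (s₁ := f.support) (s₂ := g.support))]
  · exact Finset.sum_congr rfl fun m _ => by ring
  all_goals
    intro m _ hm
    rw [MvPolynomial.notMem_support_iff.mp hm]; ring

theorem normPowerSum_add_single (q t : F) (m : ℕ+ →₀ ℕ) (k : ℕ+) :
    normPowerSum q t (m + Finsupp.single k 1) =
      normPowerSum q t m * ((k : ℕ) * (m k + 1) * kap q t k) := by
  classical
  simp only [normPowerSum]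
  rw [← Finsupp.mul_prod_erase' (m + Finsupp.single k 1) k _ (by intro; simp),
    ← Finsupp.mul_prod_erase' m k _ (by intro; simp)]
  have h : (m + Finsupp.single k 1).erase k = m.erase k := by
    ext i
    by_cases hi : i = k
    · subst hi; simp
    · simp [Finsupp.erase_ne hi]
  rw [h]
  simp [kap, Nat.factorial_succ, pow_succ]
  ring

theorem coeff_pderiv' (k : ℕ+) (m : ℕ+ →₀ ℕ) (g : SymFun F) :
    (MvPolynomial.pderiv k g).coeff m = (m k + 1) * g.coeff (m + Finsupp.single k 1) := by
  classical
  induction g using MvPolynomial.induction_on' with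
  | monomial u a =>
    rw [MvPolynomial.pderiv_monomial, MvPolynomial.coeff_monomial, MvPolynomial.coeff_monomial]
    by_cases h : u = m + Finsupp.single k 1
    · subst h; simp [mul_comm]
    · rw [if_neg h, mul_zero]
      split_ifs with h2
      · have : u k = 0 := by
          by_contra h3
          apply h
          rw [← h2, tsub_add_cancel_of_le]
          rw [Finsupp.single_le_iff]
          exact Nat.pos_of_ne_zero h3
        simp [this]
      · rfl
  | add p q hp hq => rw [map_add, MvPolynomial.coeff_add, hp, hq, MvPolynomial.coeff_add]; ring

/-- Multiplication by `p_k` is adjoint to `k (1 - q ^ k) / (1 - t ^ k) ∂ / ∂ p_k`. -/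
theorem macForm_X_mul (q t : F) (k : ℕ+) (f g : SymFun F) :
    macForm q t (MvPolynomial.X k * f) g =
      (k : ℕ) * kap q t k * macForm q t f (MvPolynomial.pderiv k g) := by
  induction f using MvPolynomial.induction_on' with
  | monomial u a =>
    rw [mul_comm, MvPolynomial.X, MvPolynomial.monomial_mul, macForm_monomial, macForm_monomial,
      normPowerSum_add_single, coeff_pderiv']
    ring
  | add p q hp hq => rw [mul_add, map_add, LinearMap.add_apply, hp, hq, map_add,
      LinearMap.add_apply]; ring

theorem normPowerSum_ne_zero [CharZero F] {q t : F} (hq : ∀ n : ℕ, 0 < n → q ^ n ≠ 1)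
    (ht : ∀ n : ℕ, 0 < n → t ^ n ≠ 1) (m : ℕ+ →₀ ℕ) : normPowerSum q t m ≠ 0 := by
  rw [normPowerSum, Finsupp.prod]
  refine Finset.prod_ne_zero_iff.mpr fun k _ => ?_
  have h1 : ((k : ℕ) : F) ≠ 0 := by exact_mod_cast k.ne_zero
  have h2 : (((m k).factorial : ℕ) : F) ≠ 0 := by exact_mod_cast (m k).factorial_ne_zero
  exact mul_ne_zero (mul_ne_zero (pow_ne_zero _ h1) h2)
    (pow_ne_zero _ (div_ne_zero (sub_ne_zero.mpr (hq k k.pos).symm)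
      (sub_ne_zero.mpr (ht k k.pos).symm)))

theorem eq_zero_of_macForm [CharZero F] {q t : F} (hq : ∀ n : ℕ, 0 < n → q ^ n ≠ 1)
    (ht : ∀ n : ℕ, 0 < n → t ^ n ≠ 1) {f : SymFun F} (h : ∀ g, macForm q t f g = 0) : f = 0 := by
  ext m
  have := h (MvPolynomial.monomial m 1)
  rw [macForm_comm, macForm_monomial, one_mul] at this
  simpa using (mul_eq_zero.mp this).resolve_right (normPowerSum_ne_zero hq ht m)

theorem shift_pderiv (d : ℕ → F) (k : ℕ+) (f : SymFun F) (r : ℕ) :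
    shiftCoeff d r (MvPolynomial.pderiv k f) = MvPolynomial.pderiv k (shiftCoeff d r f) := by
  induction f using MvPolynomial.induction_on generalizing r with
  | C a =>
    have : shift d (MvPolynomial.C a) = Polynomial.C (MvPolynomial.C a) := by
      rw [← MvPolynomial.algebraMap_eq, AlgHom.commutes,
        IsScalarTower.algebraMap_apply F (SymFun F) (Polynomial (SymFun F))]; rfl
    rw [MvPolynomial.pderiv_C, map_zero, shiftCoeff_apply, this, Polynomial.coeff_C]
    split_ifs <;> simp
  | add f g hf hg => simp only [map_add, hf, hg]
  | mul_X f n hf =>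
    have key : ∀ (g : SymFun F) r, shiftCoeff d r (g * MvPolynomial.X n) =
        shiftCoeff d r g * MvPolynomial.X n +
          if (n : ℕ) ≤ r then shiftCoeff d (r - n) g * MvPolynomial.C (d n) else 0 := by
      intro g r
      simp only [shiftCoeff_apply]
      rw [map_mul, shift_X, mul_add, Polynomial.coeff_add, Polynomial.coeff_mul_C, ← mul_assoc,
        Polynomial.coeff_mul_X_pow', Polynomial.coeff_mul_C]
    classical
    rw [Derivation.leibniz, key, map_add, smul_eq_mul, smul_eq_mul, mul_comm (MvPolynomial.X n),
      map_add, key, hf, MvPolynomial.pderiv_X, Derivation.leibniz, MvPolynomial.pderiv_X]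
    have e : ∀ g : SymFun F, shiftCoeff d r (g * (Pi.single k (1 : SymFun F) : ℕ+ → SymFun F) n) =
        shiftCoeff d r g * (Pi.single k (1 : SymFun F) : ℕ+ → SymFun F) n := by
      intro g
      by_cases h : n = k
      · subst h; simp
      · simp [Pi.single_eq_of_ne h]
    rw [e, hf, smul_eq_mul, smul_eq_mul]
    split_ifs with hn
    · rw [Derivation.leibniz, MvPolynomial.pderiv_C]
      simp only [smul_eq_mul, mul_zero, zero_add]
      ring
    · rw [map_zero]
      ring

theorem shiftCoeff_X_mul (d : ℕ → F) (n : ℕ+) (g : SymFun F) (r : ℕ) :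
    shiftCoeff d r (MvPolynomial.X n * g) = MvPolynomial.X n * shiftCoeff d r g +
      if (n : ℕ) ≤ r then MvPolynomial.C (d n) * shiftCoeff d (r - n) g else 0 := by
  simp only [shiftCoeff_apply]
  rw [map_mul, shift_X, add_mul, Polynomial.coeff_add, Polynomial.coeff_C_mul, mul_assoc,
    Polynomial.coeff_C_mul, Polynomial.coeff_X_pow_mul']
  split_ifs <;> simp

theorem shiftCoeff_C (d : ℕ → F) (a : F) (r : ℕ) :
    shiftCoeff d r (MvPolynomial.C a) = if r = 0 then MvPolynomial.C a else 0 := by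
  have : shift d (MvPolynomial.C a) = Polynomial.C (MvPolynomial.C a) := by
    rw [← MvPolynomial.algebraMap_eq, AlgHom.commutes,
      IsScalarTower.algebraMap_apply F (SymFun F) (Polynomial (SymFun F))]; rfl
  rw [shiftCoeff_apply, this, Polynomial.coeff_C]

/-- The pairing with `1` is the evaluation of all power sums at `0`. -/
theorem macForm_one_left (q t : F) (g : SymFun F) :
    macForm q t 1 g = MvPolynomial.constantCoeff g := by
  have : (1 : SymFun F) = MvPolynomial.monomial 0 1 := rfl
  rw [this, macForm_monomial]
  simp [normPowerSum, MvPolynomial.constantCoeff_eq]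

theorem macForm_hSeries_one [CharZero F] (q t : F) (c : ℕ → F) (r : ℕ) (h : SymFun F) :
    macForm q t (hSeries c r) h =
      MvPolynomial.constantCoeff (shiftCoeff (fun n => c n * kap q t n) r h) := by
  induction h using MvPolynomial.induction_on generalizing r with
  | C a =>
    have h1 : (MvPolynomial.C a : SymFun F) = a • 1 := by
      rw [MvPolynomial.smul_eq_C_mul, mul_one]
    rw [shiftCoeff_C, h1, map_smul, macForm_comm, macForm_one_left]
    cases r with
    | zero => simp
    | succ r =>
      have hr : ((r : F) + 1) ≠ 0 := by exact_mod_cast Nat.succ_ne_zero r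
      have h2 := congrArg MvPolynomial.constantCoeff (hSeries_succ c r)
      have h3 : ∀ n, MvPolynomial.constantCoeff (pSum F (n + 1)) = 0 := fun n => by
        have : pSum F (n + 1) = MvPolynomial.X n.succPNat := pSum_coe n.succPNat
        rw [this, MvPolynomial.constantCoeff_X]
      simp only [map_mul, map_sum, h3, map_add, map_natCast, map_one, mul_zero, zero_mul,
        Finset.sum_const_zero] at h2
      rw [(mul_eq_zero.mp h2).resolve_right hr]
      simp
  | add f g hf hg => simp only [map_add, hf, hg]
  | mul_X f k hf =>
    rw [mul_comm, macForm_comm, macForm_X_mul, macForm_comm, pderiv_hSeries, shiftCoeff_X_mul,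
      map_add, map_mul, MvPolynomial.constantCoeff_X, zero_mul, zero_add]
    split_ifs with h
    · have hk : ((k : ℕ) : F) ≠ 0 := by exact_mod_cast k.ne_zero
      rw [MvPolynomial.C_mul', map_smul, LinearMap.smul_apply, hf, map_mul,
        MvPolynomial.constantCoeff_C, smul_eq_mul]
      field_simp
    · simp

/-- Multiplication by the coefficients of `exp (∑ c n p_n w ^ n / n)` is adjoint to a shift of
the power sums. -/
theorem macForm_hSeries_mul [CharZero F] (q t : F) (c : ℕ → F) (r : ℕ) (f h : SymFun F) :
    macForm q t (hSeries c r * f) h =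
      macForm q t f (shiftCoeff (fun n => c n * kap q t n) r h) := by
  induction f using MvPolynomial.induction_on generalizing h with
  | C a =>
    have h1 : (MvPolynomial.C a : SymFun F) = a • 1 := by
      rw [MvPolynomial.smul_eq_C_mul, mul_one]
    rw [h1, mul_smul_comm, mul_one, map_smul, map_smul, LinearMap.smul_apply,
      LinearMap.smul_apply, macForm_hSeries_one, macForm_one_left]
  | add f g hf hg => simp only [mul_add, map_add, LinearMap.add_apply, hf, hg]
  | mul_X f k hf =>
    rw [mul_comm f, mul_left_comm, macForm_X_mul, hf, macForm_X_mul, shift_pderiv]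

/-! ### Vertex operators -/

/-- The `Λ`-linear map `X ^ r ↦ hSeries g (r + m)`. -/
def contract (g : ℕ → F) (m : ℕ) : Polynomial (SymFun F) →ₗ[SymFun F] SymFun F :=
  Polynomial.lsum fun r => LinearMap.mulLeft (SymFun F) (hSeries g (r + m))

theorem contract_eq (g : ℕ → F) (m : ℕ) (p : Polynomial (SymFun F)) {K : ℕ}
    (hK : p.natDegree < K) :
    contract g m p = ∑ r ∈ Finset.range K, hSeries g (r + m) * p.coeff r := by
  rw [contract, Polynomial.lsum_apply, Polynomial.sum_over_range' _ _ _ hK]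
  · simp
  · simp

theorem contract_X_mul (g : ℕ → F) (m : ℕ) (p : Polynomial (SymFun F)) :
    contract g m (Polynomial.X * p) = contract g (m + 1) p := by
  rw [contract_eq g m (K := p.natDegree + 2), contract_eq g (m + 1) p (Nat.lt_succ_self _),
    Finset.sum_range_succ']
  · simp only [Polynomial.coeff_X_mul, Polynomial.mul_coeff_zero, Polynomial.coeff_X_zero,
      zero_mul, mul_zero, add_zero]
    exact Finset.sum_congr rfl fun r _ => by rw [add_assoc, add_comm 1 m]
  · have := Polynomial.natDegree_mul_le (p := (Polynomial.X : Polynomial (SymFun F))) (q := p)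
    have h2 := Polynomial.natDegree_X_le (R := SymFun F)
    omega

/-- The mode of degree `m` of the vertex operator
`exp (∑ g n p_n w ^ n / n) exp (∑ d n (∂ / ∂ p_n) w ^ (-n))`. -/
def vertexOp (g d : ℕ → F) (m : ℕ) : SymFun F →ₗ[F] SymFun F :=
  (contract g m).restrictScalars F ∘ₗ (shift d).toLinearMap

theorem vertexOp_eq (g d : ℕ → F) (m : ℕ) (f : SymFun F) {K : ℕ}
    (hK : (shift d f).natDegree < K) :
    vertexOp g d m f = ∑ r ∈ Finset.range K, hSeries g (r + m) * shiftCoeff d r f :=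
  contract_eq g m _ hK

theorem shiftCoeff_eq_zero (d : ℕ → F) (f : SymFun F) {r : ℕ}
    (h : (shift d f).natDegree < r) : shiftCoeff d r f = 0 :=
  Polynomial.coeff_eq_zero_of_natDegree_lt h

theorem macForm_vertexOp [CharZero F] (q t : F) {g d : ℕ → F} {α : F}
    (hg : ∀ n, g n * kap q t n = α ^ n * d n) (f h : SymFun F) :
    macForm q t (vertexOp g d 0 f) h = macForm q t f (vertexOp g d 0 h) := by
  set K := max ((shift d f).natDegree + 1) ((shift d h).natDegree + 1) with hK
  have h1 : (shift d f).natDegree < K := by omega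
  have h2 : (shift d h).natDegree < K := by omega
  rw [macForm_comm q t f, vertexOp_eq g d 0 f h1, vertexOp_eq g d 0 h h2, map_sum, map_sum,
    LinearMap.sum_apply, LinearMap.sum_apply]
  refine Finset.sum_congr rfl fun r _ => ?_
  have hd : (fun n => g n * kap q t n) = fun n => α ^ n * d n := funext hg
  rw [macForm_hSeries_mul, macForm_hSeries_mul, hd, shiftCoeff_rescale, shiftCoeff_rescale,
    map_smul, map_smul, add_zero, macForm_comm]

end

/-! ### Commutation relations -/

section

variable {F : Type*} [Field F]

/-- The mode of degree `m` of the Macdonald vertex operator; for `m = 0` this is, up to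
normalization, the Macdonald operator in infinitely many variables. -/
def macOp (q t : F) (m : ℕ) : SymFun F →ₗ[F] SymFun F :=
  vertexOp (fun n => 1 - t⁻¹ ^ n) (fun n => q ^ n - 1) m

/-- The elementary symmetric function `e_r`. -/
def eFun (F : Type*) [Field F] (r : ℕ) : SymFun F := hSeries (fun n => -(-1) ^ n) r

theorem eFun_zero : eFun F 0 = 1 := hSeries_zero _

theorem eFun_one [CharZero F] : eFun F 1 = MvPolynomial.X 1 := by
  have h : pSum F 1 = MvPolynomial.X 1 := pSum_coe 1
  rw [eFun, hSeries_one, h]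
  simp

theorem shift_eFun_succ [CharZero F] (q : F) (s : ℕ) :
    shift (fun n => q ^ n - 1) (eFun F (s + 1)) +
        Polynomial.X * shift (fun n => q ^ n - 1) (eFun F s) =
      Polynomial.C (eFun F (s + 1)) +
        Polynomial.C (MvPolynomial.C q * eFun F s) * Polynomial.X := by
  have hκ : IsPowerExp (fun n => -(-1) ^ n * (q ^ n - 1))
      ((1 - PowerSeries.C (-q) * PowerSeries.X) * PowerSeries.mk fun n => (-1 : F) ^ n) :=
    ((isPowerExp_one_sub (-q)).mul (isPowerExp_geom (-1 : F))).congr fun n => by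
      rw [neg_pow q]; ring
  have h0 : ∀ i, PowerSeries.coeff (i + 1)
      ((1 - PowerSeries.C (-q) * PowerSeries.X) * PowerSeries.mk fun n => (-1 : F) ^ n) =
      (-1) ^ (i + 1) + q * (-1) ^ i := fun i => by
    rw [sub_mul, one_mul, mul_assoc, map_sub, PowerSeries.coeff_C_mul,
      PowerSeries.coeff_succ_X_mul]
    simp
  have h00 : PowerSeries.coeff 0
      ((1 - PowerSeries.C (-q) * PowerSeries.X) * PowerSeries.mk fun n => (-1 : F) ^ n) = 1 := by
    simp
  rw [eFun, eFun, shift_hSeries _ _ hκ, shift_hSeries _ _ hκ, Finset.Nat.sum_antidiagonal_succ,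
    Finset.mul_sum, add_assoc, ← Finset.sum_add_distrib, h00, MvPolynomial.C_1, one_mul, pow_zero,
    mul_one]
  congr 1
  rw [Finset.sum_eq_single (0, s)]
  · simp only [h0, h00]
    simp only [map_add, map_mul, map_pow, map_neg, map_one]
    ring
  · rintro ⟨i, j⟩ _ hne
    simp only [h0]
    obtain _ | i := i
    · rename_i hmem
      exfalso
      apply hne
      simpa using hmem
    · simp only [h0]
      simp only [map_add, map_mul, map_pow, map_neg, map_one]
      ring
  · intro h; simp at h

/-- The relation between `E`, `E₁` and the multiplications by `e_s` and `e_{s+1}`. Translating `p_n`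
multiplies `∑ e_s z ^ s` by `(1 + q X z) / (1 + X z)`, and clearing the denominator leaves two terms. -/
theorem macOp_eFun_mul [CharZero F] (q t : F) (s : ℕ) (f : SymFun F) :
    macOp q t 0 (eFun F (s + 1) * f) + macOp q t 1 (eFun F s * f) =
      eFun F (s + 1) * macOp q t 0 f + MvPolynomial.C q * eFun F s * macOp q t 1 f := by
  have h : ∀ m (f : SymFun F), macOp q t m f =
    contract (fun n => 1 - t⁻¹ ^ n) m (shift (fun n => q ^ n - 1) f) := fun _ _ => rfl
  rw [h, h, h, h, ← contract_X_mul, ← contract_X_mul, ← map_add, map_mul, map_mul, ← mul_assoc,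
    ← add_mul, shift_eFun_succ, add_mul, map_add, mul_assoc, ← Polynomial.smul_eq_C_mul,
    ← Polynomial.smul_eq_C_mul, map_smul, map_smul]
  simp

theorem macOp_p1_comm [CharZero F] (q t : F) (f : SymFun F) :
    macOp q t 0 (MvPolynomial.X 1 * f) - MvPolynomial.X 1 * macOp q t 0 f =
      (q - 1) • macOp q t 1 f := by
  have h := macOp_eFun_mul q t 0 f
  rw [zero_add, eFun_one, eFun_zero, one_mul, mul_one] at h
  rw [sub_smul, one_smul, MvPolynomial.smul_eq_C_mul]
  linear_combination h

theorem geom_mul_one_sub (a : F) :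
    (PowerSeries.mk fun n => a ^ n) * (1 - PowerSeries.C a * PowerSeries.X) = 1 := by
  ext n
  rw [mul_sub, mul_one, ← mul_assoc, map_sub]
  cases n with
  | zero => simp
  | succ n =>
    rw [PowerSeries.coeff_succ_mul_X, PowerSeries.coeff_mul_C]
    simp [PowerSeries.coeff_one, pow_succ]

/-- The partial fraction expansion of `(1 - X) (1 - a b X) / ((1 - a X) (1 - b X))`. -/
theorem isPowerExp_partialFraction [CharZero F] {a b B : F} (hB : B * (a - b) = (1 - a) * (1 - b)) :
    IsPowerExp (fun n => a ^ n + b ^ n - 1 - (a * b) ^ n)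
      (1 - PowerSeries.C B * ((PowerSeries.mk fun n => a ^ n) - PowerSeries.mk fun n => b ^ n)) := by
  have h := (((isPowerExp_one_sub (1 : F)).mul (isPowerExp_one_sub (a * b))).mul
    ((isPowerExp_geom a).mul (isPowerExp_geom b)))
  have ha := geom_mul_one_sub a
  have hb := geom_mul_one_sub b
  have hB' := congrArg (PowerSeries.C (R := F)) hB
  simp only [map_mul, map_sub, map_one] at hB' h
  convert h.congr (b := fun n => a ^ n + b ^ n - 1 - (a * b) ^ n) fun n => by ring using 1
  generalize PowerSeries.mk (fun n => a ^ n) = Ga at *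
  generalize PowerSeries.mk (fun n => b ^ n) = Gb at *
  generalize PowerSeries.C a = Ca at *
  generalize PowerSeries.C b = Cb at *
  generalize PowerSeries.C B = CB at *
  generalize (PowerSeries.X : PowerSeries F) = X at *
  linear_combination (-Gb * (1 - Cb * X) + CB * Gb * 0) * ha - hb + CB * (Ga * hb - Gb * ha)
    - Ga * Gb * X * hB'

theorem shiftCoeff_comm (c d : ℕ → F) (r s : ℕ) (f : SymFun F) :
    shiftCoeff c r (shiftCoeff d s f) = shiftCoeff d s (shiftCoeff c r f) := by
  induction f using MvPolynomial.induction_on generalizing r s with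
  | C a => simp only [shiftCoeff_C]; split_ifs <;> simp_all [shiftCoeff_C]
  | add f g hf hg => simp only [map_add, hf, hg]
  | mul_X f k hf =>
    have hC : ∀ (c : ℕ → F) r (a : F) (g : SymFun F), shiftCoeff c r (MvPolynomial.C a * g) =
        MvPolynomial.C a * shiftCoeff c r g := fun c r a g => by
      rw [MvPolynomial.C_mul', map_smul, MvPolynomial.C_mul']
    rw [mul_comm f]
    simp only [shiftCoeff_X_mul, map_add]
    split_ifs <;> simp only [hC, hf, map_zero] <;> ring

/-- The product of a mode of a vertex operator with multiplication by `hSeries c n`, in normal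
order. -/
theorem vertexOp_hSeries_mul [CharZero F] (g d c : ℕ → F) {κ : PowerSeries F}
    (hκ : IsPowerExp (fun n => c n * d n) κ) (m n : ℕ) (f : SymFun F) :
    vertexOp g d m (hSeries c n * f) = ∑ k ∈ Finset.range (n + 1),
      MvPolynomial.C (PowerSeries.coeff k κ) * hSeries c (n - k) * vertexOp g d (m + k) f := by
  have h : ∀ m (f : SymFun F), vertexOp g d m f = contract g m (shift d f) := fun _ _ => rfl
  have hX : ∀ k (p : Polynomial (SymFun F)), contract g m (Polynomial.X ^ k * p) =
      contract g (m + k) p := by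
    intro k
    induction k with
    | zero => intro p; simp
    | succ k ih => intro p; rw [pow_succ, mul_assoc, ih, contract_X_mul, add_assoc]
  rw [h, map_mul, shift_hSeries _ _ hκ, Finset.Nat.sum_antidiagonal_eq_sum_range_succ_mk,
    Finset.sum_mul, map_sum]
  refine Finset.sum_congr rfl fun k _ => ?_
  rw [mul_assoc, ← Polynomial.smul_eq_C_mul, map_smul, hX, smul_eq_mul, h]

theorem hSeries_add [CharZero F] (c d : ℕ → F) (α : F) (m : ℕ) :
    hSeries (fun n => c n + α ^ n * d n) m = ∑ x ∈ antidiagonal m,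
      hSeries c x.1 * (MvPolynomial.C α ^ x.2 * hSeries d x.2) := by
  have h := ((isPowerExp_hSeries c).mul
    ((isPowerExp_hSeries d).rescale (MvPolynomial.C α))).congr
      (b := fun n => MvPolynomial.C (c n + α ^ n * d n) * pSum F n) fun n => by
        rw [map_add, map_mul, map_pow]; ring
  have h2 := congrArg (PowerSeries.coeff m) ((isPowerExp_hSeries _).unique h)
  rw [PowerSeries.coeff_mk, PowerSeries.coeff_mul] at h2
  rw [h2]
  simp [PowerSeries.coeff_rescale]

theorem hSeries_eq_zero [CharZero F] {c : ℕ → F} (hc : ∀ n, c n = 0) (m : ℕ) :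
    hSeries c (m + 1) = 0 := by
  have h2 := congrArg (PowerSeries.coeff (m + 1))
    ((isPowerExp_hSeries c).unique (isPowerExp_one.congr fun n => by simp [hc]))
  rw [PowerSeries.coeff_mk, PowerSeries.coeff_one] at h2
  simpa using h2

/-- The normally ordered coefficient of the commutator of two opposite Macdonald vertex
operators. -/
theorem commutator_coeff [CharZero F] {q t : F} (hq : q ≠ 0) (ht : t ≠ 0)
    {B : F} {gb g : ℕ → F} (hgb : ∀ n, gb n = 1 - t ^ n) (hg : ∀ n, g n = 1 - t⁻¹ ^ n)
    {κ κ' : PowerSeries F}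
    (hκ : ∀ k, PowerSeries.coeff k κ = (if k = 0 then 1 else 0) + B * (q⁻¹ ^ k - t⁻¹ ^ k))
    (hκ' : ∀ k, PowerSeries.coeff k κ' = (if k = 0 then 1 else 0) - B * (q ^ k - t ^ k))
    (r s : ℕ) :
    ∑ k ∈ Finset.range (s + 1 + 1), MvPolynomial.C (PowerSeries.coeff k κ) *
        hSeries g (s + 1 - k) * hSeries gb (r + k) -
      ∑ k ∈ Finset.range (r + 1), MvPolynomial.C (PowerSeries.coeff k κ') *
        hSeries gb (r - k) * hSeries g (s + 1 + k) =
      MvPolynomial.C (B * q⁻¹ ^ (s + 1)) * hSeries (fun n => gb n + q ^ n * g n) (r + s + 1) := by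
  have hV : hSeries (fun n => gb n + t ^ n * g n) (r + s + 1) = 0 :=
    hSeries_eq_zero (fun n => by
      rw [hgb, hg, inv_pow]; have := pow_ne_zero n ht; field_simp; ring) _
  have hU : MvPolynomial.C (B * q⁻¹ ^ (s + 1)) *
        hSeries (fun n => gb n + q ^ n * g n) (r + s + 1) =
      MvPolynomial.C (B * q⁻¹ ^ (s + 1)) * hSeries (fun n => gb n + q ^ n * g n) (r + s + 1) -
      MvPolynomial.C (B * t⁻¹ ^ (s + 1)) * hSeries (fun n => gb n + t ^ n * g n) (r + s + 1) := by
    rw [hV]; ring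
  rw [hU, hSeries_add, hSeries_add, Finset.mul_sum, Finset.mul_sum, ← Finset.sum_sub_distrib,
    Finset.Nat.sum_antidiagonal_eq_sum_range_succ_mk,
    show (r + s + 1).succ = (r + 1) + (s + 1) by omega, Finset.sum_range_succ']
  conv_rhs => rw [Finset.sum_range_add, ← Finset.sum_range_reflect _ (r + 1)]
  have h1 : ∀ k ∈ Finset.range (r + 1), MvPolynomial.C (PowerSeries.coeff k κ') *
        hSeries gb (r - k) * hSeries g (s + 1 + k) =
      (if k = 0 then hSeries gb r * hSeries g (s + 1) else 0) -
      MvPolynomial.C (B * (q ^ k - t ^ k)) * hSeries gb (r - k) * hSeries g (s + 1 + k) := by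
    intro k _
    rw [hκ']
    split_ifs with h
    · subst h; simp
    · rw [zero_sub, zero_sub, map_neg]; ring
  rw [Finset.sum_congr rfl h1, Finset.sum_sub_distrib, Finset.sum_ite_eq' , if_pos (by simp), hκ]
  simp only [if_pos, pow_zero, sub_self, mul_zero, add_zero, map_one, one_mul, Nat.sub_zero]
  have h2 : ∀ k ∈ Finset.range (s + 1), MvPolynomial.C (PowerSeries.coeff (k + 1) κ) *
        hSeries g (s + 1 - (k + 1)) * hSeries gb (r + (k + 1)) =
      MvPolynomial.C (B * q⁻¹ ^ (s + 1)) * (hSeries gb (r + 1 + k) *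
        (MvPolynomial.C q ^ (r + s + 1 - (r + 1 + k)) * hSeries g (r + s + 1 - (r + 1 + k)))) -
      MvPolynomial.C (B * t⁻¹ ^ (s + 1)) * (hSeries gb (r + 1 + k) *
        (MvPolynomial.C t ^ (r + s + 1 - (r + 1 + k)) * hSeries g (r + s + 1 - (r + 1 + k)))) := by
    intro k hk
    rw [Finset.mem_range] at hk
    rw [hκ, if_neg (Nat.succ_ne_zero k), zero_add,
      show r + s + 1 - (r + 1 + k) = s - k by omega, show s + 1 - (k + 1) = s - k by omega,
      show r + (k + 1) = r + 1 + k by omega]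
    have e : ∀ x : F, x ≠ 0 → x⁻¹ ^ (k + 1) = x⁻¹ ^ (s + 1) * x ^ (s - k) := by
      intro x hx
      rw [show s + 1 = (k + 1) + (s - k) by omega, pow_add _ (k + 1), mul_assoc, ← mul_pow,
        inv_mul_cancel₀ hx, one_pow, mul_one]
    rw [e q hq, e t ht]
    simp only [map_mul, map_sub, map_pow]
    ring
  have h3 : ∀ k ∈ Finset.range (r + 1), MvPolynomial.C (B * (q ^ k - t ^ k)) *
        hSeries gb (r - k) * hSeries g (s + 1 + k) =
      MvPolynomial.C (B * q⁻¹ ^ (s + 1)) * (hSeries gb (r + 1 - 1 - k) *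
        (MvPolynomial.C q ^ (r + s + 1 - (r + 1 - 1 - k)) *
          hSeries g (r + s + 1 - (r + 1 - 1 - k)))) -
      MvPolynomial.C (B * t⁻¹ ^ (s + 1)) * (hSeries gb (r + 1 - 1 - k) *
        (MvPolynomial.C t ^ (r + s + 1 - (r + 1 - 1 - k)) *
          hSeries g (r + s + 1 - (r + 1 - 1 - k)))) := by
    intro k hk
    rw [Finset.mem_range] at hk
    rw [show r + s + 1 - (r + 1 - 1 - k) = s + 1 + k by omega,
      show r + 1 - 1 - k = r - k by omega]
    have e : ∀ x : F, x ≠ 0 → x ^ k = x⁻¹ ^ (s + 1) * x ^ (s + 1 + k) := by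
      intro x hx
      rw [pow_add x (s + 1), ← mul_assoc, ← mul_pow, inv_mul_cancel₀ hx, one_pow, one_mul]
    rw [e q hq, e t ht]
    simp only [map_mul, map_sub, map_pow]
    ring
  rw [Finset.sum_congr rfl h2, Finset.sum_congr rfl h3]
  ring

/-- The commutator of the modes `0` and `1` of the two opposite Macdonald vertex operators. -/
theorem macOp_inv_comm [CharZero F] {q t : F} (hq : q ≠ 0) (ht : t ≠ 0) (hqt : q ≠ t)
    (f : SymFun F) :
    macOp q⁻¹ t⁻¹ 0 (macOp q t 1 f) - macOp q t 1 (macOp q⁻¹ t⁻¹ 0 f) =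
      ((q - 1) * (1 - t) ^ 2 / (q * t)) • (MvPolynomial.X 1 * f) := by
  set g : ℕ → F := fun n => 1 - t⁻¹ ^ n with hg
  set d : ℕ → F := fun n => q ^ n - 1 with hd
  set gb : ℕ → F := fun n => 1 - t⁻¹⁻¹ ^ n with hgb
  set db : ℕ → F := fun n => q⁻¹ ^ n - 1 with hdb
  have hqt' : q - t ≠ 0 := sub_ne_zero.mpr hqt
  set B : F := (1 - q) * (1 - t) / (q - t) with hB
  have hκ := isPowerExp_partialFraction (a := q⁻¹) (b := t⁻¹) (B := -B) (by
    rw [hB]; field_simp; ring)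
  have hκ' := isPowerExp_partialFraction (a := q) (b := t) (B := B) (by
    rw [hB]; field_simp)
  set κ := 1 - PowerSeries.C (-B) * ((PowerSeries.mk fun n => q⁻¹ ^ n) -
    PowerSeries.mk fun n => t⁻¹ ^ n) with hκd
  set κ' := 1 - PowerSeries.C B * ((PowerSeries.mk fun n => q ^ n) -
    PowerSeries.mk fun n => t ^ n) with hκd'
  have hκ1 : IsPowerExp (fun n => g n * db n) κ := hκ.congr fun n => by
    simp only [hg, hdb]; rw [mul_pow]; ring
  have hκ1' : IsPowerExp (fun n => gb n * d n) κ' := hκ'.congr fun n => by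
    simp only [hgb, hd, inv_inv]; rw [mul_pow]; ring
  have hκ2 : ∀ k, PowerSeries.coeff k κ = (if k = 0 then 1 else 0) + B * (q⁻¹ ^ k - t⁻¹ ^ k) :=
    fun k => by
      rw [hκd, map_sub, PowerSeries.coeff_C_mul, map_sub, PowerSeries.coeff_one]; simp
  have hκ2' : ∀ k, PowerSeries.coeff k κ' = (if k = 0 then 1 else 0) - B * (q ^ k - t ^ k) :=
    fun k => by
      rw [hκd', map_sub, PowerSeries.coeff_C_mul, map_sub, PowerSeries.coeff_one]; simp
  -- A bound beyond which all coefficients of the shifts involved vanish.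
  obtain ⟨K, hK1, hK2, hK3, hK4⟩ : ∃ K, (shift d f).natDegree < K ∧ (shift db f).natDegree < K ∧
      (∀ s, (shift db (shiftCoeff d s f)).natDegree < K) ∧
      (∀ s, (shift d (shiftCoeff db s f)).natDegree < K) := by
    have key : ∀ c e : ℕ → F, ∃ K, ∀ s, (shift c (shiftCoeff e s f)).natDegree < K := by
      intro c e
      refine ⟨(Finset.range ((shift e f).natDegree + 1)).sup
        (fun s => (shift c (shiftCoeff e s f)).natDegree) + 1, fun s => Nat.lt_succ_of_le ?_⟩
      by_cases hs : s < (shift e f).natDegree + 1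
      · exact Finset.le_sup (f := fun s => (shift c (shiftCoeff e s f)).natDegree)
          (Finset.mem_range.mpr hs)
      · rw [shiftCoeff_eq_zero e f (by omega), map_zero, Polynomial.natDegree_zero]
        exact Nat.zero_le _
    obtain ⟨K1, h1⟩ := key db d
    obtain ⟨K2, h2⟩ := key d db
    refine ⟨max (max ((shift d f).natDegree + 1) ((shift db f).natDegree + 1)) (max K1 K2),
      by omega, by omega, fun s => ?_, fun s => ?_⟩
    · have := h1 s; omega
    · have := h2 s; omega
  have e1 : macOp q⁻¹ t⁻¹ 0 (macOp q t 1 f) = ∑ s ∈ Finset.range K, ∑ r ∈ Finset.range K,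
      (∑ k ∈ Finset.range (s + 1 + 1), MvPolynomial.C (PowerSeries.coeff k κ) *
        hSeries g (s + 1 - k) * hSeries gb (r + k)) * shiftCoeff db r (shiftCoeff d s f) := by
    change vertexOp gb db 0 (vertexOp g d 1 f) = _
    rw [vertexOp_eq g d 1 f hK1, map_sum]
    refine Finset.sum_congr rfl fun s _ => ?_
    rw [vertexOp_hSeries_mul gb db g hκ1]
    simp only [Finset.sum_mul]
    rw [Finset.sum_comm]
    refine Finset.sum_congr rfl fun k _ => ?_
    rw [vertexOp_eq gb db _ _ (hK3 s), Finset.mul_sum]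
    refine Finset.sum_congr rfl fun r _ => ?_
    rw [zero_add]; ring
  have e2 : macOp q t 1 (macOp q⁻¹ t⁻¹ 0 f) = ∑ s ∈ Finset.range K, ∑ r ∈ Finset.range K,
      (∑ k ∈ Finset.range (r + 1), MvPolynomial.C (PowerSeries.coeff k κ') *
        hSeries gb (r - k) * hSeries g (s + 1 + k)) * shiftCoeff db r (shiftCoeff d s f) := by
    change vertexOp g d 1 (vertexOp gb db 0 f) = _
    rw [vertexOp_eq gb db 0 f hK2, map_sum, Finset.sum_comm]
    refine Finset.sum_congr rfl fun r _ => ?_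
    rw [vertexOp_hSeries_mul g d gb hκ1']
    simp only [Finset.sum_mul]
    rw [Finset.sum_comm]
    refine Finset.sum_congr rfl fun k _ => ?_
    rw [vertexOp_eq g d _ _ (hK4 r), Finset.mul_sum]
    refine Finset.sum_congr rfl fun s _ => ?_
    rw [add_zero, shiftCoeff_comm db d, show s + 1 + k = s + (1 + k) by omega]; ring
  set u : ℕ → F := fun n => gb n + q ^ n * g n with hu
  have e3 : macOp q⁻¹ t⁻¹ 0 (macOp q t 1 f) - macOp q t 1 (macOp q⁻¹ t⁻¹ 0 f) =
      ∑ s ∈ Finset.range K, ∑ r ∈ Finset.range K,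
        MvPolynomial.C (B * q⁻¹ ^ (s + 1)) * hSeries u (r + s + 1) *
          shiftCoeff db r (shiftCoeff d s f) := by
    rw [e1, e2, ← Finset.sum_sub_distrib]
    refine Finset.sum_congr rfl fun s _ => ?_
    rw [← Finset.sum_sub_distrib]
    refine Finset.sum_congr rfl fun r _ => ?_
    rw [← sub_mul, commutator_coeff hq ht (fun n => by simp [hgb]) (fun n => rfl) hκ2 hκ2']
  -- The two shifts cancel after rescaling one of them by `q⁻¹`.
  have e4 : contract u 1 (shift (fun n => db n + q⁻¹ ^ n * d n) f) =
      ∑ s ∈ Finset.range K, ∑ r ∈ Finset.range K, MvPolynomial.C (q⁻¹ ^ s) *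
        hSeries u (r + s + 1) * shiftCoeff db r (shiftCoeff d s f) := by
    have hX : ∀ k (p : Polynomial (SymFun F)), contract u 1 (p * Polynomial.X ^ k) =
        contract u (1 + k) p := by
      intro k
      induction k with
      | zero => intro p; simp
      | succ k ih =>
        intro p; rw [pow_succ', ← mul_assoc, ih, mul_comm, contract_X_mul, add_assoc]
    have hdeg : (shift (fun n => q⁻¹ ^ n * d n) f).natDegree < K := by
      rw [shift_rescale]
      refine lt_of_le_of_lt Polynomial.natDegree_comp_le ?_
      refine lt_of_le_of_lt ?_ hK1
      calc _ ≤ (shift d f).natDegree * 1 :=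
            Nat.mul_le_mul_left _ (((Polynomial.natDegree_C_mul_le _ _).trans
              Polynomial.natDegree_X_le))
        _ = _ := mul_one _
    rw [shift_shift, Polynomial.eval₂_eq_sum_range' _ hdeg, map_sum]
    refine Finset.sum_congr rfl fun s _ => ?_
    rw [hX, ← shiftCoeff_apply, shiftCoeff_rescale, RingHom.coe_coe, map_smul,
      ← algebraMap_smul (SymFun F) (q⁻¹ ^ s), map_smul, contract_eq u _ _ (hK3 s), Finset.smul_sum]
    refine Finset.sum_congr rfl fun r _ => ?_
    rw [shiftCoeff_apply db, smul_eq_mul, MvPolynomial.algebraMap_eq,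
      show r + (1 + s) = r + s + 1 by omega]
    ring
  have e5 : contract u 1 (shift (fun n => db n + q⁻¹ ^ n * d n) f) = hSeries u 1 * f := by
    have : (fun n => db n + q⁻¹ ^ n * d n) = fun _ => 0 := by
      funext n
      simp only [hdb, hd, inv_pow]
      have := pow_ne_zero n hq
      field_simp
      ring
    rw [this, shift_zero, contract_eq u 1 (K := 1) _ (by simp)]
    simp
  have e6 : hSeries u 1 = MvPolynomial.C ((1 - t) * (1 - q * t⁻¹)) * MvPolynomial.X 1 := by
    have h : pSum F 1 = MvPolynomial.X 1 := pSum_coe 1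
    rw [hSeries_one, h]
    congr 2
    simp only [hu, hgb, hg]
    field_simp
    ring
  have e7 : macOp q⁻¹ t⁻¹ 0 (macOp q t 1 f) - macOp q t 1 (macOp q⁻¹ t⁻¹ 0 f) =
      MvPolynomial.C (B * q⁻¹) * (hSeries u 1 * f) := by
    rw [e3, ← e5, e4, Finset.mul_sum]
    refine Finset.sum_congr rfl fun s _ => ?_
    rw [Finset.mul_sum]
    refine Finset.sum_congr rfl fun r _ => ?_
    rw [pow_succ]
    simp only [map_mul, map_pow]
    ring
  rw [e7, e6, MvPolynomial.smul_eq_C_mul, ← mul_assoc, ← mul_assoc, ← map_mul, mul_assoc]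
  congr 2
  rw [hB]
  field_simp
  ring

end

/-! ### Young diagrams -/

section

variable {F : Type*} [Field F]

theorem mem_cells_iff_of_le (Y : YoungDiagram) {N : ℕ} (hN : Y.colLen 0 ≤ N) (p : ℕ × ℕ) :
    p ∈ Y.cells ↔ p.1 ∈ Finset.range N ∧ p.2 ∈ Finset.range (Y.rowLen p.1) := by
  rw [YoungDiagram.mem_cells, Finset.mem_range, Finset.mem_range, ← YoungDiagram.mem_iff_lt_rowLen]
  refine ⟨fun h => ⟨?_, h⟩, fun h => h.2⟩
  refine lt_of_lt_of_le ?_ hN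
  rw [← YoungDiagram.mem_iff_lt_colLen]
  exact Y.up_left_mem le_rfl (Nat.zero_le _) h

@[to_additive]
theorem prod_cells {M : Type*} [CommMonoid M] (Y : YoungDiagram) {N : ℕ} (hN : Y.colLen 0 ≤ N)
    (f : ℕ × ℕ → M) :
    ∏ p ∈ Y.cells, f p = ∏ i ∈ Finset.range N, ∏ j ∈ Finset.range (Y.rowLen i), f (i, j) :=
  Finset.prod_finset_product _ _ _ (mem_cells_iff_of_le Y hN)

theorem card_eq_sum_rowLen (Y : YoungDiagram) {N : ℕ} (hN : Y.colLen 0 ≤ N) :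
    Y.card = ∑ i ∈ Finset.range N, Y.rowLen i := by
  rw [YoungDiagram.card, Finset.card_eq_sum_ones, sum_cells Y hN]
  simp

theorem rowLen_eq_zero (Y : YoungDiagram) {i : ℕ} (hi : Y.colLen 0 ≤ i) : Y.rowLen i = 0 := by
  by_contra h
  have : (i, 0) ∈ Y := YoungDiagram.mem_iff_lt_rowLen.mpr (Nat.pos_of_ne_zero h)
  rw [YoungDiagram.mem_iff_lt_colLen] at this
  omega

theorem rowLen_injective : Function.Injective YoungDiagram.rowLen := by
  intro Y Z h
  apply YoungDiagram.ext
  ext ⟨i, j⟩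
  rw [YoungDiagram.mem_cells, YoungDiagram.mem_cells, YoungDiagram.mem_iff_lt_rowLen,
    YoungDiagram.mem_iff_lt_rowLen, h]

theorem colLen_le_card (Y : YoungDiagram) : Y.colLen 0 ≤ Y.card := by
  rw [YoungDiagram.colLen_eq_card]
  exact Finset.card_le_card (Finset.filter_subset _ _)

/-- Every exponent vector is a rearrangement of the row lengths of a Young diagram. -/
theorem exists_diagram_perm {N : ℕ} (α : Fin N → ℕ) : ∃ (Y : YoungDiagram)
    (σ : Equiv.Perm (Fin N)), Y.colLen 0 ≤ N ∧ ∀ i, α i = Y.rowLen (σ i) := by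
  set τ : Equiv.Perm (Fin N) := Fin.revPerm.trans (Tuple.sort α) with hτ
  have hanti : Antitone (α ∘ τ) := by
    intro i j hij
    exact Tuple.monotone_sort α (Fin.rev_le_rev.mpr hij)
  have hw : (List.ofFn (α ∘ τ)).SortedGE := by
    rw [List.sortedGE_ofFn_iff]; exact hanti
  refine ⟨YoungDiagram.ofRowLens (List.ofFn (α ∘ τ)) hw, τ.symm, ?_, ?_⟩
  · by_contra h
    push Not at h
    rw [← YoungDiagram.mem_iff_lt_colLen, YoungDiagram.mem_ofRowLens] at h
    obtain ⟨h, _⟩ := h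
    simp at h
  · intro i
    have h := YoungDiagram.rowLen_ofRowLens (hw := hw) (⟨(τ.symm i : ℕ), by simp⟩)
    rw [h]
    simp

theorem card_of_perm {N : ℕ} {α : Fin N → ℕ} {Y : YoungDiagram} {σ : Equiv.Perm (Fin N)}
    (hY : Y.colLen 0 ≤ N) (h : ∀ i, α i = Y.rowLen (σ i)) : Y.card = ∑ i, α i := by
  rw [card_eq_sum_rowLen Y hY, Finset.sum_range]
  simp_rw [h]
  exact (Equiv.sum_comp σ fun i : Fin N => Y.rowLen i).symm

/-! ### Coefficients of monomials -/

theorem kap_ne_zero {q t : F} (hq : ∀ n : ℕ, 0 < n → q ^ n ≠ 1)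
    (ht : ∀ n : ℕ, 0 < n → t ^ n ≠ 1) {n : ℕ} (hn : 0 < n) : kap q t n ≠ 0 :=
  div_ne_zero (sub_ne_zero.mpr (hq n hn).symm) (sub_ne_zero.mpr (ht n hn).symm)

/-- Macdonald's `g_r(x; q, t)`. The products of the `g_r` are dual to the monomial symmetric
functions. -/
def gFun (q t : F) (r : ℕ) : SymFun F := hSeries (fun n => (kap q t n)⁻¹) r

theorem constantCoeff_hSeries [CharZero F] (c : ℕ → F) (r : ℕ) :
    MvPolynomial.constantCoeff (hSeries c r) = if r = 0 then 1 else 0 := by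
  have h := macForm_hSeries_one 0 0 c r 1
  have h1 : (1 : SymFun F) = MvPolynomial.C 1 := rfl
  rw [macForm_comm, macForm_one_left, h1, shiftCoeff_C] at h
  rw [h]
  split_ifs <;> simp

theorem derivation_prod {ι : Type*} [DecidableEq ι] (k : ℕ+) (s : Finset ι) (f : ι → SymFun F) :
    MvPolynomial.pderiv k (∏ i ∈ s, f i) =
      ∑ i ∈ s, (∏ j ∈ s.erase i, f j) * MvPolynomial.pderiv k (f i) := by
  induction s using Finset.induction_on with
  | empty => simp
  | insert a s ha ih =>
    rw [Finset.prod_insert ha, Derivation.leibniz, ih, Finset.sum_insert ha,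
      Finset.erase_insert ha, smul_eq_mul, smul_eq_mul, Finset.mul_sum, add_comm]
    congr 1
    refine Finset.sum_congr rfl fun i hi => ?_
    rw [Finset.erase_insert_of_ne (by rintro rfl; exact ha hi),
      Finset.prod_insert (fun h => ha (Finset.mem_of_mem_erase h)), mul_assoc]

/-- The coefficient of a monomial in a symmetric function is its pairing with a product of
the functions `g_r`. -/
theorem coeff_evalVars [CharZero F] {q t : F} (hq : ∀ n : ℕ, 0 < n → q ^ n ≠ 1)
    (ht : ∀ n : ℕ, 0 < n → t ^ n ≠ 1) (N : ℕ) (α : Fin N →₀ ℕ) (f : SymFun F) :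
    (evalVars N f).coeff α = macForm q t f (∏ i, gFun q t (α i)) := by
  classical
  induction f using MvPolynomial.induction_on generalizing α with
  | C a =>
    have h1 : (MvPolynomial.C a : SymFun F) = a • 1 := by
      rw [MvPolynomial.smul_eq_C_mul, mul_one]
    rw [h1, map_smul, map_one, map_smul, LinearMap.smul_apply, macForm_one_left, map_prod,
      MvPolynomial.coeff_smul, MvPolynomial.coeff_one]
    congr 1
    simp only [gFun, constantCoeff_hSeries]
    by_cases h : α = 0
    · subst h; simp
    · obtain ⟨i, hi⟩ := DFunLike.ne_iff.mp h
      rw [if_neg (Ne.symm h), eq_comm]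
      exact Finset.prod_eq_zero (Finset.mem_univ i) (if_neg hi)
  | add f g hf hg => simp only [map_add, MvPolynomial.coeff_add, hf, hg, LinearMap.add_apply]
  | mul_X f k hf =>
    have hk : ((k : ℕ) : F) ≠ 0 := by exact_mod_cast k.ne_zero
    have hκ := kap_ne_zero hq ht k.pos
    rw [map_mul]
    have h1 : evalVars N (MvPolynomial.X k : SymFun F) = ∑ i, MvPolynomial.X i ^ (k : ℕ) := by
      simp [evalVars, MvPolynomial.psum]
    rw [h1, Finset.mul_sum, MvPolynomial.coeff_sum, mul_comm, macForm_X_mul,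
      derivation_prod, map_sum, Finset.mul_sum]
    refine Finset.sum_congr rfl fun i _ => ?_
    rw [MvPolynomial.X_pow_eq_monomial, MvPolynomial.coeff_mul_monomial', gFun, pderiv_hSeries]
    have h2 : Finsupp.single i (k : ℕ) ≤ α ↔ (k : ℕ) ≤ α i := Finsupp.single_le_iff
    simp only [h2]
    split_ifs with h
    · rw [hf, mul_one, mul_left_comm, MvPolynomial.C_mul', map_smul, smul_eq_mul]
      have h3 : ∏ j, gFun q t ((α - Finsupp.single i (k : ℕ)) j) =
          (∏ j ∈ Finset.univ.erase i, gFun q t (α j)) * gFun q t (α i - k) := by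
        rw [← Finset.mul_prod_erase _ _ (Finset.mem_univ i), mul_comm]
        congr 1
        · refine Finset.prod_congr rfl fun j hj => ?_
          rw [Finsupp.tsub_apply, Finsupp.single_eq_of_ne (Finset.ne_of_mem_erase hj), tsub_zero]
        · simp
      rw [h3]
      simp only [gFun]
      field_simp
    · simp

/-- The product `∏ g_{λ_i}` over the rows of a Young diagram. -/
def gProd (q t : F) (Y : YoungDiagram) : SymFun F :=
  ∏ i ∈ Finset.range (Y.colLen 0), gFun q t (Y.rowLen i)

theorem gProd_eq (q t : F) (Y : YoungDiagram) {N : ℕ} (hN : Y.colLen 0 ≤ N) :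
    gProd q t Y = ∏ i : Fin N, gFun q t (Y.rowLen i) := by
  rw [← Finset.prod_range (fun i => gFun q t (Y.rowLen i)), gProd]
  refine Finset.prod_subset (by simpa using hN) fun i _ hi => ?_
  rw [rowLen_eq_zero Y (by simpa using hi), gFun, hSeries_zero]

theorem gProd_eq_of_perm (q t : F) {N : ℕ} {α : Fin N → ℕ} {Y : YoungDiagram}
    {σ : Equiv.Perm (Fin N)} (hY : Y.colLen 0 ≤ N) (h : ∀ i, α i = Y.rowLen (σ i)) :
    ∏ i, gFun q t (α i) = gProd q t Y := by
  rw [gProd_eq q t Y hY]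
  simp_rw [h]
  exact Equiv.prod_comp σ fun i : Fin N => gFun q t (Y.rowLen i)

/-- The coefficient of the monomial symmetric function `m_Y`. -/
def mCoeff (q t : F) (Y : YoungDiagram) : SymFun F →ₗ[F] F := (macForm q t).flip (gProd q t Y)

theorem mCoeff_apply (q t : F) (Y : YoungDiagram) (f : SymFun F) :
    mCoeff q t Y f = macForm q t f (gProd q t Y) := rfl

theorem coeff_evalVars_of_perm [CharZero F] {q t : F} (hq : ∀ n : ℕ, 0 < n → q ^ n ≠ 1)
    (ht : ∀ n : ℕ, 0 < n → t ^ n ≠ 1) {N : ℕ} {α : Fin N →₀ ℕ} {Y : YoungDiagram}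
    {σ : Equiv.Perm (Fin N)} (hY : Y.colLen 0 ≤ N) (h : ∀ i, α i = Y.rowLen (σ i))
    (f : SymFun F) : (evalVars N f).coeff α = mCoeff q t Y f := by
  rw [coeff_evalVars hq ht, mCoeff_apply, gProd_eq_of_perm q t hY h]

theorem adjoin_gFun [CharZero F] {q t : F} (hq : ∀ n : ℕ, 0 < n → q ^ n ≠ 1)
    (ht : ∀ n : ℕ, 0 < n → t ^ n ≠ 1) :
    Algebra.adjoin F (Set.range (gFun q t)) = ⊤ := by
  have hX : ∀ n : ℕ, pSum F (n + 1) ∈ Algebra.adjoin F (Set.range (gFun q t)) := by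
    intro n
    induction n using Nat.strong_induction_on with
    | _ n ih =>
      have hg : ∀ r, gFun q t r ∈ Algebra.adjoin F (Set.range (gFun q t)) :=
        fun r => Algebra.subset_adjoin ⟨r, rfl⟩
      have h := hSeries_succ (fun n => (kap q t n)⁻¹) n
      rw [Finset.Nat.sum_antidiagonal_eq_sum_range_succ_mk, Finset.sum_range_succ] at h
      simp only [Nat.sub_self, hSeries_zero, mul_one] at h
      have h2 : pSum F (n + 1) = kap q t (n + 1) • (hSeries (fun n => (kap q t n)⁻¹) (n + 1) *
          ((n : SymFun F) + 1) - ∑ k ∈ Finset.range n, MvPolynomial.C ((kap q t (k + 1))⁻¹) *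
            pSum F (k + 1) * hSeries (fun n => (kap q t n)⁻¹) (n - k)) := by
        rw [h, add_sub_cancel_left, MvPolynomial.smul_eq_C_mul, ← mul_assoc, ← map_mul,
          mul_inv_cancel₀ (kap_ne_zero hq ht (Nat.succ_pos n)), map_one, one_mul]
      rw [h2]
      refine Subalgebra.smul_mem _ (Subalgebra.sub_mem _ (Subalgebra.mul_mem _ (hg _)
        (Subalgebra.add_mem _ (Subalgebra.natCast_mem _ n) (Subalgebra.one_mem _)))
        (Subalgebra.sum_mem _ fun k hk => Subalgebra.mul_mem _ (Subalgebra.mul_mem _ ?_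
          (ih k (Finset.mem_range.mp hk))) (hg _))) _
      exact Subalgebra.algebraMap_mem _ _
  rw [eq_top_iff, ← MvPolynomial.adjoin_range_X]
  refine Algebra.adjoin_le ?_
  rintro _ ⟨k, rfl⟩
  have := hX (k - 1)
  rw [show (k : ℕ) - 1 + 1 = k from Nat.sub_add_cancel k.pos, pSum_coe] at this
  exact this

theorem span_gProd [CharZero F] {q t : F} (hq : ∀ n : ℕ, 0 < n → q ^ n ≠ 1)
    (ht : ∀ n : ℕ, 0 < n → t ^ n ≠ 1) : Submodule.span F (Set.range (gProd q t)) = ⊤ := by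
  have h := congrArg Subalgebra.toSubmodule (adjoin_gFun hq ht)
  rw [Algebra.adjoin_eq_span, Algebra.top_toSubmodule] at h
  rw [eq_top_iff, ← h]
  refine Submodule.span_mono fun f hf => ?_
  obtain ⟨l, hl, rfl⟩ := Submonoid.exists_list_of_mem_closure hf
  choose! r hr using hl
  obtain ⟨Y, σ, hY, hσ⟩ := exists_diagram_perm fun i : Fin l.length => r (l.get i)
  refine ⟨Y, ?_⟩
  rw [← gProd_eq_of_perm q t hY hσ]
  conv_rhs => rw [← List.ofFn_get l, List.prod_ofFn]
  exact Finset.prod_congr rfl fun i _ => hr _ (l.get_mem i)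

/-- A symmetric function is determined by its coefficients. -/
theorem eq_zero_of_mCoeff [CharZero F] {q t : F} (hq : ∀ n : ℕ, 0 < n → q ^ n ≠ 1)
    (ht : ∀ n : ℕ, 0 < n → t ^ n ≠ 1) {f : SymFun F} (h : ∀ Y, mCoeff q t Y f = 0) : f = 0 := by
  apply eq_zero_of_macForm hq ht
  intro g
  have hg : g ∈ Submodule.span F (Set.range (gProd q t)) := by rw [span_gProd hq ht]; trivial
  induction hg using Submodule.span_induction with
  | mem x hx => obtain ⟨Y, rfl⟩ := hx; exact h Y
  | zero => simp
  | add x y _ _ hx hy => rw [map_add, hx, hy, add_zero]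
  | smul a x _ hx => rw [map_smul, hx, smul_zero]

/-! ### The grading -/

/-- The homogeneous symmetric functions of degree `n`, the power sum `p_k` having degree `k`. -/
abbrev homog (F : Type*) [Field F] (n : ℕ) : Submodule F (SymFun F) :=
  MvPolynomial.weightedHomogeneousSubmodule F (fun k : ℕ+ => (k : ℕ)) n

theorem mul_mem_homog {m n : ℕ} {f g : SymFun F} (hf : f ∈ homog F m) (hg : g ∈ homog F n) :
    f * g ∈ homog F (m + n) :=
  MvPolynomial.IsWeightedHomogeneous.mul hf hg

theorem C_mem_homog (a : F) : MvPolynomial.C a ∈ homog F 0 :=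
  MvPolynomial.isWeightedHomogeneous_C _ a

theorem pSum_mem_homog (n : ℕ) : pSum F (n + 1) ∈ homog F (n + 1) := by
  have h : pSum F (n + 1) = MvPolynomial.X n.succPNat := pSum_coe n.succPNat
  rw [h]
  exact MvPolynomial.isWeightedHomogeneous_X F (fun k : ℕ+ => (k : ℕ)) n.succPNat

theorem hSeries_mem_homog [CharZero F] (c : ℕ → F) (r : ℕ) : hSeries c r ∈ homog F r := by
  induction r using Nat.strong_induction_on with
  | _ r ih =>
    cases r with
    | zero => rw [hSeries_zero]; exact C_mem_homog 1
    | succ r =>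
      have hr : ((r : F) + 1) ≠ 0 := by exact_mod_cast Nat.succ_ne_zero r
      have h : hSeries c (r + 1) = ((r : F) + 1)⁻¹ • (hSeries c (r + 1) * (r + 1)) := by
        have : ((r : SymFun F) + 1) = MvPolynomial.C ((r : F) + 1) := by simp
        rw [this, mul_comm, MvPolynomial.C_mul', smul_smul, inv_mul_cancel₀ hr, one_smul]
      rw [h, hSeries_succ]
      refine Submodule.smul_mem _ _ (Submodule.sum_mem _ ?_)
      rintro ⟨i, j⟩ hx
      rw [Finset.HasAntidiagonal.mem_antidiagonal] at hx
      simp only at hx ⊢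
      have := mul_mem_homog (mul_mem_homog (C_mem_homog (c (i + 1))) (pSum_mem_homog i))
        (ih j (by omega))
      rwa [show 0 + (i + 1) + j = r + 1 by omega] at this

theorem gProd_mem_homog [CharZero F] (q t : F) (Y : YoungDiagram) :
    gProd q t Y ∈ homog F Y.card := by
  rw [card_eq_sum_rowLen Y le_rfl, gProd]
  exact MvPolynomial.IsWeightedHomogeneous.prod _ _ _ fun i _ => hSeries_mem_homog _ _

theorem macForm_homog (q t : F) {m n : ℕ} (hmn : m ≠ n) {f g : SymFun F} (hf : f ∈ homog F m)
    (hg : g ∈ homog F n) : macForm q t f g = 0 := by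
  rw [macForm_apply, macInner]
  refine Finset.sum_eq_zero fun x hx => ?_
  have h1 := hf (MvPolynomial.mem_support_iff.mp hx)
  by_cases h2 : g.coeff x = 0
  · rw [h2]; ring
  · exact absurd (h1.symm.trans (hg h2)) hmn

theorem mCoeff_homog [CharZero F] (q t : F) {n : ℕ} {f : SymFun F} (hf : f ∈ homog F n)
    {Y : YoungDiagram} (hY : Y.card ≠ n) : mCoeff q t Y f = 0 :=
  macForm_homog q t hY.symm hf (gProd_mem_homog q t Y)

theorem mem_homog_of_mCoeff [CharZero F] {q t : F} (hq : ∀ n : ℕ, 0 < n → q ^ n ≠ 1)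
    (ht : ∀ n : ℕ, 0 < n → t ^ n ≠ 1) {n : ℕ} {f : SymFun F}
    (h : ∀ Y : YoungDiagram, Y.card ≠ n → mCoeff q t Y f = 0) : f ∈ homog F n := by
  set w : ℕ+ → ℕ := fun k => (k : ℕ)
  have hc : ∀ m, MvPolynomial.weightedHomogeneousComponent w m f ∈ homog F m := fun m =>
    MvPolynomial.weightedHomogeneousComponent_isWeightedHomogeneous m f
  have key : f - MvPolynomial.weightedHomogeneousComponent w n f = 0 := by
    apply eq_zero_of_mCoeff hq ht
    intro Y
    by_cases hY : Y.card = n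
    · have h1 : mCoeff q t Y (f - MvPolynomial.weightedHomogeneousComponent w n f) = 0 := by
        have h2 : f = ∑ᶠ m, MvPolynomial.weightedHomogeneousComponent w m f :=
          (MvPolynomial.sum_weightedHomogeneousComponent w f).symm
        rw [finsum_eq_sum _ (MvPolynomial.weightedHomogeneousComponent_finsupp f)] at h2
        rw [map_sub, sub_eq_zero]
        conv_lhs => rw [h2]
        rw [map_sum]
        by_cases hz : MvPolynomial.weightedHomogeneousComponent w n f = 0
        · rw [hz, map_zero]
          refine Finset.sum_eq_zero fun m _ => ?_
          by_cases hm : m = n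
          · rw [hm, hz, map_zero]
          · exact mCoeff_homog q t (hc m) (by omega)
        · rw [Finset.sum_eq_single n]
          · intro m _ hm
            exact mCoeff_homog q t (hc m) (by omega)
          · intro hn
            exact absurd ((Set.Finite.mem_toFinset _).mpr hz) hn
      exact h1
    · rw [map_sub, h Y hY, mCoeff_homog q t (hc n) hY, sub_zero]
  rw [sub_eq_zero] at key
  rw [key]
  exact hc n

end

/-! ### The Macdonald operator in finitely many variables -/

section

variable {F : Type*} [Field F]

theorem det_vandermonde_update {R : Type*} [CommRing R] {N : ℕ} (v : Fin N → R) (i : Fin N)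
    (y : R) : (Matrix.vandermonde (Function.update v i y)).det *
        ∏ j ∈ Finset.univ.erase i, (v i - v j) =
      (Matrix.vandermonde v).det * ∏ j ∈ Finset.univ.erase i, (y - v j) := by
  obtain _ | n := N
  · exact i.elim0
  have h0 : ∀ (v : Fin (n + 1) → R) (y : R),
      (Matrix.vandermonde (Function.update v 0 y)).det * ∏ j : Fin n, (v 0 - v j.succ) =
        (Matrix.vandermonde v).det * ∏ j : Fin n, (y - v j.succ) := by
    intro v y
    rw [Matrix.det_vandermonde, Matrix.det_vandermonde, Fin.prod_univ_succ, Fin.prod_univ_succ]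
    have h1 : ∀ f : Fin (n + 1) → R, ∏ j ∈ Finset.Ioi (0 : Fin (n + 1)), f j =
        ∏ j : Fin n, f j.succ := fun f => by
      rw [Fin.Ioi_zero_eq_map, Finset.prod_map]; rfl
    have h2 : ∏ i : Fin n, ∏ j ∈ Finset.Ioi i.succ,
        (Function.update v 0 y j - Function.update v 0 y i.succ) =
        ∏ i : Fin n, ∏ j ∈ Finset.Ioi i.succ, (v j - v i.succ) := by
      refine Finset.prod_congr rfl fun i _ => Finset.prod_congr rfl fun j hj => ?_
      have hj0 : j ≠ 0 := by
        rintro rfl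
        exact absurd (Finset.mem_Ioi.mp hj) (by simp)
      rw [Function.update_of_ne hj0, Function.update_of_ne (Fin.succ_ne_zero i)]
    rw [h2, h1, h1]
    have h3 : (∏ j : Fin n, (Function.update v 0 y j.succ - Function.update v 0 y 0)) *
        ∏ j : Fin n, (v 0 - v j.succ) =
        (∏ j : Fin n, (v j.succ - v 0)) * ∏ j : Fin n, (y - v j.succ) := by
      rw [← Finset.prod_mul_distrib, ← Finset.prod_mul_distrib]
      refine Finset.prod_congr rfl fun j _ => ?_
      rw [Function.update_of_ne (Fin.succ_ne_zero j), Function.update_self]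
      ring
    linear_combination (∏ i : Fin n, ∏ j ∈ Finset.Ioi i.succ, (v j - v i.succ)) * h3
  -- Reduce to `i = 0` by a transposition of the rows.
  set σ : Equiv.Perm (Fin (n + 1)) := Equiv.swap 0 i with hσ
  have hdet : ∀ w : Fin (n + 1) → R, (Matrix.vandermonde (w ∘ σ)).det =
      Equiv.Perm.sign σ * (Matrix.vandermonde w).det := fun w => by
    rw [← Matrix.det_permute]; rfl
  have hprod : ∀ y, ∏ j ∈ Finset.univ.erase i, (y - v j) = ∏ j : Fin n, (y - v (σ j.succ)) := by
    intro y
    rw [← Fin.prod_Ioi_zero (f := fun j => y - v (σ j))]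
    symm
    refine Finset.prod_equiv σ (fun j => ?_) fun j _ => rfl
    rw [Finset.mem_Ioi, Finset.mem_erase, Fin.pos_iff_ne_zero]
    simp only [Finset.mem_univ, and_true]
    rw [not_iff_not, hσ, Equiv.swap_apply_eq_iff, Equiv.swap_apply_right]
  have h := h0 (v ∘ σ) y
  have hu : Function.update (v ∘ σ) 0 y = Function.update v i y ∘ σ := by
    have := Function.update_comp_equiv v σ i y
    rw [this, hσ, Equiv.symm_swap, Equiv.swap_apply_right]
  rw [hu, hdet, hdet] at h
  have hσ0 : (v ∘ σ) 0 = v i := by simp [hσ]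
  rw [hσ0] at h
  rw [hprod, hprod]
  have hs : ((Equiv.Perm.sign σ : ℤ) : R) * ((Equiv.Perm.sign σ : ℤ) : R) = 1 := by
    rw [← Int.cast_mul, ← Units.val_mul, Int.units_mul_self]; simp
  simp only [Function.comp_apply] at h
  linear_combination ((Equiv.Perm.sign σ : ℤ) : R) * h +
    ((Matrix.vandermonde v).det * ∏ j : Fin n, (y - v (σ j.succ)) -
    (Matrix.vandermonde (Function.update v i y)).det * ∏ j : Fin n, (v i - v (σ j.succ))) * hs

/-- Lagrange interpolation for `∏ (z - x_j / t) - t ^ (-N) ∏ (z - x_j)` at the points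
`0, x_1, …, x_N`. -/
theorem vandermonde_partialFraction {R : Type*} [CommRing R] [IsDomain R] {N : ℕ} (x : Fin N → R)
    (hx : Function.Injective x) (hx0 : ∀ i, x i ≠ 0) {t τ : R} (htτ : t * τ = 1) :
    Polynomial.C (Matrix.vandermonde x).det *
      (∏ j, (Polynomial.X - Polynomial.C (τ * x j)) -
        Polynomial.C (τ ^ N) * ∏ j, (Polynomial.X - Polynomial.C (x j))) =
      Polynomial.C ((1 - τ) * τ ^ (N - 1)) * (Polynomial.X *
        ∑ i, Polynomial.C (Matrix.vandermonde (Function.update x i (t * x i))).det *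
          ∏ j ∈ Finset.univ.erase i, (Polynomial.X - Polynomial.C (x j))) := by
  classical
  rw [← sub_eq_zero]
  have hdeg : ∀ (s : Finset (Fin N)) (c : Fin N → R),
      (∏ j ∈ s, (Polynomial.X - Polynomial.C (c j))).natDegree ≤ s.card := by
    intro s c
    rw [Polynomial.natDegree_prod_of_monic _ _ fun j _ => Polynomial.monic_X_sub_C _]
    simp
  refine Polynomial.eq_zero_of_natDegree_lt_card_of_eval_eq_zero' _
    (insert 0 (Finset.univ.image x)) ?_ ?_
  · intro z hz
    rw [Finset.mem_insert, Finset.mem_image] at hz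
    obtain rfl | ⟨i, _, rfl⟩ := hz
    · simp only [Polynomial.eval_sub, Polynomial.eval_mul, Polynomial.eval_C,
        Polynomial.eval_prod, Polynomial.eval_X, zero_sub, zero_mul, mul_zero, sub_zero]
      have : ∏ j, (-(τ * x j)) = τ ^ N * ∏ j, (-x j) := by
        rw [Finset.prod_congr rfl (g := fun j => τ * (-x j)) fun j _ => by ring,
          Finset.prod_mul_distrib]
        simp
      rw [this]; ring
    · have hN : 0 < N := i.pos
      have hv := det_vandermonde_update x i (t * x i)
      simp only [Polynomial.eval_sub, Polynomial.eval_mul, Polynomial.eval_C,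
        Polynomial.eval_prod, Polynomial.eval_X, Polynomial.eval_finsetSum]
      rw [Finset.prod_eq_zero (f := fun j => x i - x j) (Finset.mem_univ i) (sub_self _), mul_zero,
        sub_zero,
        Finset.sum_eq_single i, hv, ← Finset.mul_prod_erase _ _ (Finset.mem_univ i)]
      · have : ∏ j ∈ Finset.univ.erase i, (t * x i - x j) =
            t ^ (N - 1) * ∏ j ∈ Finset.univ.erase i, (x i - τ * x j) := by
          rw [Finset.prod_congr rfl (g := fun j => t * (x i - τ * x j)) fun j _ => by
            rw [mul_sub, ← mul_assoc, htτ, one_mul], Finset.prod_mul_distrib]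
          simp [Finset.card_erase_of_mem]
        rw [this]
        have h2 : τ ^ (N - 1) * t ^ (N - 1) = 1 := by rw [← mul_pow, mul_comm, htτ, one_pow]
        linear_combination (-(1 - τ) * x i * (Matrix.vandermonde x).det *
          ∏ j ∈ Finset.univ.erase i, (x i - τ * x j)) * h2
      · intro j _ hj
        rw [Finset.prod_eq_zero (i := i) (Finset.mem_erase.mpr ⟨hj.symm, Finset.mem_univ _⟩)
          (sub_self _), mul_zero]
      · intro h; exact absurd (Finset.mem_univ _) h
  · have hcard : (insert 0 (Finset.univ.image x)).card = N + 1 := by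
      rw [Finset.card_insert_of_notMem, Finset.card_image_of_injective _ hx, Finset.card_univ,
        Fintype.card_fin]
      simp only [Finset.mem_image, Finset.mem_univ, true_and, not_exists]
      exact hx0
    rw [hcard, Nat.lt_succ_iff]
    refine (Polynomial.natDegree_sub_le _ _).trans (max_le ?_ ?_)
    · refine (Polynomial.natDegree_C_mul_le _ _).trans
        ((Polynomial.natDegree_sub_le _ _).trans (max_le ?_ ?_))
      · exact (hdeg _ _).trans (by simp)
      · exact (Polynomial.natDegree_C_mul_le _ _).trans ((hdeg _ _).trans (by simp))
    · refine (Polynomial.natDegree_C_mul_le _ _).trans ?_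
      rw [Finset.mul_sum]
      refine Polynomial.natDegree_sum_le_of_forall_le _ _ fun i _ => ?_
      rw [mul_left_comm]
      refine (Polynomial.natDegree_C_mul_le _ _).trans ?_
      refine Polynomial.natDegree_mul_le.trans ?_
      have := hdeg (Finset.univ.erase i) x
      rw [Finset.card_erase_of_mem (Finset.mem_univ _), Finset.card_univ, Fintype.card_fin] at this
      have h1 := Polynomial.natDegree_X_le (R := R)
      have := i.pos
      omega

theorem reflect_prod {R : Type*} [CommRing R] [IsDomain R] {ι : Type*} (s : Finset ι) (c : ι → R) :
    (∏ j ∈ s, (Polynomial.X - Polynomial.C (c j))).reflect s.card =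
      ∏ j ∈ s, (1 - Polynomial.C (c j) * Polynomial.X) := by
  classical
  induction s using Finset.induction_on with
  | empty => simp
  | insert a s ha ih =>
    rw [Finset.prod_insert ha, Finset.prod_insert ha, Finset.card_insert_of_notMem ha, add_comm,
      Polynomial.reflect_mul, ih]
    · congr 1
      rw [Polynomial.reflect_sub, Polynomial.reflect_C]
      rw [Polynomial.reflect_one_X, pow_one]
    · exact (Polynomial.natDegree_X_sub_C _).le
    · rw [Polynomial.natDegree_prod_of_monic _ _ fun j _ => Polynomial.monic_X_sub_C _]
      simp

theorem vandermonde_partialFraction' {R : Type*} [CommRing R] [IsDomain R] {N : ℕ} (x : Fin N → R)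
    (hx : Function.Injective x) (hx0 : ∀ i, x i ≠ 0) {t τ : R} (htτ : t * τ = 1) :
    Polynomial.C (Matrix.vandermonde x).det *
      (∏ j, (1 - Polynomial.C (τ * x j) * Polynomial.X) -
        Polynomial.C (τ ^ N) * ∏ j, (1 - Polynomial.C (x j) * Polynomial.X)) =
      Polynomial.C ((1 - τ) * τ ^ (N - 1)) *
        ∑ i, Polynomial.C (Matrix.vandermonde (Function.update x i (t * x i))).det *
          ∏ j ∈ Finset.univ.erase i, (1 - Polynomial.C (x j) * Polynomial.X) := by
  have h := congrArg (Polynomial.reflect N) (vandermonde_partialFraction x hx hx0 htτ)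
  have h1 : ∀ c : Fin N → R, (∏ j, (Polynomial.X - Polynomial.C (c j))).reflect N =
      ∏ j, (1 - Polynomial.C (c j) * Polynomial.X) := fun c => by
    have := reflect_prod Finset.univ c
    rwa [Finset.card_univ, Fintype.card_fin] at this
  rw [Polynomial.reflect_C_mul, Polynomial.reflect_sub, Polynomial.reflect_C_mul, h1, h1,
    Polynomial.reflect_C_mul, Finset.mul_sum] at h
  rw [h]
  congr 1
  have hsum : ∀ (s : Finset (Fin N)) (f : Fin N → Polynomial R),
      (∑ i ∈ s, f i).reflect N = ∑ i ∈ s, (f i).reflect N := by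
    intro s f
    induction s using Finset.induction_on with
    | empty => simp
    | insert a s ha ih => rw [Finset.sum_insert ha, Finset.sum_insert ha, Polynomial.reflect_add, ih]
  rw [hsum]
  refine Finset.sum_congr rfl fun i _ => ?_
  rw [mul_left_comm, Polynomial.reflect_C_mul]
  congr 1
  have hc : (Finset.univ.erase i).card = N - 1 := by
    rw [Finset.card_erase_of_mem (Finset.mem_univ _), Finset.card_univ, Fintype.card_fin]
  have h2 := reflect_prod (Finset.univ.erase i) x
  rw [hc] at h2
  have hN : N = 1 + (N - 1) := by have := i.pos; omega
  rw [← h2]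
  refine (congrArg (fun m => Polynomial.reflect m _) hN).trans ?_
  rw [Polynomial.reflect_mul _ _ Polynomial.natDegree_X_le, Polynomial.reflect_one_X, one_mul]
  rw [Polynomial.natDegree_prod_of_monic _ _ fun j _ => Polynomial.monic_X_sub_C _]
  simp [hc]

theorem evalVars_X (N : ℕ) (k : ℕ+) : evalVars N (MvPolynomial.X k : SymFun F) =
    ∑ i, MvPolynomial.X i ^ (k : ℕ) := by
  simp [evalVars, MvPolynomial.psum]

theorem evalVars_C (N : ℕ) (a : F) : evalVars N (MvPolynomial.C a : SymFun F) =
    MvPolynomial.C a := by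
  simp [evalVars]

theorem isPowerExp_evalVars_hSeries [CharZero F] (N : ℕ) (c : ℕ → F) :
    IsPowerExp (fun n => ∑ i : Fin N, MvPolynomial.C (c n) * MvPolynomial.X i ^ n)
      (PowerSeries.mk fun r => evalVars N (hSeries c r)) := by
  have h := (isPowerExp_hSeries c).map ((evalVars N : SymFun F →ₐ[F] MvPolynomial (Fin N) F) :
        SymFun F →+* MvPolynomial (Fin N) F)
  have h2 : PowerSeries.map ((evalVars N : SymFun F →ₐ[F] MvPolynomial (Fin N) F) :
        SymFun F →+* MvPolynomial (Fin N) F)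
      (PowerSeries.mk (hSeries c)) = PowerSeries.mk fun r => evalVars N (hSeries c r) := by
    ext n
    simp
  rw [h2] at h
  refine h.congr fun n => ?_
  have hp : pSum F (n + 1) = MvPolynomial.X n.succPNat := pSum_coe n.succPNat
  rw [hp, RingHom.coe_coe, map_mul, evalVars_C, evalVars_X, Finset.mul_sum]
  rfl

/-- The Vandermonde determinant in the variables `x_1, …, x_N`. -/
abbrev vdm (F : Type*) [Field F] (N : ℕ) : MvPolynomial (Fin N) F :=
  (Matrix.vandermonde fun i : Fin N => (MvPolynomial.X i : MvPolynomial (Fin N) F)).det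

/-- The Vandermonde determinant with the variable `x_i` scaled by `t`. -/
abbrev vdmScale {N : ℕ} (t : F) (i : Fin N) : MvPolynomial (Fin N) F :=
  (Matrix.vandermonde (Function.update (fun i : Fin N => (MvPolynomial.X i : MvPolynomial (Fin N) F))
    i (MvPolynomial.C t * MvPolynomial.X i))).det

theorem vdm_mul_evalVars_hSeries [CharZero F] {t : F} (ht : t ≠ 0) (N r : ℕ) :
    vdm F N * evalVars N (hSeries (fun n => 1 - t⁻¹ ^ n) r) =
      (if r = 0 then MvPolynomial.C (t⁻¹ ^ N) * vdm F N else 0) +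
        MvPolynomial.C ((1 - t⁻¹) * t⁻¹ ^ (N - 1)) *
          ∑ i, MvPolynomial.X i ^ r * vdmScale t i := by
  set x : Fin N → MvPolynomial (Fin N) F := fun i => MvPolynomial.X i with hx
  set τ : MvPolynomial (Fin N) F := MvPolynomial.C t⁻¹ with hτ
  have htτ : MvPolynomial.C t * τ = 1 := by rw [hτ, ← map_mul, mul_inv_cancel₀ ht, map_one]
  have hpf := vandermonde_partialFraction' x (MvPolynomial.X_injective)
    (fun i => MvPolynomial.X_ne_zero i) htτ
  have hpf' := congrArg (Polynomial.coeToPowerSeries.ringHom) hpf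
  simp only [map_mul, map_sub, map_prod, map_sum, map_one,
    Polynomial.coeToPowerSeries.ringHom_apply, Polynomial.coe_C, Polynomial.coe_X] at hpf'
  have e1 : (PowerSeries.mk fun r => evalVars N (hSeries (fun n => 1 - t⁻¹ ^ n) r)) *
      ∏ j, (1 - PowerSeries.C (x j) * PowerSeries.X) =
      ∏ j, (1 - PowerSeries.C (τ * x j) * PowerSeries.X) := by
    have h1 := (isPowerExp_evalVars_hSeries N (fun n => 1 - t⁻¹ ^ n)).mul
      (IsPowerExp.prod Finset.univ fun j _ => isPowerExp_one_sub (x j))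
    have h2 := IsPowerExp.prod Finset.univ fun j _ => isPowerExp_one_sub (τ * x j)
    refine h1.unique (h2.congr fun n => ?_)
    rw [← Finset.sum_add_distrib]
    refine Finset.sum_congr rfl fun j _ => ?_
    rw [map_sub, map_pow, map_one, mul_pow]
    ring
  have e2 : ∀ i, (PowerSeries.mk fun n => x i ^ n) * ∏ j, (1 - PowerSeries.C (x j) * PowerSeries.X)
      = ∏ j ∈ Finset.univ.erase i, (1 - PowerSeries.C (x j) * PowerSeries.X) := by
    intro i
    rw [← Finset.mul_prod_erase _ _ (Finset.mem_univ i), ← mul_assoc,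
      ((isPowerExp_geom (x i)).mul (isPowerExp_one_sub (x i))).unique
        (isPowerExp_one.congr fun n => by simp), one_mul]
  have hne : (∏ j, (1 - PowerSeries.C (x j) * PowerSeries.X) :
      PowerSeries (MvPolynomial (Fin N) F)) ≠ 0 := by
    refine Finset.prod_ne_zero_iff.mpr fun j _ h => ?_
    have := congrArg PowerSeries.constantCoeff h
    simp at this
  have e3 : PowerSeries.C (vdm F N) *
      (PowerSeries.mk fun r => evalVars N (hSeries (fun n => 1 - t⁻¹ ^ n) r)) =
      PowerSeries.C (MvPolynomial.C (t⁻¹ ^ N) * vdm F N) +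
      PowerSeries.C (MvPolynomial.C ((1 - t⁻¹) * t⁻¹ ^ (N - 1))) *
        ∑ i, PowerSeries.C (vdmScale t i) * (PowerSeries.mk fun n => x i ^ n) := by
    apply mul_right_cancel₀ hne
    rw [add_mul, mul_assoc, e1, mul_assoc, Finset.sum_mul]
    simp_rw [mul_assoc, e2]
    simp only [map_mul, map_sub, map_one, map_pow] at hpf' ⊢
    rw [hτ] at hpf'
    linear_combination hpf'
  have e4 := congrArg (PowerSeries.coeff r) e3
  rw [PowerSeries.coeff_C_mul, PowerSeries.coeff_mk, map_add, PowerSeries.coeff_C,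
    PowerSeries.coeff_C_mul, map_sum] at e4
  rw [e4]
  congr 2
  refine Finset.sum_congr rfl fun i _ => ?_
  rw [PowerSeries.coeff_C_mul, PowerSeries.coeff_mk, mul_comm]

/-- The ring homomorphism `x_i ↦ q x_i` which fixes the other variables. -/
def scaleVar {N : ℕ} (q : F) (i : Fin N) : MvPolynomial (Fin N) F →ₐ[F] MvPolynomial (Fin N) F :=
  MvPolynomial.aeval (Function.update (fun i : Fin N => (MvPolynomial.X i : MvPolynomial (Fin N) F))
    i (MvPolynomial.C q * MvPolynomial.X i))

theorem scaleVar_evalVars {N : ℕ} (q : F) (i : Fin N) (f : SymFun F) :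
    scaleVar q i (evalVars N f) = (shift (fun n => q ^ n - 1) f).eval₂
      ((evalVars N : SymFun F →ₐ[F] MvPolynomial (Fin N) F) :
        SymFun F →+* MvPolynomial (Fin N) F) (MvPolynomial.X i) := by
  induction f using MvPolynomial.induction_on with
  | C a =>
    have h : shift (fun n => q ^ n - 1) (MvPolynomial.C a) = Polynomial.C (MvPolynomial.C a) := by
      rw [← MvPolynomial.algebraMap_eq, AlgHom.commutes,
        IsScalarTower.algebraMap_apply F (SymFun F) (Polynomial (SymFun F))]; rfl
    rw [h, Polynomial.eval₂_C, RingHom.coe_coe, evalVars_C, scaleVar, MvPolynomial.aeval_C]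
    rfl
  | add f g hf hg => rw [map_add, map_add, hf, hg, map_add, Polynomial.eval₂_add]
  | mul_X f k hf =>
    have h1 : ∀ j, scaleVar q i (MvPolynomial.X j ^ (k : ℕ)) = MvPolynomial.X j ^ (k : ℕ) +
        if j = i then MvPolynomial.C (q ^ (k : ℕ) - 1) * MvPolynomial.X i ^ (k : ℕ) else 0 := by
      intro j
      rw [map_pow, scaleVar, MvPolynomial.aeval_X]
      split_ifs with h
      · subst h
        rw [Function.update_self, mul_pow, map_sub, map_pow, map_one]
        ring
      · rw [Function.update_of_ne h, add_zero]
    rw [map_mul (evalVars N), map_mul (scaleVar q i), hf, map_mul (shift _), Polynomial.eval₂_mul,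
      shift_X, evalVars_X, map_sum, Finset.sum_congr rfl fun j _ => h1 j, Finset.sum_add_distrib,
      Finset.sum_ite_eq', if_pos (Finset.mem_univ _), Polynomial.eval₂_add, Polynomial.eval₂_mul,
      Polynomial.eval₂_C, Polynomial.eval₂_C, Polynomial.eval₂_X_pow, RingHom.coe_coe, evalVars_X,
      evalVars_C]

/-- In finitely many variables, `macOp q t 0` is an affine function of the Macdonald
`q`-difference operator. -/
theorem vdm_mul_evalVars_macOp [CharZero F] {q t : F} (ht : t ≠ 0) (N : ℕ) (f : SymFun F) :
    vdm F N * evalVars N (macOp q t 0 f) = MvPolynomial.C (t⁻¹ ^ N) * (vdm F N * evalVars N f) +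
      MvPolynomial.C ((1 - t⁻¹) * t⁻¹ ^ (N - 1)) *
        ∑ i, vdmScale t i * scaleVar q i (evalVars N f) := by
  rw [macOp, vertexOp_eq _ _ _ _ (Nat.lt_succ_self _), map_sum, Finset.mul_sum]
  simp_rw [scaleVar_evalVars, Polynomial.eval₂_eq_sum_range' _ (Nat.lt_succ_self _), add_zero,
    map_mul, ← mul_assoc, vdm_mul_evalVars_hSeries ht, add_mul]
  rw [Finset.sum_add_distrib]
  congr 1
  · rw [Finset.sum_eq_single 0]
    · simp
    · intro r _ hr; rw [if_neg hr, zero_mul]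
    · simp
  · simp_rw [mul_assoc, Finset.sum_mul, Finset.mul_sum]
    rw [Finset.sum_comm]
    refine Finset.sum_congr rfl fun i _ => Finset.sum_congr rfl fun r _ => ?_
    rw [RingHom.coe_coe, shiftCoeff_apply]
    simp only [map_mul]
    ring

end

/-! ### Dominance order -/

section

variable {F : Type*} [Field F]

/-- The dominance order on Young diagrams of the same size. -/
def Dom (Y Z : YoungDiagram) : Prop :=
  Y.card = Z.card ∧ ∀ k, ∑ i ∈ Finset.range k, Y.rowLen i ≤ ∑ i ∈ Finset.range k, Z.rowLen i

theorem Dom.refl (Y : YoungDiagram) : Dom Y Y := ⟨rfl, fun _ => le_rfl⟩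

theorem Dom.trans {X Y Z : YoungDiagram} (h : Dom X Y) (h' : Dom Y Z) : Dom X Z :=
  ⟨h.1.trans h'.1, fun k => (h.2 k).trans (h'.2 k)⟩

theorem Dom.antisymm {Y Z : YoungDiagram} (h : Dom Y Z) (h' : Dom Z Y) : Y = Z := by
  apply rowLen_injective
  funext i
  have h1 := le_antisymm (h.2 i) (h'.2 i)
  have h2 := le_antisymm (h.2 (i + 1)) (h'.2 (i + 1))
  rw [Finset.sum_range_succ, Finset.sum_range_succ, h1] at h2
  omega

/-- A statistic that is strictly increasing for the dominance order. -/
def domStat (Y : YoungDiagram) : ℕ :=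
  ∑ k ∈ Finset.range (Y.card + 1), ∑ i ∈ Finset.range k, Y.rowLen i

theorem sum_rowLen_le_card (Y : YoungDiagram) (k : ℕ) :
    ∑ i ∈ Finset.range k, Y.rowLen i ≤ Y.card := by
  rw [card_eq_sum_rowLen Y (le_max_right k (Y.colLen 0))]
  exact Finset.sum_le_sum_of_subset (by simp)

theorem domStat_le (Y : YoungDiagram) : domStat Y ≤ (Y.card + 1) * Y.card := by
  refine (Finset.sum_le_card_nsmul _ _ Y.card fun k _ => sum_rowLen_le_card Y k).trans ?_
  simp

theorem Dom.domStat_lt {Y Z : YoungDiagram} (h : Dom Y Z) (hne : Y ≠ Z) :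
    domStat Y < domStat Z := by
  unfold domStat
  rw [← h.1]
  by_contra hlt
  have hle : ∀ k ∈ Finset.range (Y.card + 1), ∑ i ∈ Finset.range k, Y.rowLen i ≤
      ∑ i ∈ Finset.range k, Z.rowLen i := fun k _ => h.2 k
  have heq := (Finset.sum_eq_sum_iff_of_le hle).mp
    (le_antisymm (Finset.sum_le_sum hle) (not_lt.mp hlt))
  refine hne (h.antisymm ⟨h.1.symm, fun k => ?_⟩)
  by_cases hk : k ≤ Y.card
  · exact (heq k (Finset.mem_range.mpr (Nat.lt_succ_of_le hk))).ge
  · refine (sum_rowLen_le_card Z k).trans ?_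
    rw [← h.1, card_eq_sum_rowLen Y ((colLen_le_card Y).trans (not_le.mp hk).le)]

theorem sum_le_sum_range_of_antitone {f : ℕ → ℕ} (hf : Antitone f) (s : Finset ℕ) :
    ∑ i ∈ s, f i ≤ ∑ i ∈ Finset.range s.card, f i := by
  induction s using Finset.induction_on_max with
  | empty => simp
  | insert a s ha ih =>
    have has : a ∉ s := fun h => lt_irrefl a (ha a h)
    have hcard : s.card ≤ a := by
      have : s ⊆ Finset.range a := fun x hx => Finset.mem_range.mpr (ha x hx)
      simpa using Finset.card_le_card this
    rw [Finset.sum_insert has, Finset.card_insert_of_notMem has, Finset.sum_range_succ, add_comm]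
    exact Nat.add_le_add ih (hf hcard)

theorem sum_injective_le {f : ℕ → ℕ} (hf : Antitone f) {k : ℕ} {g : Fin k → ℕ}
    (hg : Function.Injective g) : ∑ i, f (g i) ≤ ∑ i ∈ Finset.range k, f i := by
  classical
  have h := sum_le_sum_range_of_antitone hf (Finset.univ.image g)
  rwa [Finset.sum_image fun _ _ _ _ h => hg h, Finset.card_image_of_injective _ hg,
    Finset.card_univ, Fintype.card_fin] at h

/-- Subtracting a permutation of the staircase from `λ + δ` moves up in the dominance order,
strictly so unless the permutation is trivial. -/
theorem dom_of_perm {N : ℕ} {Y Z : YoungDiagram} (hY : Y.colLen 0 ≤ N) (hZ : Z.colLen 0 ≤ N)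
    (σ π : Equiv.Perm (Fin N))
    (h : ∀ i, Z.rowLen (π i) + σ i = Y.rowLen (Fin.rev i) + i) :
    Dom Y Z ∧ (Z = Y → σ = 1) := by
  have hcard : Y.card = Z.card := by
    have h1 : ∑ i : Fin N, (Z.rowLen (π i) + (σ i : ℕ)) = ∑ i : Fin N, (Y.rowLen (Fin.rev i) + i) :=
      Finset.sum_congr rfl fun i _ => h i
    have h2 := Equiv.sum_comp Fin.revPerm fun i : Fin N => Y.rowLen i
    simp only [Fin.revPerm_apply] at h2
    rw [Finset.sum_add_distrib, Finset.sum_add_distrib,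
      Equiv.sum_comp π fun i : Fin N => Z.rowLen i, Equiv.sum_comp σ fun i : Fin N => (i : ℕ),
      h2] at h1
    rw [card_eq_sum_rowLen Y hY, card_eq_sum_rowLen Z hZ, Finset.sum_range, Finset.sum_range]
    omega
  refine ⟨⟨hcard, fun k => ?_⟩, fun hZY => ?_⟩
  · by_cases hk : k ≤ N
    · set e : Fin k → Fin N := fun i => Fin.rev (Fin.castLE hk i) with he
      have hinj : Function.Injective e := Fin.rev_injective.comp (Fin.castLE_injective hk)
      have h1 : ∑ i : Fin k, Z.rowLen (π (e i)) ≤ ∑ i ∈ Finset.range k, Z.rowLen i :=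
        sum_injective_le (fun _ _ hij => Z.rowLen_anti _ _ hij)
          (Fin.val_injective.comp (π.injective.comp hinj))
      have h2 : ∑ i : Fin k, (N - 1 - (N - 1 - (σ (e i) : ℕ))) ≤
          ∑ i ∈ Finset.range k, (N - 1 - i) := by
        refine sum_injective_le (f := fun j => N - 1 - j) (g := fun i => N - 1 - (σ (e i) : ℕ))
          (fun a b hab => Nat.sub_le_sub_left hab _) fun a b hab => ?_
        have ha := (σ (e a)).isLt
        have hb := (σ (e b)).isLt
        have : (σ (e a) : ℕ) = σ (e b) := by simp only at hab; omega
        exact hinj (σ.injective (Fin.ext this))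
      have h3 : ∑ i : Fin k, (Z.rowLen (π (e i)) + (N - 1 - (N - 1 - (σ (e i) : ℕ)))) =
          ∑ i : Fin k, (Y.rowLen i + (N - 1 - (i : ℕ))) := by
        refine Finset.sum_congr rfl fun i _ => ?_
        have hlt := (σ (e i)).isLt
        have := h (e i)
        have h4 : (Fin.rev (e i) : ℕ) = i := by simp [he]
        have h5 : (e i : ℕ) = N - 1 - i := by simp [he, Fin.val_rev]; omega
        rw [h4, h5] at this
        rw [← this]
        omega
      rw [Finset.sum_add_distrib, Finset.sum_add_distrib] at h3
      rw [Finset.sum_range] at h2 ⊢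
      omega
    · have := card_eq_sum_rowLen Z (hZ.trans (not_le.mp hk).le)
      rw [← this, ← hcard]
      exact sum_rowLen_le_card Y k
  · subst hZY
    have hmono : Monovary (fun i : Fin N => (Z.rowLen (Fin.rev i) : ℤ)) fun i : Fin N =>
        ((i : ℕ) : ℤ) := by
      intro i j hij
      have : (i : ℕ) < j := by simpa using hij
      refine Int.ofNat_le.mpr ?_
      exact Z.rowLen_anti _ _ (Fin.rev_le_rev.mpr (Fin.le_def.mpr this.le))
    have hr := hmono.sum_mul_comp_perm_le_sum_mul (σ := σ)
    have hZi : ∀ i, (Z.rowLen (π i) : ℤ) = Z.rowLen (Fin.rev i) + ((i : ℕ) : ℤ) - (σ i : ℕ) :=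
      fun i => by have := h i; omega
    have hsq : ∑ i : Fin N, (Z.rowLen (π i) : ℤ) ^ 2 =
        ∑ i : Fin N, (Z.rowLen (Fin.rev i) : ℤ) ^ 2 := by
      have h2 := Equiv.sum_comp Fin.revPerm fun i : Fin N => (Z.rowLen i : ℤ) ^ 2
      simp only [Fin.revPerm_apply] at h2
      rw [Equiv.sum_comp π fun i : Fin N => (Z.rowLen i : ℤ) ^ 2, h2]
    simp_rw [hZi] at hsq
    have hexp : ∑ i : Fin N, ((Z.rowLen (Fin.rev i) : ℤ) + ((i : ℕ) : ℤ) - (σ i : ℕ)) ^ 2 =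
        ∑ i : Fin N, (Z.rowLen (Fin.rev i) : ℤ) ^ 2 +
        2 * (∑ i : Fin N, (Z.rowLen (Fin.rev i) : ℤ) * ((i : ℕ) : ℤ) -
          ∑ i : Fin N, (Z.rowLen (Fin.rev i) : ℤ) * ((σ i : ℕ) : ℤ)) +
        ∑ i : Fin N, (((i : ℕ) : ℤ) - (σ i : ℕ)) ^ 2 := by
      rw [← Finset.sum_sub_distrib, Finset.mul_sum, ← Finset.sum_add_distrib,
        ← Finset.sum_add_distrib]
      exact Finset.sum_congr rfl fun i _ => by ring
    have hz : ∑ i : Fin N, (((i : ℕ) : ℤ) - (σ i : ℕ)) ^ 2 = 0 :=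
      le_antisymm (by linarith) (Finset.sum_nonneg fun i _ => sq_nonneg _)
    ext i
    have := (Finset.sum_eq_zero_iff_of_nonneg fun i _ => sq_nonneg _).mp hz i (Finset.mem_univ i)
    have := pow_eq_zero_iff (two_ne_zero) |>.mp this
    simp only [Equiv.Perm.coe_one, id_eq]
    omega

/-! ### Triangularity -/

/-- The exponent vector of the diagonal term of index `σ` of a Vandermonde determinant. -/
def permExp {N : ℕ} (σ : Equiv.Perm (Fin N)) : Fin N →₀ ℕ :=
  Finsupp.equivFunOnFinite.symm fun i => (σ i : ℕ)

@[simp] theorem permExp_apply {N : ℕ} (σ : Equiv.Perm (Fin N)) (i : Fin N) :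
    permExp σ i = σ i := rfl

theorem prod_X_pow_perm {N : ℕ} (σ : Equiv.Perm (Fin N)) :
    ∏ i, (MvPolynomial.X i : MvPolynomial (Fin N) F) ^ (σ i : ℕ) =
      MvPolynomial.monomial (permExp σ) 1 := by
  rw [MvPolynomial.monomial_eq, map_one, one_mul, Finsupp.prod_fintype _ _ (by simp)]
  rfl

theorem vdm_eq_sum (N : ℕ) : vdm F N = ∑ σ : Equiv.Perm (Fin N),
    MvPolynomial.monomial (permExp σ) ((Equiv.Perm.sign σ : ℤ) : F) := by
  rw [vdm, ← Matrix.det_transpose, Matrix.det_apply']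
  refine Finset.sum_congr rfl fun σ _ => ?_
  simp only [Matrix.transpose_apply, Matrix.vandermonde_apply]
  rw [prod_X_pow_perm, ← map_intCast (MvPolynomial.C (R := F) (σ := Fin N)), MvPolynomial.C_mul_monomial, mul_one]

theorem vdmScale_eq_sum {N : ℕ} (t : F) (i : Fin N) : vdmScale t i =
    ∑ σ : Equiv.Perm (Fin N), MvPolynomial.monomial (permExp σ)
      (((Equiv.Perm.sign σ : ℤ) : F) * t ^ (σ i : ℕ)) := by
  rw [vdmScale, ← Matrix.det_transpose, Matrix.det_apply']
  refine Finset.sum_congr rfl fun σ _ => ?_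
  simp only [Matrix.transpose_apply, Matrix.vandermonde_apply]
  have : ∏ x, Function.update (fun i : Fin N => (MvPolynomial.X i : MvPolynomial (Fin N) F))
      i (MvPolynomial.C t * MvPolynomial.X i) x ^ (σ x : ℕ) =
      MvPolynomial.C (t ^ (σ i : ℕ)) * ∏ x, MvPolynomial.X x ^ (σ x : ℕ) := by
    rw [← Finset.mul_prod_erase _ _ (Finset.mem_univ i),
      ← Finset.mul_prod_erase Finset.univ _ (Finset.mem_univ i), Function.update_self, mul_pow,
      map_pow, mul_assoc]
    congr 2
    exact Finset.prod_congr rfl fun j hj => by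
      rw [Function.update_of_ne (Finset.ne_of_mem_erase hj)]
  rw [this, prod_X_pow_perm, ← map_intCast (MvPolynomial.C (R := F) (σ := Fin N)), ← mul_assoc,
    ← map_mul, MvPolynomial.C_mul_monomial, mul_one]

theorem coeff_scaleVar {N : ℕ} (q : F) (i : Fin N) (f : MvPolynomial (Fin N) F)
    (γ : Fin N →₀ ℕ) : (scaleVar q i f).coeff γ = q ^ γ i * f.coeff γ := by
  classical
  induction f using MvPolynomial.induction_on' with
  | monomial u a =>
    have : scaleVar q i (MvPolynomial.monomial u a) =
        MvPolynomial.monomial u (q ^ u i * a) := by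
      rw [scaleVar, MvPolynomial.aeval_monomial, MvPolynomial.monomial_eq,
        Finsupp.prod_fintype _ _ (by simp), Finsupp.prod_fintype _ _ (by simp),
        ← Finset.mul_prod_erase _ _ (Finset.mem_univ i),
        ← Finset.mul_prod_erase Finset.univ _ (Finset.mem_univ i), Function.update_self,
        Finset.prod_congr rfl fun j hj => by
          rw [Function.update_of_ne (Finset.ne_of_mem_erase hj)], map_mul, map_pow,
        MvPolynomial.algebraMap_eq]
      ring
    rw [this, MvPolynomial.coeff_monomial, MvPolynomial.coeff_monomial]
    split_ifs with h
    · rw [h]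
    · simp
  | add p q hp hq => rw [map_add, MvPolynomial.coeff_add, hp, hq, MvPolynomial.coeff_add, mul_add]

/-- Up to normalization, the eigenvalue of the Macdonald operator on `P_λ`. -/
def macEig (q t : F) (Y : YoungDiagram) : F :=
  1 - (1 - q) * (1 - t⁻¹) * ∑ s ∈ Y.cells, q ^ s.2 * t⁻¹ ^ s.1

theorem macEig_eq {q t : F} (ht : t ≠ 0) (Y : YoungDiagram) {N : ℕ} (hN : Y.colLen 0 ≤ N) :
    macEig q t Y = t⁻¹ ^ N + (1 - t⁻¹) * t⁻¹ ^ (N - 1) *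
      ∑ i : Fin N, t ^ (i : ℕ) * q ^ Y.rowLen (Fin.rev i) := by
  have h1 : t⁻¹ ^ (N - 1) * ∑ i : Fin N, t ^ (i : ℕ) * q ^ Y.rowLen (Fin.rev i) =
      ∑ i ∈ Finset.range N, t⁻¹ ^ i * q ^ Y.rowLen i := by
    rw [← Equiv.sum_comp Fin.revPerm, Finset.mul_sum, Finset.sum_range]
    refine Finset.sum_congr rfl fun i _ => ?_
    have : t⁻¹ ^ (N - 1) * t ^ (Fin.rev i : ℕ) = t⁻¹ ^ (i : ℕ) := by
      have : N - 1 = i + (Fin.rev i : ℕ) := by rw [Fin.val_rev]; omega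
      rw [this, pow_add, mul_assoc, ← mul_pow, inv_mul_cancel₀ ht, one_pow, mul_one]
    rw [Fin.revPerm_apply, Fin.rev_rev, ← mul_assoc, this]
  rw [mul_assoc, h1, macEig, sum_cells Y hN]
  have h2 : ∀ i, (1 - q) * ∑ j ∈ Finset.range (Y.rowLen i), q ^ j * t⁻¹ ^ i =
      t⁻¹ ^ i - t⁻¹ ^ i * q ^ Y.rowLen i := by
    intro i
    rw [← Finset.sum_mul, ← mul_assoc, mul_comm (1 - q), geom_sum_mul_neg]
    ring
  have h3 : (1 - q) * (1 - t⁻¹) * ∑ i ∈ Finset.range N, ∑ j ∈ Finset.range (Y.rowLen i),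
      q ^ j * t⁻¹ ^ i = (1 - t⁻¹) * (∑ i ∈ Finset.range N, t⁻¹ ^ i -
        ∑ i ∈ Finset.range N, t⁻¹ ^ i * q ^ Y.rowLen i) := by
    rw [mul_comm (1 - q), mul_assoc, Finset.mul_sum, Finset.sum_congr rfl fun i _ => h2 i,
      Finset.sum_sub_distrib]
  rw [h3]
  have h4 := geom_sum_mul_neg t⁻¹ N
  linear_combination -h4

/-- The Macdonald operator is triangular with respect to the dominance order. -/
theorem mCoeff_macOp [CharZero F] {q t : F} (hq : ∀ n : ℕ, 0 < n → q ^ n ≠ 1)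
    (ht : ∀ n : ℕ, 0 < n → t ^ n ≠ 1) (a : F) {b : F} (hb : b ≠ 0) {f : SymFun F}
    (Y : YoungDiagram) (hf : ∀ Z, Dom Y Z → Z ≠ Y → mCoeff q t Z f = 0) :
    mCoeff q t Y (macOp a b 0 f) = macEig a b Y * mCoeff q t Y f := by
  classical
  -- Descending induction along the dominance order.
  induction hm : (Y.card + 1) * Y.card - domStat Y using Nat.strong_induction_on generalizing Y with
  | _ m ih =>
  have hE : ∀ Z, Dom Y Z → Z ≠ Y → mCoeff q t Z (macOp a b 0 f) = 0 := by
    intro Z hZ hne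
    have hlt := hZ.domStat_lt hne.symm
    have h1 := domStat_le Z
    have h2 := domStat_le Y
    rw [ih ((Z.card + 1) * Z.card - domStat Z) (by rw [← hZ.1] at h1 ⊢; omega) Z (fun X hX hXZ =>
      hf X (hZ.trans hX) (by rintro rfl; exact hne (hX.antisymm hZ))) rfl, hf Z hZ hne, mul_zero]
  set N := Y.colLen 0 with hN
  set β : Fin N →₀ ℕ := Finsupp.equivFunOnFinite.symm fun i => Y.rowLen (Fin.rev i) + i with hβ
  have hβi : ∀ i, β i = Y.rowLen (Fin.rev i) + i := fun i => rfl
  -- Only the leading term of the Vandermonde determinant contributes.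
  have key : ∀ g : SymFun F, (∀ Z, Dom Y Z → Z ≠ Y → mCoeff q t Z g = 0) →
      ∀ σ : Equiv.Perm (Fin N), permExp σ ≤ β →
        (evalVars N g).coeff (β - permExp σ) = if σ = 1 then mCoeff q t Y g else 0 := by
    intro g hg σ hσ
    obtain ⟨Z, π, hZN, hZ⟩ := exists_diagram_perm (β - permExp σ)
    have h1 : ∀ i, Z.rowLen (π i) + σ i = Y.rowLen (Fin.rev i) + i := by
      intro i
      have h2 := hσ i
      have h3 := hZ i
      rw [Finsupp.tsub_apply] at h3
      rw [permExp_apply] at h2 h3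
      rw [hβi] at h2 h3
      omega
    obtain ⟨hdom, hone⟩ := dom_of_perm le_rfl hZN σ π h1
    rw [coeff_evalVars_of_perm hq ht hZN hZ]
    split_ifs with h
    · have : Z = Y := by
        subst h
        refine Dom.antisymm ⟨hdom.1.symm, fun k => ?_⟩ hdom
        by_cases hk : k ≤ N
        · -- Here `Z` is a rearrangement of `Y`.
          have h2 : ∀ i : Fin N, Z.rowLen (π i) = Y.rowLen (Fin.rev i) := fun i => by
            have := h1 i; simpa using this
          have h3 : ∀ i : Fin N, Z.rowLen i = Y.rowLen (Fin.rev (π.symm i)) := fun i => by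
            have := h2 (π.symm i); simpa using this
          calc ∑ i ∈ Finset.range k, Z.rowLen i
              = ∑ i : Fin k, Y.rowLen (Fin.rev (π.symm (Fin.castLE hk i))) := by
                rw [Finset.sum_range]
                exact Finset.sum_congr rfl fun i _ => h3 (Fin.castLE hk i)
            _ ≤ _ := sum_injective_le (fun _ _ hij => Y.rowLen_anti _ _ hij)
                (g := fun i => ((Fin.rev (π.symm (Fin.castLE hk i)) : Fin N) : ℕ))
                (Fin.val_injective.comp (Fin.rev_injective.comp
                  (π.symm.injective.comp (Fin.castLE_injective hk))))
        · rw [← card_eq_sum_rowLen Y (not_le.mp hk).le, hdom.1]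
          exact sum_rowLen_le_card Z k
      rw [this]
    · exact hg Z hdom fun hZY => h (hone hZY)
  have hle1 : permExp (1 : Equiv.Perm (Fin N)) ≤ β := fun i => by
    rw [permExp_apply, hβi]; simp
  have hvdm : ∀ g : SymFun F, (∀ Z, Dom Y Z → Z ≠ Y → mCoeff q t Z g = 0) →
      (vdm F N * evalVars N g).coeff β = mCoeff q t Y g := by
    intro g hg
    rw [vdm_eq_sum, Finset.sum_mul, MvPolynomial.coeff_sum, Finset.sum_eq_single 1]
    · rw [MvPolynomial.coeff_monomial_mul', if_pos hle1, key g hg 1 hle1]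
      simp
    · intro σ _ hσ
      rw [MvPolynomial.coeff_monomial_mul']
      split_ifs with h
      · rw [key g hg σ h, if_neg hσ, mul_zero]
      · rfl
    · simp
  have hscale : ∀ i, (vdmScale b i * scaleVar a i (evalVars N f)).coeff β =
      b ^ (i : ℕ) * a ^ Y.rowLen (Fin.rev i) * mCoeff q t Y f := by
    intro i
    rw [vdmScale_eq_sum, Finset.sum_mul, MvPolynomial.coeff_sum, Finset.sum_eq_single 1]
    · rw [MvPolynomial.coeff_monomial_mul', if_pos hle1, coeff_scaleVar, key f hf 1 hle1]
      have : (β - permExp (1 : Equiv.Perm (Fin N)) : Fin N →₀ ℕ) i = Y.rowLen (Fin.rev i) := by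
        rw [Finsupp.tsub_apply, permExp_apply, hβi]; simp
      rw [this]
      simp
      ring
    · intro σ _ hσ
      rw [MvPolynomial.coeff_monomial_mul']
      split_ifs with h
      · rw [coeff_scaleVar, key f hf σ h, if_neg hσ, mul_zero, mul_zero]
      · rfl
    · simp
  have h := congrArg (MvPolynomial.coeff β) (vdm_mul_evalVars_macOp (q := a) hb N f)
  rw [hvdm _ hE, MvPolynomial.coeff_add, MvPolynomial.coeff_C_mul, hvdm f hf,
    MvPolynomial.coeff_C_mul, MvPolynomial.coeff_sum, Finset.sum_congr rfl fun i _ => hscale i,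
    ← Finset.sum_mul] at h
  rw [h, macEig_eq hb Y le_rfl]
  ring

end

/-! ### Generic parameters -/

section

variable {F : Type*} [Field F]

/-- The parameters are generic when the monomials `q ^ a * t ^ b` with integral exponents are
linearly independent over `ℚ`. -/
def Generic [CharZero F] (q t : F) : Prop :=
  LinearIndependent ℚ fun p : ℤ × ℤ => q ^ p.1 * t ^ p.2

theorem generic_of_algebraicIndependent [CharZero F] {q t : F}
    (h : AlgebraicIndependent ℚ ![q, t]) : Generic q t := by
  classical
  have hq : q ≠ 0 := by simpa using h.ne_zero 0
  have ht : t ≠ 0 := by simpa using h.ne_zero 1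
  rw [Generic, linearIndependent_iff']
  intro s g hs p hp
  -- Clear denominators with the monomial `(q t) ^ M`.
  set M : ℕ := ∑ p ∈ s, (p.1.natAbs + p.2.natAbs) with hM
  have hle : ∀ p ∈ s, p.1.natAbs + p.2.natAbs ≤ M := fun p hp =>
    Finset.single_le_sum (f := fun p : ℤ × ℤ => p.1.natAbs + p.2.natAbs) (fun _ _ => Nat.zero_le _) hp
  set e : ℤ × ℤ → Fin 2 →₀ ℕ := fun p =>
    Finsupp.equivFunOnFinite.symm ![(p.1 + M).toNat, (p.2 + M).toNat] with he
  have hmap : MvPolynomial.aeval ![q, t] (∑ p ∈ s, MvPolynomial.monomial (e p) (g p)) = 0 := by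
    rw [map_sum]
    have : ∀ p ∈ s, MvPolynomial.aeval ![q, t] (MvPolynomial.monomial (e p) (g p)) =
        (q ^ M * t ^ M) * g p • (q ^ p.1 * t ^ p.2) := by
      intro p hp
      have hp' := hle p hp
      have h1 : q ^ (p.1 + M).toNat = q ^ p.1 * q ^ M := by
        rw [← zpow_natCast q, ← zpow_natCast q, Int.toNat_of_nonneg (by omega), zpow_add₀ hq]
      have h2 : t ^ (p.2 + M).toNat = t ^ p.2 * t ^ M := by
        rw [← zpow_natCast t, ← zpow_natCast t, Int.toNat_of_nonneg (by omega), zpow_add₀ ht]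
      rw [MvPolynomial.aeval_monomial, Finsupp.prod_fintype _ _ (by simp), Fin.prod_univ_two]
      have h3 : e p 0 = (p.1 + M).toNat := rfl
      have h4 : e p 1 = (p.2 + M).toNat := rfl
      rw [h3, h4, Algebra.smul_def]
      simp only [Matrix.cons_val_zero, Matrix.cons_val_one]
      rw [h1, h2]
      ring
    rw [Finset.sum_congr rfl this, ← Finset.mul_sum, hs, mul_zero]
  have hzero : ∑ p ∈ s, MvPolynomial.monomial (e p) (g p) = 0 :=
    (injective_iff_map_eq_zero _).mp h _ hmap
  have hc := congrArg (MvPolynomial.coeff (e p)) hzero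
  rw [MvPolynomial.coeff_sum, MvPolynomial.coeff_zero, Finset.sum_eq_single p] at hc
  · simpa using hc
  · intro r hr hrp
    rw [MvPolynomial.coeff_monomial, if_neg]
    intro hep
    apply hrp
    have h0 := DFunLike.congr_fun hep 0
    have h1 := DFunLike.congr_fun hep 1
    have h0' : (r.1 + M).toNat = (p.1 + M).toNat := h0
    have h1' : (r.2 + M).toNat = (p.2 + M).toNat := h1
    have := hle p hp
    have := hle r hr
    exact Prod.ext (by omega) (by omega)
  · exact fun hn => absurd hp hn

namespace Generic

variable [CharZero F] {q t : F}

theorem q_ne_zero (h : Generic q t) : q ≠ 0 := by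
  have := h.ne_zero (1, 0)
  simpa using this

theorem t_ne_zero (h : Generic q t) : t ≠ 0 := by
  have := h.ne_zero (0, 1)
  simpa using this

theorem monomial_inj (h : Generic q t) {a b c d : ℤ} (he : q ^ a * t ^ b = q ^ c * t ^ d) :
    a = c ∧ b = d := by
  have := LinearIndependent.injective h (a₁ := (a, b)) (a₂ := (c, d)) he
  exact ⟨congrArg Prod.fst this, congrArg Prod.snd this⟩

theorem q_pow_ne_one (h : Generic q t) (n : ℕ) (hn : 0 < n) : q ^ n ≠ 1 := by
  intro he
  have := (h.monomial_inj (a := n) (b := 0) (c := 0) (d := 0) (by simpa using he)).1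
  omega

theorem t_pow_ne_one (h : Generic q t) (n : ℕ) (hn : 0 < n) : t ^ n ≠ 1 := by
  intro he
  have := (h.monomial_inj (a := 0) (b := n) (c := 0) (d := 0) (by simpa using he)).2
  omega

theorem q_ne_t (h : Generic q t) : q ≠ t := by
  intro he
  have := (h.monomial_inj (a := 1) (b := 0) (c := 0) (d := 1) (by simpa using he)).1
  omega

theorem one_sub_ne_zero (h : Generic q t) (a b : ℕ) : 1 - q ^ a * t ^ (b + 1) ≠ 0 := by
  intro he
  have := (h.monomial_inj (a := a) (b := (b + 1 : ℕ)) (c := 0) (d := 0)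
    (by rw [zpow_natCast, zpow_natCast, zpow_zero, zpow_zero, mul_one]
        exact (sub_eq_zero.mp he).symm)).2
  omega

/-- A sum of box monomials determines its coefficients. -/
theorem sum_boxes_eq_zero (h : Generic q t) (s : Finset (ℕ × ℕ)) (c : ℕ × ℕ → ℚ)
    (hs : ∑ x ∈ s, (c x : F) * (q ^ x.2 * t⁻¹ ^ x.1) = 0) : ∀ x ∈ s, c x = 0 := by
  have hinj : Function.Injective fun x : ℕ × ℕ => ((x.2 : ℤ), -(x.1 : ℤ)) := by
    rintro ⟨a, b⟩ ⟨c, d⟩ hab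
    simp only [Prod.mk.injEq, neg_inj, Nat.cast_inj] at hab
    rw [hab.1, hab.2]
  have h1 := linearIndependent_iff'.mp (LinearIndependent.comp h _ hinj) s c
  apply h1
  rw [← hs]
  refine Finset.sum_congr rfl fun x _ => ?_
  simp [Algebra.smul_def]

theorem macEig_injective (h : Generic q t) : Function.Injective (macEig q t) := by
  classical
  intro Y Z hYZ
  have h1 : (1 - q) * (1 - t⁻¹) ≠ 0 := by
    refine mul_ne_zero (sub_ne_zero.mpr ?_) (sub_ne_zero.mpr ?_)
    · simpa using (h.q_pow_ne_one 1 one_pos).symm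
    · have := h.t_pow_ne_one 1 one_pos
      rw [pow_one] at this
      exact fun h' => this (by rw [← inv_inv t, ← h', inv_one])
  have h2 : ∑ s ∈ Y.cells, q ^ s.2 * t⁻¹ ^ s.1 = ∑ s ∈ Z.cells, q ^ s.2 * t⁻¹ ^ s.1 :=
    mul_left_cancel₀ h1 (sub_right_injective hYZ)
  have h3 := h.sum_boxes_eq_zero (Y.cells ∪ Z.cells)
    (fun x => (if x ∈ Y.cells then 1 else 0) - (if x ∈ Z.cells then 1 else 0)) (by
      simp only [Rat.cast_sub, apply_ite (Rat.cast : ℚ → F), Rat.cast_one, Rat.cast_zero, sub_mul, ite_mul, one_mul, zero_mul, Finset.sum_sub_distrib]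
      rw [← Finset.sum_filter, ← Finset.sum_filter, Finset.filter_mem_eq_inter,
        Finset.filter_mem_eq_inter, Finset.union_inter_cancel_left,
        Finset.union_inter_cancel_right, h2, sub_self])
  apply YoungDiagram.ext
  ext x
  by_cases hY : x ∈ Y.cells <;> by_cases hZ : x ∈ Z.cells <;> simp only [hY, hZ]
  · have := h3 x (Finset.mem_union_left _ hY)
    simp [hY, hZ] at this
  · have := h3 x (Finset.mem_union_right _ hZ)
    simp [hY, hZ] at this

/-- The constant term of `f(q, t) f(q⁻¹, t⁻¹)` is the sum of the squares of the coefficients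
of `f`. -/
theorem sum_sq_eq_one (h : Generic q t) (s : Finset (ℕ × ℕ)) (c : ℕ × ℕ → ℤ)
    (hs : (∑ x ∈ s, (c x : F) * (q ^ x.2 * t⁻¹ ^ x.1)) *
      (∑ x ∈ s, (c x : F) * (q⁻¹ ^ x.2 * t⁻¹⁻¹ ^ x.1)) = 1) : ∑ x ∈ s, c x ^ 2 = 1 := by
  classical
  have hq := h.q_ne_zero
  have ht := h.t_ne_zero
  set δ : (ℕ × ℕ) × (ℕ × ℕ) → ℤ × ℤ := fun p =>
    ((p.1.2 : ℤ) - p.2.2, (p.2.1 : ℤ) - p.1.1) with hδ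
  set S := insert 0 ((s ×ˢ s).image δ) with hS
  have h1 : ∑ d ∈ S, ((∑ p ∈ s ×ˢ s with δ p = d, (c p.1 * c p.2 : ℚ)) - if d = 0 then 1 else 0) •
      (q ^ d.1 * t ^ d.2) = 0 := by
    simp only [sub_smul, Finset.sum_sub_distrib, ite_smul, one_smul, zero_smul]
    rw [Finset.sum_ite_eq' S (0 : ℤ × ℤ), if_pos (Finset.mem_insert_self _ _), sub_eq_zero]
    simp only [Prod.fst_zero, zpow_zero, Prod.snd_zero, mul_one]
    rw [← hs, Finset.sum_mul_sum, ← Finset.sum_product', ← Finset.sum_fiberwise_of_maps_to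
      (t := S) (g := δ) fun p hp => Finset.mem_insert_of_mem (Finset.mem_image_of_mem _ hp)]
    refine Finset.sum_congr rfl fun d _ => ?_
    rw [Finset.sum_smul]
    refine Finset.sum_congr rfl fun p hp => ?_
    rw [← (Finset.mem_filter.mp hp).2, Algebra.smul_def, hδ]
    simp only [map_mul, map_intCast, zpow_sub₀ hq, zpow_sub₀ ht, zpow_natCast, inv_pow, inv_inv]
    field_simp
  have h2 := linearIndependent_iff'.mp h S _ h1 0 (Finset.mem_insert_self _ _)
  rw [if_pos rfl, sub_eq_zero] at h2
  have h3 : ∑ p ∈ s ×ˢ s with δ p = 0, (c p.1 * c p.2 : ℚ) = ∑ x ∈ s, (c x : ℚ) ^ 2 := by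
    refine Finset.sum_nbij' (fun p => p.1) (fun x => (x, x)) ?_ ?_ ?_ ?_ ?_
    · intro p hp
      exact (Finset.mem_product.mp (Finset.mem_filter.mp hp).1).1
    · intro x hx
      simp [hx, hδ]
    · rintro ⟨⟨a, b⟩, ⟨c, d⟩⟩ hp
      have := (Finset.mem_filter.mp hp).2
      simp only [hδ, Prod.mk_eq_zero] at this
      ext <;> simp only <;> omega
    · intro _ _; rfl
    · rintro ⟨⟨a, b⟩, ⟨c', d⟩⟩ hp
      have := (Finset.mem_filter.mp hp).2
      simp only [hδ, Prod.mk_eq_zero] at this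
      have e1 : a = c' := by omega
      have e2 : b = d := by omega
      rw [e1, e2]; ring
  rw [h3] at h2
  exact_mod_cast h2

end Generic

/-! ### Partitions and diagrams -/

theorem rowLens_diagram {n : ℕ} (lam : n.Partition) :
    (diagram lam).rowLens = lam.parts.sort (· ≥ ·) :=
  YoungDiagram.rowLens_ofRowLens_eq_self fun _ hx =>
    lam.parts_pos ((Multiset.mem_sort (· ≥ ·)).mp hx)

theorem coe_rowLens_diagram {n : ℕ} (lam : n.Partition) :
    ((diagram lam).rowLens : Multiset ℕ) = lam.parts := by
  rw [rowLens_diagram, Multiset.sort_eq]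

theorem sum_rowLens (Y : YoungDiagram) : Y.rowLens.sum = Y.card := by
  rw [card_eq_sum_rowLen Y le_rfl, YoungDiagram.rowLens, Finset.sum_range, ← List.sum_ofFn]
  congr 1
  rw [List.ofFn_eq_map, ← List.map_coe_finRange_eq_range, List.map_map]
  rfl

theorem card_diagram {n : ℕ} (lam : n.Partition) : (diagram lam).card = n := by
  rw [← sum_rowLens, ← Multiset.sum_coe, coe_rowLens_diagram, lam.parts_sum]

theorem rowLens_injective {Y Z : YoungDiagram} (h : (Y.rowLens : Multiset ℕ) = Z.rowLens) :
    Y = Z := by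
  have h1 : Y.rowLens = Z.rowLens :=
    (Multiset.coe_eq_coe.mp h).eq_of_sortedGE Y.rowLens_sorted Z.rowLens_sorted
  rw [← YoungDiagram.ofRowLens_to_rowLens_eq_self (μ := Y),
    ← YoungDiagram.ofRowLens_to_rowLens_eq_self (μ := Z)]
  congr 1

theorem diagram_injective {n : ℕ} : Function.Injective (diagram (n := n)) := by
  intro a b h
  apply Nat.Partition.ext
  rw [← coe_rowLens_diagram, ← coe_rowLens_diagram, h]

theorem exists_diagram_eq (Y : YoungDiagram) : ∃ lam : Y.card.Partition, diagram lam = Y := by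
  refine ⟨⟨Y.rowLens, fun {i} hi => YoungDiagram.pos_of_mem_rowLens Y i hi, ?_⟩, ?_⟩
  · rw [Multiset.sum_coe, sum_rowLens]
  · exact rowLens_injective (coe_rowLens_diagram _)

/-- The finite set of Young diagrams with `n` boxes. -/
def diagrams (n : ℕ) : Finset YoungDiagram := Finset.univ.map ⟨diagram (n := n), diagram_injective⟩

theorem mem_diagrams {n : ℕ} {Y : YoungDiagram} : Y ∈ diagrams n ↔ Y.card = n := by
  simp only [diagrams, Finset.mem_map, Finset.mem_univ, true_and, Function.Embedding.coeFn_mk]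
  constructor
  · rintro ⟨lam, rfl⟩
    exact card_diagram lam
  · rintro rfl
    exact exists_diagram_eq Y

theorem sum_diagrams {M : Type*} [AddCommMonoid M] (n : ℕ) (f : YoungDiagram → M) :
    ∑ Y ∈ diagrams n, f Y = ∑ lam : n.Partition, f (diagram lam) := by
  rw [diagrams, Finset.sum_map]
  rfl

end

/-! ### Monomial symmetric functions -/

section

variable {F : Type*} [Field F]

/-- The multiplicities of the rows of a Young diagram. -/
def rowMult (Y : YoungDiagram) : ℕ+ →₀ ℕ :=
  Multiset.toFinsupp ((Y.rowLens : Multiset ℕ).map Nat.toPNat')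

theorem map_toMultiset_rowMult (Y : YoungDiagram) :
    (Finsupp.toMultiset (rowMult Y)).map ((↑) : ℕ+ → ℕ) = (Y.rowLens : Multiset ℕ) := by
  rw [rowMult, Multiset.toFinsupp_toMultiset, Multiset.map_map]
  conv_rhs => rw [← Multiset.map_id (Y.rowLens : Multiset ℕ)]
  refine Multiset.map_congr rfl fun x hx => ?_
  have := YoungDiagram.pos_of_mem_rowLens Y x hx
  simp [Nat.toPNat'_coe, this]

theorem rowMult_injective : Function.Injective rowMult := fun Y Z h =>
  rowLens_injective (by rw [← map_toMultiset_rowMult, h, map_toMultiset_rowMult])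

theorem weight_eq_sum (m : ℕ+ →₀ ℕ) : Finsupp.weight (fun k : ℕ+ => (k : ℕ)) m =
    ((Finsupp.toMultiset m).map ((↑) : ℕ+ → ℕ)).sum := by
  induction m using Finsupp.induction_linear with
  | zero => simp
  | add f g hf hg => simp only [map_add, Multiset.map_add, Multiset.sum_add, hf, hg]
  | single k n => simp [Finsupp.weight_single, Finsupp.toMultiset_single, Multiset.map_nsmul, Multiset.sum_nsmul]

theorem monomial_rowMult_mem_homog (Y : YoungDiagram) (a : F) :
    MvPolynomial.monomial (rowMult Y) a ∈ homog F Y.card := by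
  refine MvPolynomial.isWeightedHomogeneous_monomial _ _ _ ?_
  rw [weight_eq_sum, map_toMultiset_rowMult, Multiset.sum_coe, sum_rowLens]

/-- The coefficients of a homogeneous symmetric function in the monomial basis. -/
def mCoeffs (q t : F) (n : ℕ) : homog F n →ₗ[F] (diagrams n → F) :=
  LinearMap.pi fun Y => mCoeff q t Y ∘ₗ (homog F n).subtype

section

variable [CharZero F] {q t : F}

theorem mCoeffs_injective (h : Generic q t) (n : ℕ) : Function.Injective (mCoeffs q t n) := by
  rw [← LinearMap.ker_eq_bot, LinearMap.ker_eq_bot']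
  rintro ⟨f, hf⟩ h0
  ext1
  refine eq_zero_of_mCoeff h.q_pow_ne_one h.t_pow_ne_one fun Y => ?_
  by_cases hY : Y.card = n
  · exact congrFun h0 ⟨Y, mem_diagrams.mpr hY⟩
  · exact mCoeff_homog q t hf hY

/-- Monomial symmetric functions exist: a homogeneous symmetric function may have arbitrary
coefficients. -/
theorem mCoeffs_surjective (h : Generic q t) (n : ℕ) : Function.Surjective (mCoeffs q t n) := by
  set v : diagrams n → homog F n := fun Y => ⟨MvPolynomial.monomial (rowMult Y) 1, by
    have := monomial_rowMult_mem_homog (Y : YoungDiagram) (1 : F)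
    rwa [mem_diagrams.mp Y.2] at this⟩ with hv
  have hli : LinearIndependent F v := by
    refine LinearIndependent.of_comp (homog F n).subtype ?_
    have h1 := (MvPolynomial.basisMonomials ℕ+ F).linearIndependent.comp
      (fun Y : diagrams n => rowMult Y) (rowMult_injective.comp Subtype.val_injective)
    have h2 : (homog F n).subtype ∘ v =
        MvPolynomial.basisMonomials ℕ+ F ∘ fun Y : diagrams n => rowMult Y := by
      funext Y
      simp [hv]
    rw [h2]
    exact h1
  have hinj : Function.Injective (mCoeffs q t n ∘ₗ Fintype.linearCombination F v) :=
    (mCoeffs_injective h n).comp (linearIndependent_iff_injective_fintypeLinearCombination.mp hli)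
  have hsurj := LinearMap.injective_iff_surjective.mp hinj
  exact Function.Surjective.of_comp hsurj

theorem finiteDimensional_homog (h : Generic q t) (n : ℕ) : FiniteDimensional F (homog F n) :=
  Module.Finite.of_injective _ (mCoeffs_injective h n)

/-- A nonzero symmetric function has a monomial that is maximal in the dominance order. -/
theorem exists_maximal_mCoeff (h : Generic q t) {n : ℕ} {f : SymFun F} (hf : f ∈ homog F n)
    (h0 : f ≠ 0) : ∃ Y ∈ diagrams n, mCoeff q t Y f ≠ 0 ∧
      ∀ Z, Dom Y Z → Z ≠ Y → mCoeff q t Z f = 0 := by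
  classical
  have hne : ((diagrams n).filter fun Y => mCoeff q t Y f ≠ 0).Nonempty := by
    rw [Finset.nonempty_iff_ne_empty]
    intro he
    refine h0 (eq_zero_of_mCoeff h.q_pow_ne_one h.t_pow_ne_one fun Y => ?_)
    by_cases hY : Y.card = n
    · by_contra hYf
      have : Y ∈ (diagrams n).filter fun Y => mCoeff q t Y f ≠ 0 :=
        Finset.mem_filter.mpr ⟨mem_diagrams.mpr hY, hYf⟩
      rw [he] at this
      simp at this
    · exact mCoeff_homog q t hf hY
  obtain ⟨Y, hY, hmax⟩ := Finset.exists_max_image _ domStat hne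
  rw [Finset.mem_filter] at hY
  refine ⟨Y, hY.1, hY.2, fun Z hYZ hZ => ?_⟩
  by_contra hZf
  have := hmax Z (Finset.mem_filter.mpr ⟨mem_diagrams.mpr
    (hYZ.1.symm.trans (mem_diagrams.mp hY.1)), hZf⟩)
  exact absurd (hYZ.domStat_lt hZ.symm) (not_lt.mpr this)

theorem macOp_mem_homog (h : Generic q t) (a : F) {b : F} (hb : b ≠ 0) {n : ℕ} {f : SymFun F}
    (hf : f ∈ homog F n) : macOp a b 0 f ∈ homog F n := by
  refine mem_homog_of_mCoeff h.q_pow_ne_one h.t_pow_ne_one fun Y hY => ?_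
  rw [mCoeff_macOp h.q_pow_ne_one h.t_pow_ne_one a hb Y fun Z hZ _ =>
    mCoeff_homog q t hf (hZ.1 ▸ hY), mCoeff_homog q t hf hY, mul_zero]

/-! ### Macdonald symmetric functions as eigenvectors -/

/-- The homogeneous functions whose monomials are strictly dominated by `Y`. -/
def lowerSpace (q t : F) (Y : YoungDiagram) : Submodule F (SymFun F) where
  carrier := {f | f ∈ homog F Y.card ∧ ∀ Z, mCoeff q t Z f ≠ 0 → Dom Z Y ∧ Z ≠ Y}
  zero_mem' := ⟨Submodule.zero_mem _, fun Z hZ => absurd (by simp) hZ⟩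
  add_mem' := by
    rintro f g ⟨hf, hf'⟩ ⟨hg, hg'⟩
    refine ⟨Submodule.add_mem _ hf hg, fun Z hZ => ?_⟩
    by_cases h1 : mCoeff q t Z f = 0
    · refine hg' Z fun h2 => hZ ?_
      rw [map_add, h1, h2, add_zero]
    · exact hf' Z h1
  smul_mem' := by
    rintro a f ⟨hf, hf'⟩
    refine ⟨Submodule.smul_mem _ a hf, fun Z hZ => hf' Z fun h1 => hZ ?_⟩
    rw [map_smul, h1, smul_zero]

theorem mCoeff_macOp_eq_zero (h : Generic q t) (a : F) {b : F} (hb : b ≠ 0) {Y Z : YoungDiagram}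
    {f : SymFun F} (hf : ∀ X, mCoeff q t X f ≠ 0 → Dom X Y) (hZ : ¬ Dom Z Y) :
    mCoeff q t Z (macOp a b 0 f) = 0 := by
  have h1 : ∀ X, Dom Z X → mCoeff q t X f = 0 := fun X hX => by
    by_contra hXf
    exact hZ (hX.trans (hf X hXf))
  rw [mCoeff_macOp h.q_pow_ne_one h.t_pow_ne_one a hb Z fun X hX _ => h1 X hX, h1 Z (Dom.refl Z),
    mul_zero]

theorem exists_eigenvector (h : Generic q t) (Y : YoungDiagram) : ∃ f : SymFun F,
    f ∈ homog F Y.card ∧ mCoeff q t Y f = 1 ∧ (∀ Z, mCoeff q t Z f ≠ 0 → Dom Z Y) ∧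
      macOp q t 0 f = macEig q t Y • f := by
  classical
  have hq := h.q_pow_ne_one
  have ht := h.t_pow_ne_one
  have ht0 := h.t_ne_zero
  have := finiteDimensional_homog h Y.card
  have : FiniteDimensional F (lowerSpace q t Y) :=
    Submodule.finiteDimensional_of_le (S₂ := homog F Y.card) fun f hf => hf.1
  set T : SymFun F →ₗ[F] SymFun F := macOp q t 0 - macEig q t Y • LinearMap.id with hT
  have hTf : ∀ f, T f = macOp q t 0 f - macEig q t Y • f := fun f => rfl
  have hlow : ∀ f ∈ homog F Y.card, (∀ Z, mCoeff q t Z f ≠ 0 → Dom Z Y) →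
      T f ∈ lowerSpace q t Y := by
    intro f hfh hf
    refine ⟨Submodule.sub_mem _ (macOp_mem_homog h q ht0 hfh) (Submodule.smul_mem _ _ hfh),
      fun Z hZ => ?_⟩
    rw [hTf, map_sub, map_smul] at hZ
    by_contra hcon
    apply hZ
    by_cases hZY : Z = Y
    · subst hZY
      rw [mCoeff_macOp hq ht q ht0 Z fun X hX hne => ?_, smul_eq_mul, sub_self]
      by_contra hXf
      exact hne ((hf X hXf).antisymm hX)
    · have hZd : ¬ Dom Z Y := fun hd => hcon ⟨hd, hZY⟩
      have hZf : mCoeff q t Z f = 0 := by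
        by_contra hne
        exact hZd (hf Z hne)
      rw [mCoeff_macOp_eq_zero h q ht0 hf hZd, hZf, smul_zero, sub_zero]
  -- `E - e_Y` is injective, hence surjective, on the space of functions below `Y`.
  set R : lowerSpace q t Y →ₗ[F] lowerSpace q t Y :=
    T.restrict fun f hf => hlow f hf.1 fun Z hZ => (hf.2 Z hZ).1 with hR
  have hinj : Function.Injective R := by
    rw [← LinearMap.ker_eq_bot, LinearMap.ker_eq_bot']
    rintro ⟨f, hf⟩ h0
    have h1 : macOp q t 0 f = macEig q t Y • f :=
      sub_eq_zero.mp (congrArg (fun x : lowerSpace q t Y => (x : SymFun F)) h0)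
    by_contra hne
    have hf0 : f ≠ 0 := fun hz => hne (Subtype.ext hz)
    obtain ⟨Z, hZ, hZf, hmax⟩ := exists_maximal_mCoeff h hf.1 hf0
    have h2 := mCoeff_macOp hq ht q ht0 Z hmax
    rw [h1, map_smul, smul_eq_mul] at h2
    exact (hf.2 Z hZf).2 (h.macEig_injective (mul_right_cancel₀ hZf h2)).symm
  have hsurj := LinearMap.injective_iff_surjective.mp hinj
  obtain ⟨⟨m, hmh⟩, hm⟩ := mCoeffs_surjective h Y.card
    fun Z => if (Z : YoungDiagram) = Y then 1 else 0
  have hmZ : ∀ Z, mCoeff q t Z m = if Z = Y then 1 else 0 := by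
    intro Z
    by_cases hZ : Z.card = Y.card
    · exact congrFun hm ⟨Z, mem_diagrams.mpr hZ⟩
    · rw [mCoeff_homog q t hmh hZ, if_neg (fun h => hZ (by rw [h]))]
  have hmd : ∀ Z, mCoeff q t Z m ≠ 0 → Dom Z Y := by
    intro Z hZ
    rw [hmZ] at hZ
    by_cases hZY : Z = Y
    · rw [hZY]; exact Dom.refl Y
    · rw [if_neg hZY] at hZ; exact absurd rfl hZ
  obtain ⟨⟨g, hgh, hgl⟩, hg⟩ := hsurj ⟨T m, hlow m hmh hmd⟩
  have hg' : T g = T m := congrArg Subtype.val hg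
  have hgY : mCoeff q t Y g = 0 := by
    by_contra hne
    exact (hgl Y hne).2 rfl
  refine ⟨m - g, (homog F Y.card).sub_mem hmh hgh, ?_, fun Z hZ => ?_, ?_⟩
  · rw [map_sub, hgY, hmZ, if_pos rfl, sub_zero]
  · by_cases h1 : mCoeff q t Z m = 0
    · refine (hgl Z fun h2 => hZ ?_).1
      rw [map_sub, h1, h2, sub_zero]
    · exact hmd Z h1
  · rw [hTf, hTf] at hg'
    rw [map_sub, smul_sub]
    linear_combination -hg'

end

/-- The Macdonald symmetric function attached to a Young diagram, as an eigenvector of the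
Macdonald operator. -/
def macP (q t : F) (Y : YoungDiagram) : SymFun F :=
  Classical.epsilon fun f => f ∈ homog F Y.card ∧ mCoeff q t Y f = 1 ∧
    (∀ Z, mCoeff q t Z f ≠ 0 → Dom Z Y) ∧ macOp q t 0 f = macEig q t Y • f

section

variable [CharZero F] {q t : F}

theorem macP_mem_homog (h : Generic q t) (Y : YoungDiagram) : macP q t Y ∈ homog F Y.card :=
  (Classical.epsilon_spec (exists_eigenvector h Y)).1

theorem mCoeff_macP_self (h : Generic q t) (Y : YoungDiagram) : mCoeff q t Y (macP q t Y) = 1 :=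
  (Classical.epsilon_spec (exists_eigenvector h Y)).2.1

theorem dom_of_mCoeff_macP (h : Generic q t) {Y Z : YoungDiagram}
    (hZ : mCoeff q t Z (macP q t Y) ≠ 0) : Dom Z Y :=
  (Classical.epsilon_spec (exists_eigenvector h Y)).2.2.1 Z hZ

theorem macOp_macP (h : Generic q t) (Y : YoungDiagram) :
    macOp q t 0 (macP q t Y) = macEig q t Y • macP q t Y :=
  (Classical.epsilon_spec (exists_eigenvector h Y)).2.2.2

theorem macP_ne_zero (h : Generic q t) (Y : YoungDiagram) : macP q t Y ≠ 0 := by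
  intro h0
  have := mCoeff_macP_self h Y
  rw [h0, map_zero] at this
  exact zero_ne_one this

theorem macForm_macOp (h : Generic q t) (f g : SymFun F) :
    macForm q t (macOp q t 0 f) g = macForm q t f (macOp q t 0 g) := by
  refine macForm_vertexOp q t (α := t⁻¹) (fun n => ?_) f g
  rcases Nat.eq_zero_or_pos n with rfl | hn
  · simp
  have h1 : 1 - t ^ n ≠ 0 := sub_ne_zero.mpr (h.t_pow_ne_one n hn).symm
  have h2 : t ^ n ≠ 0 := pow_ne_zero _ h.t_ne_zero
  rw [kap, inv_pow]
  field_simp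
  ring

theorem macForm_macOp_inv (h : Generic q t) (f g : SymFun F) :
    macForm q t (macOp q⁻¹ t⁻¹ 0 f) g = macForm q t f (macOp q⁻¹ t⁻¹ 0 g) := by
  refine macForm_vertexOp q t (α := q) (fun n => ?_) f g
  rcases Nat.eq_zero_or_pos n with rfl | hn
  · simp
  have h1 : 1 - t ^ n ≠ 0 := sub_ne_zero.mpr (h.t_pow_ne_one n hn).symm
  have h2 : q ^ n ≠ 0 := pow_ne_zero _ h.q_ne_zero
  rw [kap, inv_pow, inv_pow, inv_pow, inv_inv, mul_sub, mul_inv_cancel₀ h2, mul_div_cancel₀ _ h1, mul_one]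

theorem macForm_macP_of_ne (h : Generic q t) {Y Z : YoungDiagram} (hYZ : Y ≠ Z) :
    macForm q t (macP q t Y) (macP q t Z) = 0 := by
  have h1 := macForm_macOp h (macP q t Y) (macP q t Z)
  rw [macOp_macP h, macOp_macP h, map_smul, map_smul, LinearMap.smul_apply, smul_eq_mul,
    smul_eq_mul] at h1
  by_contra hne
  exact hYZ (h.macEig_injective (mul_right_cancel₀ hne h1))

theorem exists_sum_macP (h : Generic q t) {n : ℕ} {f : SymFun F} (hf : f ∈ homog F n) :
    ∃ a : YoungDiagram → F, f = ∑ Y ∈ diagrams n, a Y • macP q t Y := by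
  classical
  set v : diagrams n → homog F n := fun Y => ⟨macP q t Y, by
    have := macP_mem_homog h (Y : YoungDiagram)
    rwa [mem_diagrams.mp Y.2] at this⟩ with hv
  have hli : LinearIndependent F v := by
    refine LinearIndependent.of_comp (homog F n).subtype ?_
    exact Module.End.eigenvectors_linearIndependent' (macOp q t 0) (fun Y : diagrams n => macEig q t Y)
      (h.macEig_injective.comp Subtype.val_injective) (fun Y => macP q t Y)
      fun Y => ⟨Module.End.mem_eigenspace_iff.mpr (macOp_macP h Y), macP_ne_zero h Y⟩
  have hinj : Function.Injective (mCoeffs q t n ∘ₗ Fintype.linearCombination F v) :=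
    (mCoeffs_injective h n).comp (linearIndependent_iff_injective_fintypeLinearCombination.mp hli)
  have hsurj := LinearMap.injective_iff_surjective.mp hinj
  obtain ⟨a, ha⟩ := hsurj (mCoeffs q t n ⟨f, hf⟩)
  have h1 : Fintype.linearCombination F v a = ⟨f, hf⟩ := mCoeffs_injective h n ha
  have h2 := congrArg Subtype.val h1
  rw [Fintype.linearCombination_apply, Submodule.coe_sum] at h2
  refine ⟨fun Y => if hY : Y ∈ diagrams n then a ⟨Y, hY⟩ else 0, ?_⟩
  rw [← Finset.sum_coe_sort]
  refine h2.symm.trans ?_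
  exact Finset.sum_congr rfl fun Y _ => by simp [hv]

theorem macForm_macP_self_ne_zero (h : Generic q t) (Y : YoungDiagram) :
    macForm q t (macP q t Y) (macP q t Y) ≠ 0 := by
  intro h0
  refine macP_ne_zero h Y (eq_zero_of_mCoeff h.q_pow_ne_one h.t_pow_ne_one fun Z => ?_)
  by_cases hZ : Z.card = Y.card
  · obtain ⟨a, ha⟩ := exists_sum_macP h (gProd_mem_homog q t Z)
    rw [mCoeff_apply, ha, map_sum]
    refine Finset.sum_eq_zero fun X _ => ?_
    rw [map_smul]
    by_cases hX : Y = X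
    · rw [← hX, h0, smul_zero]
    · rw [macForm_macP_of_ne h hX, smul_zero]
  · exact mCoeff_homog q t (macP_mem_homog h Y) hZ

theorem eq_sum_macP (h : Generic q t) {n : ℕ} {f : SymFun F} (hf : f ∈ homog F n) :
    f = ∑ Y ∈ diagrams n,
      (macForm q t f (macP q t Y) / macForm q t (macP q t Y) (macP q t Y)) • macP q t Y := by
  obtain ⟨a, ha⟩ := exists_sum_macP h hf
  conv_lhs => rw [ha]
  refine Finset.sum_congr rfl fun Y hY => ?_
  have h1 : macForm q t f (macP q t Y) = a Y * macForm q t (macP q t Y) (macP q t Y) := by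
    rw [ha, map_sum, LinearMap.sum_apply, Finset.sum_eq_single Y]
    · rw [map_smul, LinearMap.smul_apply, smul_eq_mul]
    · intro Z _ hZ
      rw [map_smul, LinearMap.smul_apply, macForm_macP_of_ne h hZ, smul_zero]
    · exact fun hn => absurd hY hn
  rw [h1, mul_div_cancel_right₀ _ (macForm_macP_self_ne_zero h Y)]

/-- A function whose monomials are dominated by `Y` is a combination of the `P_Z` with `Z ≤ Y`. -/
theorem dom_of_macForm (h : Generic q t) {n : ℕ} {f : SymFun F} (hf : f ∈ homog F n)
    {Y Z : YoungDiagram} (hY : ∀ X, mCoeff q t X f ≠ 0 → Dom X Y)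
    (hZ : macForm q t f (macP q t Z) ≠ 0) : Dom Z Y := by
  classical
  have hcard : ∀ X, macForm q t f (macP q t X) ≠ 0 → X ∈ diagrams n := fun X hX => by
    rw [mem_diagrams]
    by_contra hne
    exact hX (macForm_homog q t (Ne.symm hne) hf (macP_mem_homog h X))
  induction hm : (Z.card + 1) * Z.card - domStat Z using Nat.strong_induction_on generalizing Z with
  | _ m ih =>
  by_contra hcon
  have h1 : mCoeff q t Z f = 0 := by
    by_contra hne
    exact hcon (hY Z hne)
  rw [eq_sum_macP h hf, map_sum, Finset.sum_eq_single Z] at h1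
  · rw [map_smul, mCoeff_macP_self h, smul_eq_mul, mul_one] at h1
    exact div_ne_zero hZ (macForm_macP_self_ne_zero h Z) h1
  · intro X _ hXZ
    rw [map_smul, smul_eq_mul, mul_eq_zero, div_eq_zero_iff]
    by_contra hne
    push Not at hne
    have hdom := dom_of_mCoeff_macP h hne.2
    have hlt := hdom.domStat_lt hXZ.symm
    have h2 := domStat_le X
    refine hcon (hdom.trans (ih _ ?_ hne.1.1 rfl))
    rw [← hdom.1] at h2 ⊢
    omega
  · exact fun hn => absurd (hcard Z hZ) hn

/-- The functions `P_Y` are eigenvectors of the operator with inverted parameters as well. -/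
theorem macOp_inv_macP (h : Generic q t) (Y : YoungDiagram) :
    macOp q⁻¹ t⁻¹ 0 (macP q t Y) = macEig q⁻¹ t⁻¹ Y • macP q t Y := by
  have ht' : t⁻¹ ≠ 0 := inv_ne_zero h.t_ne_zero
  have hdom : ∀ {Y Z : YoungDiagram},
      macForm q t (macOp q⁻¹ t⁻¹ 0 (macP q t Y)) (macP q t Z) ≠ 0 → Dom Z Y := by
    intro Y Z hZ
    refine dom_of_macForm h (macOp_mem_homog h _ ht' (macP_mem_homog h Y)) (fun X hX => ?_) hZ
    by_contra hXY
    exact hX (mCoeff_macOp_eq_zero h _ ht' (fun W hW => dom_of_mCoeff_macP h hW) hXY)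
  have h1 := eq_sum_macP h (macOp_mem_homog h q⁻¹ ht' (macP_mem_homog h Y))
  rw [Finset.sum_eq_single Y] at h1
  · have h2 := congrArg (mCoeff q t Y) h1
    rw [mCoeff_macOp h.q_pow_ne_one h.t_pow_ne_one _ ht' Y fun Z hZ hne => ?_, map_smul,
      mCoeff_macP_self h, smul_eq_mul, mul_one, mul_one] at h2
    · rw [h1, ← h2]
    · by_contra hZf
      exact hne ((dom_of_mCoeff_macP h hZf).antisymm hZ)
  · intro Z _ hZ
    rw [div_eq_zero_iff.mpr (Or.inl ?_), zero_smul]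
    by_contra hne
    have hd1 := hdom hne
    rw [macForm_macOp_inv h, macForm_comm] at hne
    exact hZ (hd1.antisymm (hdom hne))
  · exact fun hn => absurd (mem_diagrams.mpr rfl) hn

end

end

/-! ### Identification of the Macdonald functions -/

section

variable {F : Type*} [Field F]

theorem filter_map_rowLen (Y : YoungDiagram) {N : ℕ} (hY : Y.colLen 0 ≤ N) :
    ((Finset.range N).val.map Y.rowLen).filter (· ≠ 0) = (Y.rowLens : Multiset ℕ) := by
  have h : (Finset.range N).filter (fun i => Y.rowLen i ≠ 0) = Finset.range (Y.colLen 0) := by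
    ext i
    rw [Finset.mem_filter, Finset.mem_range, Finset.mem_range, ← Nat.pos_iff_ne_zero,
      ← YoungDiagram.mem_iff_lt_rowLen, YoungDiagram.mem_iff_lt_colLen]
    omega
  rw [Multiset.filter_map]
  change Multiset.map Y.rowLen ((Finset.range N).filter (fun i => Y.rowLen i ≠ 0)).val = _
  rw [h]
  rfl

theorem map_count_dedup {N : ℕ} (s : Multiset (Fin N)) {Y : YoungDiagram}
    {σ : Equiv.Perm (Fin N)} (hY : Y.colLen 0 ≤ N) (h : ∀ i, s.count i = Y.rowLen (σ i)) :
    s.dedup.map s.count = (Y.rowLens : Multiset ℕ) := by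
  have h1 : s.toFinset = Finset.univ.filter fun i => s.count i ≠ 0 := by
    ext i
    simp [Multiset.count_eq_zero]
  have h2 : (Finset.univ : Finset (Fin N)).val.map s.count = (Finset.range N).val.map Y.rowLen := by
    have h3 : (Finset.univ : Finset (Fin N)).val.map σ = Finset.univ.val := by
      have := Finset.map_univ_equiv σ
      exact congrArg Finset.val this
    have h4 : s.count = (fun i : Fin N => Y.rowLen i) ∘ σ := funext h
    rw [h4, ← Multiset.map_map, h3]
    rw [Fin.univ_val_map, List.ofFn_eq_map]
    change _ = ((List.map Y.rowLen (List.range N) : List ℕ) : Multiset ℕ)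
    rw [← List.map_coe_finRange_eq_range, List.map_map]
    rfl
  rw [← Multiset.toFinset_val, h1, ← filter_map_rowLen Y hY, ← h2, Multiset.filter_map]
  rfl

theorem prod_map_X {N : ℕ} (s : Multiset (Fin N)) :
    (s.map (MvPolynomial.X : Fin N → MvPolynomial (Fin N) F)).prod =
      MvPolynomial.monomial (Multiset.toFinsupp s) 1 := by
  classical
  induction s using Multiset.induction_on with
  | empty => simp
  | cons a s ih =>
    rw [Multiset.map_cons, Multiset.prod_cons, ih, MvPolynomial.X, MvPolynomial.monomial_mul,
      ← Multiset.singleton_add, map_add, Multiset.toFinsupp_singleton, one_mul]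

theorem coeff_msymm [DecidableEq YoungDiagram] {N n : ℕ} (mu : n.Partition) {α : Fin N →₀ ℕ} {Y : YoungDiagram}
    {σ : Equiv.Perm (Fin N)} (hY : Y.colLen 0 ≤ N) (h : ∀ i, α i = Y.rowLen (σ i)) :
    (MvPolynomial.msymm (Fin N) F mu).coeff α = if diagram mu = Y then 1 else 0 := by
  classical
  rw [MvPolynomial.msymm, MvPolynomial.coeff_sum]
  simp only [prod_map_X, MvPolynomial.coeff_monomial]
  split_ifs with hmu
  · have hcount : ∀ i, (Finsupp.toMultiset α).count i = Y.rowLen (σ i) := fun i => by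
      rw [Finsupp.count_toMultiset, h]
    have hcard : Multiset.card (Finsupp.toMultiset α) = n := by
      rw [Finsupp.card_toMultiset, Finsupp.sum_fintype _ _ (by simp)]
      simp only [id]
      rw [← card_of_perm hY h, ← hmu,
        card_diagram]
    have hsym : Nat.Partition.ofSym (⟨Finsupp.toMultiset α, hcard⟩ : Sym (Fin N) n) = mu := by
      apply Nat.Partition.ext
      rw [← coe_rowLens_diagram mu, hmu]
      exact map_count_dedup _ hY hcount
    rw [Finset.sum_eq_single ⟨⟨Finsupp.toMultiset α, hcard⟩, hsym⟩]
    · rw [if_pos]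
      simp
    · rintro ⟨⟨s, hs⟩, hs'⟩ _ hne
      rw [if_neg]
      rintro rfl
      exact hne (by simp)
    · simp
  · refine Finset.sum_eq_zero ?_
    rintro ⟨⟨s, hs⟩, hs'⟩ _
    rw [if_neg]
    rintro rfl
    apply hmu
    apply rowLens_injective
    rw [coe_rowLens_diagram, ← hs']
    exact map_count_dedup s hY fun i => by rw [← h, Multiset.toFinsupp_apply]

theorem dominanceLE_iff {n : ℕ} (mu lam : n.Partition) :
    DominanceLE mu lam ↔ Dom (diagram mu) (diagram lam) :=
  ⟨fun h => ⟨by rw [card_diagram, card_diagram], h⟩, fun h => h.2⟩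

section

variable [CharZero F] {q t : F}

theorem isMacdonaldFamily_macP (h : Generic q t) (n : ℕ) :
    IsMacdonaldFamily q t n fun lam => macP q t (diagram lam) where
  triangular lam := by
    classical
    refine ⟨fun mu => mCoeff q t (diagram mu) (macP q t (diagram lam)), mCoeff_macP_self h _,
      fun mu hmu => (dominanceLE_iff mu lam).mpr (dom_of_mCoeff_macP h hmu), fun N => ?_⟩
    ext α
    obtain ⟨Y, σ, hY, hσ⟩ := exists_diagram_perm α
    rw [coeff_evalVars_of_perm h.q_pow_ne_one h.t_pow_ne_one hY hσ, MvPolynomial.coeff_sum]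
    simp only [MvPolynomial.coeff_smul, coeff_msymm _ hY hσ, smul_eq_mul, mul_ite, mul_one,
      mul_zero]
    by_cases hn : Y.card = n
    · subst hn
      obtain ⟨nu, hnu⟩ := exists_diagram_eq Y
      rw [Finset.sum_eq_single nu]
      · rw [if_pos hnu, hnu]
      · intro mu _ hmu
        exact if_neg fun he => hmu (diagram_injective (he.trans hnu.symm))
      · simp
    · rw [mCoeff_homog q t (macP_mem_homog h _) (by rwa [card_diagram]), eq_comm]
      exact Finset.sum_eq_zero fun mu _ => if_neg fun he => hn (by rw [← he, card_diagram])
  orthogonal lam mu hne := macForm_macP_of_ne h fun he => hne (diagram_injective he)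

theorem mCoeff_of_isMacdonaldFamily (h : Generic q t) {n : ℕ} {Q : n.Partition → SymFun F}
    (hQ : IsMacdonaldFamily q t n Q) (lam : n.Partition) : Q lam ∈ homog F n ∧
      mCoeff q t (diagram lam) (Q lam) = 1 ∧
      ∀ Z, mCoeff q t Z (Q lam) ≠ 0 → Dom Z (diagram lam) := by
  classical
  obtain ⟨u, hu1, hu2, hu3⟩ := hQ.triangular lam
  have hm : ∀ Y, mCoeff q t Y (Q lam) = ∑ mu, if diagram mu = Y then u mu else 0 := by
    intro Y
    rw [← coeff_evalVars_of_perm h.q_pow_ne_one h.t_pow_ne_one (N := Y.colLen 0)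
      (α := Finsupp.equivFunOnFinite.symm fun i => Y.rowLen i) (σ := 1) le_rfl (fun i => rfl), hu3,
      MvPolynomial.coeff_sum]
    refine Finset.sum_congr rfl fun mu _ => ?_
    rw [MvPolynomial.coeff_smul, coeff_msymm mu (σ := 1) le_rfl fun i => rfl, smul_eq_mul, mul_ite,
      mul_one, mul_zero]
  have hmu : ∀ mu, mCoeff q t (diagram mu) (Q lam) = u mu := by
    intro mu
    rw [hm, Finset.sum_eq_single mu]
    · rw [if_pos rfl]
    · exact fun nu _ hne => if_neg fun he => hne (diagram_injective he)
    · simp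
  have hz : ∀ Z, mCoeff q t Z (Q lam) ≠ 0 → ∃ mu : n.Partition, diagram mu = Z := by
    intro Z hZ
    by_contra hcon
    push Not at hcon
    exact hZ (by rw [hm]; exact Finset.sum_eq_zero fun mu _ => if_neg (hcon mu))
  refine ⟨mem_homog_of_mCoeff h.q_pow_ne_one h.t_pow_ne_one fun Y hY => ?_, ?_, ?_⟩
  · by_contra hne
    obtain ⟨mu, rfl⟩ := hz Y hne
    exact hY (card_diagram mu)
  · rw [hmu, hu1]
  · intro Z hZ
    obtain ⟨mu, rfl⟩ := hz Z hZ
    rw [hmu] at hZ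
    exact (dominanceLE_iff mu lam).mp (hu2 mu hZ)

/-- The Macdonald functions are characterized by triangularity and orthogonality. -/
theorem eq_macP_of_isMacdonaldFamily (h : Generic q t) {n : ℕ} {Q : n.Partition → SymFun F}
    (hQ : IsMacdonaldFamily q t n Q) (lam : n.Partition) : Q lam = macP q t (diagram lam) := by
  induction hm : domStat (diagram lam) using Nat.strong_induction_on generalizing lam with
  | _ m ih =>
  obtain ⟨h1, h2, h3⟩ := mCoeff_of_isMacdonaldFamily h hQ lam
  have h4 := eq_sum_macP h h1
  rw [Finset.sum_eq_single (diagram lam)] at h4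
  · have h5 := congrArg (mCoeff q t (diagram lam)) h4
    rw [h2, map_smul, mCoeff_macP_self h, smul_eq_mul, mul_one] at h5
    rw [h4, ← h5, one_smul]
  · intro Z hZ hne
    obtain ⟨mu, rfl⟩ : ∃ mu : n.Partition, diagram mu = Z := by
      obtain rfl := mem_diagrams.mp hZ
      exact exists_diagram_eq Z
    rw [div_eq_zero_iff.mpr (Or.inl ?_), zero_smul]
    by_contra hcon
    have hdom := dom_of_macForm h h1 h3 hcon
    apply hcon
    rw [← ih _ (by rw [← hm]; exact hdom.domStat_lt hne) mu rfl]
    exact hQ.orthogonal lam mu fun he => hne (by rw [he])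
  · exact fun hn => absurd (mem_diagrams.mpr (card_diagram lam)) hn

theorem macdonaldP_eq (h : Generic q t) {n : ℕ} (lam : n.Partition) :
    macdonaldP q t n lam = macP q t (diagram lam) :=
  eq_macP_of_isMacdonaldFamily h (Classical.epsilon_spec ⟨_, isMacdonaldFamily_macP h n⟩) lam

end

end

/-! ### The Pieri rule -/

section

variable {F : Type*} [Field F]

theorem X_one_mem_homog : (MvPolynomial.X 1 : SymFun F) ∈ homog F 1 := pSum_mem_homog 0

variable [CharZero F] {q t : F}

theorem one_sub_ne_zero_of_generic (h : Generic q t) : q - 1 ≠ 0 ∧ 1 - t ≠ 0 := by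
  have h1 := h.q_pow_ne_one 1 one_pos
  have h2 := h.t_pow_ne_one 1 one_pos
  rw [pow_one] at h1 h2
  exact ⟨sub_ne_zero.mpr h1, sub_ne_zero.mpr h2.symm⟩

theorem macOp_one_mem_homog (h : Generic q t) {n : ℕ} {f : SymFun F} (hf : f ∈ homog F n) :
    macOp q t 1 f ∈ homog F (1 + n) := by
  have h1 := (one_sub_ne_zero_of_generic h).1
  have h2 : macOp q t 1 f = (q - 1)⁻¹ • (macOp q t 0 (MvPolynomial.X 1 * f) -
      MvPolynomial.X 1 * macOp q t 0 f) := by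
    rw [macOp_p1_comm, smul_smul, inv_mul_cancel₀ h1, one_smul]
  rw [h2]
  exact Submodule.smul_mem _ _ (Submodule.sub_mem _
    (macOp_mem_homog h q h.t_ne_zero (mul_mem_homog X_one_mem_homog hf))
    (mul_mem_homog X_one_mem_homog (macOp_mem_homog h q h.t_ne_zero hf)))

theorem macForm_macOp_one (h : Generic q t) (Y Z : YoungDiagram) :
    (q - 1) * macForm q t (macOp q t 1 (macP q t Y)) (macP q t Z) =
      (macEig q t Z - macEig q t Y) * macForm q t (MvPolynomial.X 1 * macP q t Y) (macP q t Z) := by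
  have h1 := congrArg (fun f => macForm q t f (macP q t Z)) (macOp_p1_comm q t (macP q t Y))
  simp only [map_sub, map_smul, LinearMap.sub_apply, LinearMap.smul_apply, smul_eq_mul] at h1
  rw [macForm_macOp h, macOp_macP h, macOp_macP h, map_smul, mul_smul_comm, map_smul,
    LinearMap.smul_apply, smul_eq_mul, smul_eq_mul] at h1
  rw [← h1]
  ring

theorem macEig_sub (Y Z : YoungDiagram) : macEig q t Z - macEig q t Y =
    (q - 1) * (1 - t⁻¹) * (∑ s ∈ Z.cells, q ^ s.2 * t⁻¹ ^ s.1 - ∑ s ∈ Y.cells, q ^ s.2 * t⁻¹ ^ s.1) := by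
  rw [macEig, macEig]
  ring

/-- Multiplication by `p₁` adds a box. This follows from the relation between the commutators of
`p₁` with the Macdonald operators for `(q, t)` and `(q⁻¹, t⁻¹)`. -/
theorem pieri_one (h : Generic q t) {Y Z : YoungDiagram}
    (hne : macForm q t (MvPolynomial.X 1 * macP q t Y) (macP q t Z) ≠ 0) :
    ∃ s, s ∉ Y.cells ∧ Z.cells = insert s Y.cells := by
  classical
  have hq := h.q_ne_zero
  have ht := h.t_ne_zero
  obtain ⟨hq1, ht1⟩ := one_sub_ne_zero_of_generic h
  have hcard : 1 + Y.card = Z.card := by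
    by_contra hc
    exact hne (macForm_homog q t hc (mul_mem_homog X_one_mem_homog (macP_mem_homog h Y))
      (macP_mem_homog h Z))
  have h1 := macForm_macOp_one h Y Z
  have h2 := congrArg (fun f => macForm q t f (macP q t Z))
    (macOp_inv_comm hq ht h.q_ne_t (macP q t Y))
  simp only [map_sub, map_smul, LinearMap.sub_apply, LinearMap.smul_apply, smul_eq_mul] at h2
  rw [macForm_macOp_inv h, macOp_inv_macP h, macOp_inv_macP h, map_smul, map_smul, map_smul,
    LinearMap.smul_apply, smul_eq_mul, smul_eq_mul, ← sub_mul] at h2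
  set a := macForm q t (MvPolynomial.X 1 * macP q t Y) (macP q t Z)
  set b := macForm q t (macOp q t 1 (macP q t Y)) (macP q t Z)
  have h3 : (macEig q⁻¹ t⁻¹ Z - macEig q⁻¹ t⁻¹ Y) * (macEig q t Z - macEig q t Y) =
      (q - 1) * ((q - 1) * (1 - t) ^ 2 / (q * t)) := by
    refine mul_right_cancel₀ hne ?_
    linear_combination (q - 1) * h2 - (macEig q⁻¹ t⁻¹ Z - macEig q⁻¹ t⁻¹ Y) * h1
  rw [macEig_sub, macEig_sub] at h3
  set c : ℕ × ℕ → ℤ := fun x => (if x ∈ Z.cells then 1 else 0) - (if x ∈ Y.cells then 1 else 0)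
    with hc
  have hsum : ∀ q t : F, ∑ x ∈ Z.cells ∪ Y.cells, (c x : F) * (q ^ x.2 * t⁻¹ ^ x.1) =
      ∑ s ∈ Z.cells, q ^ s.2 * t⁻¹ ^ s.1 - ∑ s ∈ Y.cells, q ^ s.2 * t⁻¹ ^ s.1 := by
    intro q t
    simp only [hc, Int.cast_sub, apply_ite (Int.cast : ℤ → F), Int.cast_one, Int.cast_zero, sub_mul,
      ite_mul, one_mul, zero_mul, Finset.sum_sub_distrib]
    rw [← Finset.sum_filter, ← Finset.sum_filter, Finset.filter_mem_eq_inter,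
      Finset.filter_mem_eq_inter, Finset.union_inter_cancel_left, Finset.union_inter_cancel_right]
  have h4 := h.sum_sq_eq_one (Z.cells ∪ Y.cells) c (by
    rw [hsum, hsum]
    refine mul_left_cancel₀ (a := (q - 1) * ((q - 1) * (1 - t) ^ 2 / (q * t)))
      (mul_ne_zero hq1 (div_ne_zero (mul_ne_zero hq1 (pow_ne_zero _ ht1)) (mul_ne_zero hq ht))) ?_
    refine Eq.trans ?_ (h3.trans (mul_one _).symm)
    have h5 : (q⁻¹ - 1) * (1 - t⁻¹⁻¹) * ((q - 1) * (1 - t⁻¹)) =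
        (q - 1) * ((q - 1) * (1 - t) ^ 2 / (q * t)) := by
      rw [inv_inv]
      field_simp
      ring
    rw [← h5]
    ring)
  have h6 : ∀ x, c x ^ 2 = (if x ∈ Z.cells \ Y.cells then 1 else 0) +
      (if x ∈ Y.cells \ Z.cells then 1 else 0) := by
    intro x
    by_cases hY : x ∈ Y.cells <;> by_cases hZ : x ∈ Z.cells <;> simp only [hc, hY, hZ,
      Finset.mem_sdiff] <;> simp
  rw [Finset.sum_congr rfl fun x _ => h6 x, Finset.sum_add_distrib, ← Finset.sum_filter,
    ← Finset.sum_filter, Finset.filter_mem_eq_inter, Finset.filter_mem_eq_inter,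
    Finset.inter_eq_right.mpr (Finset.sdiff_subset.trans Finset.subset_union_left),
    Finset.inter_eq_right.mpr (Finset.sdiff_subset.trans Finset.subset_union_right)] at h4
  simp only [Finset.sum_const, nsmul_eq_mul, mul_one] at h4
  have h7 := Finset.card_sdiff_add_card_inter Z.cells Y.cells
  have h8 := Finset.card_sdiff_add_card_inter Y.cells Z.cells
  rw [Finset.inter_comm] at h8
  have h9 : Z.cells.card = 1 + Y.cells.card := hcard.symm
  have h10 : (Z.cells \ Y.cells).card = 1 := by omega
  have h11 : (Y.cells \ Z.cells).card = 0 := by omega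
  have hsub : Y.cells ⊆ Z.cells := by
    rwa [Finset.card_eq_zero, Finset.sdiff_eq_empty_iff_subset] at h11
  obtain ⟨s, hs⟩ := Finset.card_eq_one.mp h10
  refine ⟨s, ?_, ?_⟩
  · have : s ∈ Z.cells \ Y.cells := by rw [hs]; exact Finset.mem_singleton_self s
    exact (Finset.mem_sdiff.mp this).2
  · rw [← Finset.sdiff_union_of_subset hsub, hs]
    rfl

/-- The matrix coefficients of `macOp q t 1` are those of `p₁`, weighted by the added box. -/
theorem macForm_macOp_one_eq (h : Generic q t) {Y Z : YoungDiagram} {s : ℕ × ℕ}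
    (hs : s ∉ Y.cells) (hZ : Z.cells = insert s Y.cells) :
    macForm q t (macOp q t 1 (macP q t Y)) (macP q t Z) = (1 - t⁻¹) * (q ^ s.2 * t⁻¹ ^ s.1) *
      macForm q t (MvPolynomial.X 1 * macP q t Y) (macP q t Z) := by
  refine mul_left_cancel₀ (one_sub_ne_zero_of_generic h).1 ?_
  rw [macForm_macOp_one h, macEig_sub, hZ, Finset.sum_insert hs]
  ring

theorem macForm_map_eq_sum (h : Generic q t) {n : ℕ} {f : SymFun F} (hf : f ∈ homog F n)
    (φ : SymFun F →ₗ[F] SymFun F) (g : SymFun F) : macForm q t (φ f) g =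
      ∑ Y ∈ diagrams n, macForm q t f (macP q t Y) / macForm q t (macP q t Y) (macP q t Y) *
        macForm q t (φ (macP q t Y)) g := by
  conv_lhs => rw [eq_sum_macP h hf]
  rw [map_sum, map_sum, LinearMap.sum_apply]
  refine Finset.sum_congr rfl fun Y _ => ?_
  rw [map_smul, map_smul, LinearMap.smul_apply, smul_eq_mul]

/-- The skew diagram `Z / Y` has at most one box in each row. -/
def VerticalStrip (Y Z : YoungDiagram) : Prop := Y ≤ Z ∧ ∀ i j, (i, j + 1) ∈ Z → (i, j) ∈ Y

/-- Multiplication by `e_r` adds a vertical strip. -/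
theorem pieri (h : Generic q t) (r : ℕ) {Y Z : YoungDiagram}
    (hne : macForm q t (eFun F r * macP q t Y) (macP q t Z) ≠ 0) : VerticalStrip Y Z := by
  classical
  induction r generalizing Y Z with
  | zero =>
    rw [eFun_zero, one_mul] at hne
    by_cases hYZ : Y = Z
    · subst hYZ
      exact ⟨le_rfl, fun i j hij => Y.up_left_mem le_rfl (Nat.le_succ j) hij⟩
    · exact absurd (macForm_macP_of_ne h hYZ) hne
  | succ r ih =>
    have hcard : r + 1 + Y.card = Z.card := by
      by_contra hc
      exact hne (macForm_homog q t hc (mul_mem_homog (hSeries_mem_homog _ _) (macP_mem_homog h Y))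
        (macP_mem_homog h Z))
    have hE : macEig q t Z - macEig q t Y ≠ 0 := by
      refine sub_ne_zero.mpr fun he => ?_
      rw [h.macEig_injective he] at hcard
      omega
    have h1 := congrArg (fun f => macForm q t f (macP q t Z)) (macOp_eFun_mul q t r (macP q t Y))
    simp only [map_add, LinearMap.add_apply] at h1
    rw [macForm_macOp h, macOp_macP h, macOp_macP h, map_smul, mul_smul_comm, map_smul,
      LinearMap.smul_apply, smul_eq_mul, smul_eq_mul, mul_assoc (MvPolynomial.C q),
      ← MvPolynomial.smul_eq_C_mul, map_smul, LinearMap.smul_apply, smul_eq_mul] at h1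
    -- Both products expand over the intermediate diagrams.
    have hl := macForm_map_eq_sum h (macOp_one_mem_homog h (macP_mem_homog h Y))
      (LinearMap.mulLeft F (eFun F r)) (macP q t Z)
    have hl' := macForm_map_eq_sum h (mul_mem_homog X_one_mem_homog (macP_mem_homog h Y))
      (LinearMap.mulLeft F (eFun F r)) (macP q t Z)
    have heY : eFun F r * macP q t Y ∈ homog F (r + Y.card) :=
      mul_mem_homog (hSeries_mem_homog _ _) (macP_mem_homog h Y)
    have hr := macForm_map_eq_sum h heY (macOp q t 1) (macP q t Z)
    have hr' := macForm_map_eq_sum h heY (LinearMap.mulLeft F (MvPolynomial.X 1)) (macP q t Z)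
    simp only [LinearMap.mulLeft_apply] at hl hl' hr hr'
    -- The pairings with `E₁` and with `p₁` are proportional, so that they vanish together.
    have hone : ∀ W V : YoungDiagram,
        macForm q t (MvPolynomial.X 1 * macP q t W) (macP q t V) = 0 →
        macForm q t (macOp q t 1 (macP q t W)) (macP q t V) = 0 := fun W V h0 => by
      have h2 := macForm_macOp_one h W V
      rw [h0, mul_zero] at h2
      exact (mul_eq_zero.mp h2).resolve_left (one_sub_ne_zero_of_generic h).1
    have hle : Y ≤ Z := by
      by_contra hYZ
      have hl0 : macForm q t (eFun F r * macOp q t 1 (macP q t Y)) (macP q t Z) = 0 := by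
        rw [hl]
        refine Finset.sum_eq_zero fun W _ => ?_
        by_contra hW
        obtain ⟨hW1, hW2⟩ := mul_ne_zero_iff.mp hW
        have hW3 := fun h0 => (div_ne_zero_iff.mp hW1).1 (hone Y W h0)
        obtain ⟨s, hs, hWs⟩ := pieri_one h hW3
        refine hYZ (le_trans ?_ (ih hW2).1)
        intro x hx
        rw [← YoungDiagram.mem_cells, hWs]
        exact Finset.mem_insert_of_mem hx
      have hr0 : macForm q t (macOp q t 1 (eFun F r * macP q t Y)) (macP q t Z) = 0 := by
        rw [hr]
        refine Finset.sum_eq_zero fun W _ => ?_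
        by_contra hW
        obtain ⟨hW1, hW2⟩ := mul_ne_zero_iff.mp hW
        have hW3 := fun h0 => hW2 (hone W Z h0)
        obtain ⟨s, hs, hWs⟩ := pieri_one h hW3
        refine hYZ (le_trans (ih (div_ne_zero_iff.mp hW1).1).1 ?_)
        intro x hx
        rw [← YoungDiagram.mem_cells, hWs]
        exact Finset.mem_insert_of_mem hx
      rw [hl0, hr0] at h1
      exact mul_ne_zero hE hne (by linear_combination h1)
    refine ⟨hle, fun i j hZ => ?_⟩
    by_contra hY
    set y := (1 - t⁻¹) * (q ^ (j + 1) * t⁻¹ ^ i) with hy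
    have hl2 : q * macForm q t (eFun F r * macOp q t 1 (macP q t Y)) (macP q t Z) =
        y * macForm q t (eFun F r * (MvPolynomial.X 1 * macP q t Y)) (macP q t Z) := by
      rw [hl, hl', Finset.mul_sum, Finset.mul_sum]
      refine Finset.sum_congr rfl fun W _ => ?_
      by_cases hW2 : macForm q t (eFun F r * macP q t W) (macP q t Z) = 0
      · rw [hW2]; ring
      by_cases hW1 : macForm q t (MvPolynomial.X 1 * macP q t Y) (macP q t W) = 0
      · rw [hW1, hone Y W hW1]; ring
      obtain ⟨s, hs, hWs⟩ := pieri_one h hW1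
      -- The added box has to be `(i, j)`.
      have hsij : (i, j) = s := by
        have h2 : (i, j) ∈ W.cells := (ih hW2).2 i j hZ
        rw [hWs] at h2
        exact (Finset.mem_insert.mp h2).resolve_right hY
      rw [macForm_macOp_one_eq h hs hWs, ← hsij, hy]
      ring
    have hr2 : macForm q t (macOp q t 1 (eFun F r * macP q t Y)) (macP q t Z) =
        y * macForm q t (MvPolynomial.X 1 * (eFun F r * macP q t Y)) (macP q t Z) := by
      rw [hr, hr', Finset.mul_sum]
      refine Finset.sum_congr rfl fun W _ => ?_
      by_cases hW1 : macForm q t (eFun F r * macP q t Y) (macP q t W) = 0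
      · rw [hW1]; ring
      by_cases hW2 : macForm q t (MvPolynomial.X 1 * macP q t W) (macP q t Z) = 0
      · rw [hW2, hone W Z hW2]; ring
      obtain ⟨s, hs, hWs⟩ := pieri_one h hW2
      -- The added box has to be `(i, j + 1)`.
      have hsij : (i, j + 1) = s := by
        have h2 : (i, j + 1) ∈ Z.cells := hZ
        rw [hWs] at h2
        refine (Finset.mem_insert.mp h2).resolve_right fun h3 => hY ((ih hW1).2 i j h3)
      rw [macForm_macOp_one_eq h hs hWs, ← hsij, hy]
      ring
    rw [hl2, hr2, mul_left_comm (eFun F r)] at h1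
    exact mul_ne_zero hE hne (by linear_combination h1)

end

/-! ### Specializations -/

section

variable {F : Type*} [Field F]

/-- The specialization `p_k ↦ (1 - u ^ k) / (1 - t ^ k)`, as a polynomial in `u`. -/
def specPoly (t : F) : SymFun F →ₐ[F] Polynomial F :=
  MvPolynomial.aeval fun k : ℕ+ => Polynomial.C (1 - t ^ (k : ℕ))⁻¹ * (1 - Polynomial.X ^ (k : ℕ))

/-- The specialization `p_k ↦ (1 - u ^ k) / (1 - t ^ k)`. -/
def specAt (t u : F) : SymFun F →ₐ[F] F :=
  MvPolynomial.aeval fun k : ℕ+ => (1 - t ^ (k : ℕ))⁻¹ * (1 - u ^ (k : ℕ))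

/-- The specialization `p_k ↦ (-1) ^ (k - 1) / (1 - t ^ k)`: up to sign, the limit of `specAt` as
`u` tends to infinity. -/
def specInf (t : F) : SymFun F →ₐ[F] F :=
  MvPolynomial.aeval fun k : ℕ+ => -(-1) ^ (k : ℕ) * (1 - t ^ (k : ℕ))⁻¹

theorem eval_specPoly (t u : F) (f : SymFun F) : (specPoly t f).eval u = specAt t u f := by
  have : ((Polynomial.aeval u).comp (specPoly t) : SymFun F →ₐ[F] F) = specAt t u := by
    apply MvPolynomial.algHom_ext
    intro k
    simp [specPoly, specAt]
  rw [← this, AlgHom.comp_apply, Polynomial.coe_aeval_eq_eval]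

theorem specPoly_mul (t : F) {f g : SymFun F} {a b : ℕ}
    (hf : (specPoly t f).natDegree ≤ a ∧ (specPoly t f).coeff a = (-1) ^ a * specInf t f)
    (hg : (specPoly t g).natDegree ≤ b ∧ (specPoly t g).coeff b = (-1) ^ b * specInf t g) :
    (specPoly t (f * g)).natDegree ≤ a + b ∧
      (specPoly t (f * g)).coeff (a + b) = (-1) ^ (a + b) * specInf t (f * g) := by
  rw [map_mul, map_mul]
  refine ⟨Polynomial.natDegree_mul_le_of_le hf.1 hg.1, ?_⟩
  rw [Polynomial.coeff_mul_add_eq_of_natDegree_le hf.1 hg.1, hf.2, hg.2, pow_add]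
  ring

theorem specPoly_monomial (t : F) (m : ℕ+ →₀ ℕ) :
    (specPoly t (MvPolynomial.monomial m 1)).natDegree ≤ Finsupp.weight (fun k : ℕ+ => (k : ℕ)) m ∧
    (specPoly t (MvPolynomial.monomial m 1)).coeff (Finsupp.weight (fun k : ℕ+ => (k : ℕ)) m) =
      (-1) ^ Finsupp.weight (fun k : ℕ+ => (k : ℕ)) m * specInf t (MvPolynomial.monomial m 1) := by
  have hadd : ∀ f g : ℕ+ →₀ ℕ, (MvPolynomial.monomial (f + g) 1 : SymFun F) =
      MvPolynomial.monomial f 1 * MvPolynomial.monomial g 1 := fun f g => by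
    rw [MvPolynomial.monomial_mul, one_mul]
  have hzero : (MvPolynomial.monomial (0 : ℕ+ →₀ ℕ) 1 : SymFun F) = 1 := rfl
  induction m using Finsupp.induction_linear with
  | zero => rw [hzero]; simp
  | add f g hf hg => rw [hadd, map_add]; exact specPoly_mul t hf hg
  | single k n =>
    induction n with
    | zero => rw [Finsupp.single_zero, hzero]; simp
    | succ n ih =>
      rw [Finsupp.single_add, hadd, map_add]
      refine specPoly_mul t ih ?_
      have hX : (MvPolynomial.monomial (Finsupp.single k 1) 1 : SymFun F) = MvPolynomial.X k := rfl
      have hs : specPoly t (MvPolynomial.X k) =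
          Polynomial.C (1 - t ^ (k : ℕ))⁻¹ * (1 - Polynomial.X ^ (k : ℕ)) := by simp [specPoly]
      have hi : specInf t (MvPolynomial.X k) = -(-1) ^ (k : ℕ) * (1 - t ^ (k : ℕ))⁻¹ := by
        simp [specInf]
      rw [hX, hs, hi, Finsupp.weight_single, one_smul]
      refine ⟨(Polynomial.natDegree_C_mul_le _ _).trans ((Polynomial.natDegree_sub_le _ _).trans ?_), ?_⟩
      · simp
      · rw [Polynomial.coeff_C_mul, Polynomial.coeff_sub, Polynomial.coeff_X_pow, if_pos rfl,
          Polynomial.coeff_one, if_neg k.ne_zero]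
        have : ((-1 : F) ^ (k : ℕ)) * (-1) ^ (k : ℕ) = 1 := by rw [← mul_pow]; simp
        linear_combination (1 - t ^ (k : ℕ))⁻¹ * this

theorem natDegree_specPoly_le (t : F) {n : ℕ} {f : SymFun F} (hf : f ∈ homog F n) :
    (specPoly t f).natDegree ≤ n ∧ (specPoly t f).coeff n = (-1) ^ n * specInf t f := by
  have hsum : f = ∑ m ∈ f.support, f.coeff m • MvPolynomial.monomial m 1 := by
    conv_lhs => rw [f.as_sum]
    exact Finset.sum_congr rfl fun m _ => by
      rw [MvPolynomial.smul_monomial, smul_eq_mul, mul_one]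
  have hw : ∀ m ∈ f.support, Finsupp.weight (fun k : ℕ+ => (k : ℕ)) m = n := fun m hm =>
    hf (MvPolynomial.mem_support_iff.mp hm)
  have h1 : specPoly t f = ∑ m ∈ f.support, f.coeff m • specPoly t (MvPolynomial.monomial m 1) := by
    conv_lhs => rw [hsum]
    rw [map_sum]
    exact Finset.sum_congr rfl fun m _ => map_smul _ _ _
  have h2 : specInf t f = ∑ m ∈ f.support, f.coeff m • specInf t (MvPolynomial.monomial m 1) := by
    conv_lhs => rw [hsum]
    rw [map_sum]
    exact Finset.sum_congr rfl fun m _ => map_smul _ _ _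
  constructor
  · rw [h1]
    refine Polynomial.natDegree_sum_le_of_forall_le _ _ fun m hm => ?_
    have := (specPoly_monomial t m).1
    rw [hw m hm] at this
    exact (Polynomial.natDegree_smul_le _ _).trans this
  · rw [h1, h2, Polynomial.finsetSum_coeff, Finset.mul_sum]
    refine Finset.sum_congr rfl fun m hm => ?_
    have := (specPoly_monomial t m).2
    rw [hw m hm] at this
    rw [Polynomial.coeff_smul, this, smul_eq_mul, smul_eq_mul]
    ring

/-- The specializations at `u` and `q u` are related by the adjoints of the multiplications by
the `e_r`. -/
theorem specAt_eq_sum (q t u : F) (f : SymFun F) :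
    ∃ K : ℕ, specAt t u f = ∑ r ∈ Finset.range K,
      specAt t (q * u) (shiftCoeff (fun n => -(-1) ^ n * kap q t n) r f) * (-u) ^ r := by
  refine ⟨(shift (fun n => -(-1) ^ n * kap q t n) f).natDegree + 1, ?_⟩
  have h : (Polynomial.eval₂RingHom (specAt t (q * u) : SymFun F →+* F) (-u)).comp
      (shift (fun n => -(-1) ^ n * kap q t n) : SymFun F →+* Polynomial (SymFun F)) =
      (specAt t u : SymFun F →+* F) := by
    apply MvPolynomial.ringHom_ext
    · intro a
      have h1 : shift (fun n => -(-1) ^ n * kap q t n) (MvPolynomial.C a) =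
          Polynomial.C (MvPolynomial.C a) := by
        rw [← MvPolynomial.algebraMap_eq, AlgHom.commutes,
          IsScalarTower.algebraMap_apply F (SymFun F) (Polynomial (SymFun F))]
        rfl
      simp only [RingHom.comp_apply, RingHom.coe_coe, h1, Polynomial.coe_eval₂RingHom,
        Polynomial.eval₂_C]
      rw [← MvPolynomial.algebraMap_eq, AlgHom.commutes, AlgHom.commutes]
    · intro k
      have h1 : ∀ a : F, specAt t (q * u) (MvPolynomial.C a) = a := fun a => by
        rw [← MvPolynomial.algebraMap_eq, AlgHom.commutes]; rfl
      have h2 : ∀ v : F, specAt t v (MvPolynomial.X k) = (1 - t ^ (k : ℕ))⁻¹ * (1 - v ^ (k : ℕ)) :=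
        fun v => by simp [specAt]
      simp only [RingHom.comp_apply, RingHom.coe_coe, shift_X, Polynomial.coe_eval₂RingHom,
        Polynomial.eval₂_add, Polynomial.eval₂_mul, Polynomial.eval₂_C, Polynomial.eval₂_X_pow, h1,
        h2]
      have h3 : ((-1 : F) ^ (k : ℕ)) * (-u) ^ (k : ℕ) = u ^ (k : ℕ) := by rw [← mul_pow]; simp
      rw [kap, div_eq_mul_inv, mul_pow]
      linear_combination (-(1 - q ^ (k : ℕ)) * (1 - t ^ (k : ℕ))⁻¹) * h3
  have h1 := RingHom.congr_fun h f
  simp only [RingHom.comp_apply, RingHom.coe_coe, Polynomial.coe_eval₂RingHom] at h1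
  rw [← h1, Polynomial.eval₂_eq_sum_range]
  rfl

theorem specAt_pow (t : F) (ht : ∀ n : ℕ, 0 < n → t ^ n ≠ 1) (N : ℕ) (f : SymFun F) :
    specAt t (t ^ N) f = MvPolynomial.eval (fun i : Fin N => t ^ (i : ℕ)) (evalVars N f) := by
  have : ((MvPolynomial.aeval fun i : Fin N => t ^ (i : ℕ)).comp (evalVars N) :
      SymFun F →ₐ[F] F) = specAt t (t ^ N) := by
    apply MvPolynomial.algHom_ext
    intro k
    have h1 : 1 - t ^ (k : ℕ) ≠ 0 := sub_ne_zero.mpr (ht k k.pos).symm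
    have h2 := geom_sum_mul_neg (t ^ (k : ℕ)) N
    have h3 : ∑ i : Fin N, (t ^ (i : ℕ)) ^ (k : ℕ) = ∑ i ∈ Finset.range N, (t ^ (k : ℕ)) ^ i := by
      rw [Finset.sum_range]
      exact Finset.sum_congr rfl fun i _ => pow_right_comm t i k
    simp only [AlgHom.comp_apply, evalVars, specAt, MvPolynomial.aeval_X, MvPolynomial.psum, map_sum,
      map_pow]
    rw [h3, ← pow_right_comm t k N, ← h2, mul_comm (Finset.sum _ _), inv_mul_cancel_left₀ h1]
  rw [← this]
  rfl

section

variable [CharZero F] {q t : F}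

/-- `P_Y` vanishes in fewer variables than `Y` has rows. -/
theorem evalVars_macP_eq_zero (h : Generic q t) {Y : YoungDiagram} {N : ℕ} (hN : N < Y.colLen 0) :
    evalVars N (macP q t Y) = 0 := by
  ext α
  rw [MvPolynomial.coeff_zero]
  obtain ⟨Z, σ, hZ, hσ⟩ := exists_diagram_perm α
  rw [coeff_evalVars_of_perm h.q_pow_ne_one h.t_pow_ne_one hZ hσ]
  by_contra hne
  have hdom := dom_of_mCoeff_macP h hne
  have h1 := hdom.2 N
  rw [← card_eq_sum_rowLen Z hZ, hdom.1] at h1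
  have h2 := sum_rowLen_le_card Y (N + 1)
  rw [Finset.sum_range_succ] at h2
  have h3 : (N, 0) ∈ Y := YoungDiagram.mem_iff_lt_colLen.mpr hN
  have := YoungDiagram.mem_iff_lt_rowLen.mp h3
  omega

theorem shiftCoeff_macForm (f g : SymFun F) (r : ℕ) :
    macForm q t (shiftCoeff (fun n => -(-1) ^ n * kap q t n) r f) g =
      macForm q t (eFun F r * g) f := by
  rw [eFun, macForm_hSeries_mul, macForm_comm]

theorem mCoeff_shiftCoeff {n : ℕ} {f : SymFun F} (hf : f ∈ homog F n) {r : ℕ} {Y : YoungDiagram}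
    (hY : r + Y.card ≠ n) :
    mCoeff q t Y (shiftCoeff (fun n => -(-1) ^ n * kap q t n) r f) = 0 := by
  rw [mCoeff_apply, shiftCoeff_macForm]
  exact macForm_homog q t hY (mul_mem_homog (hSeries_mem_homog _ _) (gProd_mem_homog q t Y)) hf

/-- The vanishing property of the principal specializations of `P_Y`. -/
theorem specAt_macP_eq_zero (h : Generic q t) (j : ℕ) {i : ℕ} {Y : YoungDiagram}
    (hY : (i, j) ∈ Y) : specAt t (q⁻¹ ^ j * t ^ i) (macP q t Y) = 0 := by
  induction j generalizing Y with
  | zero =>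
    rw [pow_zero, one_mul, specAt_pow t h.t_pow_ne_one,
      evalVars_macP_eq_zero h (YoungDiagram.mem_iff_lt_colLen.mp hY), map_zero]
  | succ j ih =>
    obtain ⟨K, hK⟩ := specAt_eq_sum q t (q⁻¹ ^ (j + 1) * t ^ i) (macP q t Y)
    rw [hK]
    refine Finset.sum_eq_zero fun r _ => ?_
    have hu : q * (q⁻¹ ^ (j + 1) * t ^ i) = q⁻¹ ^ j * t ^ i := by
      have := h.q_ne_zero
      rw [pow_succ]
      field_simp
    rw [hu]
    set g := shiftCoeff (fun n => -(-1) ^ n * kap q t n) r (macP q t Y) with hg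
    have hg0 : specAt t (q⁻¹ ^ j * t ^ i) g = 0 := by
      by_cases hr : r ≤ Y.card
      · have hgh : g ∈ homog F (Y.card - r) :=
          mem_homog_of_mCoeff h.q_pow_ne_one h.t_pow_ne_one fun Z hZ =>
            mCoeff_shiftCoeff (macP_mem_homog h Y) (by omega)
        rw [eq_sum_macP h hgh, map_sum]
        refine Finset.sum_eq_zero fun Z _ => ?_
        rw [map_smul]
        by_cases h0 : macForm q t g (macP q t Z) = 0
        · rw [h0, zero_div, zero_smul]
        · rw [hg, shiftCoeff_macForm] at h0
          rw [ih ((pieri h r h0).2 i j hY), smul_zero]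
      · have : g = 0 := eq_zero_of_mCoeff h.q_pow_ne_one h.t_pow_ne_one fun Z =>
          mCoeff_shiftCoeff (macP_mem_homog h Y) (by omega)
        rw [this, map_zero]
    rw [hg0, zero_mul]

/-- The factorization of the principal specialization of `P_Y`, up to its leading coefficient. -/
theorem specAt_macP (h : Generic q t) (Y : YoungDiagram) (u : F) : specAt t u (macP q t Y) =
    (-1) ^ Y.card * specInf t (macP q t Y) * ∏ s ∈ Y.cells, (u - q⁻¹ ^ s.2 * t ^ s.1) := by
  classical
  obtain ⟨hdeg, hcoeff⟩ := natDegree_specPoly_le t (macP_mem_homog h Y)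
  set p := specPoly t (macP q t Y) with hp
  set P : Polynomial F := ∏ s ∈ Y.cells, (Polynomial.X - Polynomial.C (q⁻¹ ^ s.2 * t ^ s.1)) with hP
  have hPm : P.Monic := Polynomial.monic_prod_of_monic _ _ fun s _ => Polynomial.monic_X_sub_C _
  have hPd : P.natDegree = Y.card := by
    rw [hP, Polynomial.natDegree_prod_of_monic _ _ fun s _ => Polynomial.monic_X_sub_C _]
    simp only [Polynomial.natDegree_X_sub_C, Finset.sum_const, smul_eq_mul, mul_one]
  have hinj : Set.InjOn (fun s : ℕ × ℕ => q⁻¹ ^ s.2 * t ^ s.1) Y.cells := by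
    intro a _ b _ hab
    have := h.monomial_inj (a := -(a.2 : ℤ)) (b := a.1) (c := -(b.2 : ℤ)) (d := b.1)
      (by simpa using hab)
    exact Prod.ext (by omega) (by omega)
  have hz : p - Polynomial.C (p.coeff Y.card) * P = 0 := by
    refine Polynomial.eq_zero_of_degree_lt_of_eval_index_eq_zero Y.cells hinj ?_ fun s hs => ?_
    · rw [Polynomial.degree_lt_iff_coeff_zero]
      intro m hm
      rw [Polynomial.coeff_sub, Polynomial.coeff_C_mul]
      rcases hm.eq_or_lt with rfl | hm
      · have : P.coeff Y.card = 1 := by rw [← hPd]; exact hPm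
        change p.coeff Y.card - p.coeff Y.card * P.coeff Y.card = 0
        rw [this, mul_one, sub_self]
      · rw [Polynomial.coeff_eq_zero_of_natDegree_lt (hdeg.trans_lt hm),
          Polynomial.coeff_eq_zero_of_natDegree_lt (p := P) (by rw [hPd]; exact hm), mul_zero, sub_zero]
    · rw [Polynomial.eval_sub, hp, eval_specPoly, specAt_macP_eq_zero h s.2 hs, Polynomial.eval_mul,
        hP, Polynomial.eval_prod, Finset.prod_eq_zero hs (by simp), mul_zero, sub_zero]
  rw [← eval_specPoly, ← hp, sub_eq_zero.mp hz, hcoeff, hP, Polynomial.eval_mul,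
    Polynomial.eval_prod, Polynomial.eval_C]
  simp

end

end

/-! ### Removing the first column -/

section

variable {F : Type*} [Field F]

theorem shiftCol_injective : Function.Injective fun s : ℕ × ℕ => (s.1, s.2 + 1) := by
  intro a b hab
  simp only [Prod.mk.injEq, Nat.add_right_cancel_iff] at hab
  exact Prod.ext hab.1 hab.2

/-- The Young diagram obtained by removing the first column. -/
def removeCol (Y : YoungDiagram) : YoungDiagram where
  cells := Y.cells.preimage (fun s => (s.1, s.2 + 1)) shiftCol_injective.injOn
  isLowerSet := by
    intro a b hba ha
    rw [Finset.mem_coe, Finset.mem_preimage, YoungDiagram.mem_cells] at ha ⊢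
    exact Y.up_left_mem hba.1 (Nat.succ_le_succ hba.2) ha

theorem mem_removeCol {Y : YoungDiagram} {i j : ℕ} : (i, j) ∈ removeCol Y ↔ (i, j + 1) ∈ Y := by
  rw [← YoungDiagram.mem_cells, removeCol, Finset.mem_preimage, YoungDiagram.mem_cells]

theorem rowLen_removeCol (Y : YoungDiagram) (i : ℕ) : (removeCol Y).rowLen i = Y.rowLen i - 1 := by
  refine le_antisymm (Nat.le_of_not_lt fun h => ?_) (Nat.le_of_not_lt fun h => ?_)
  · rw [← YoungDiagram.mem_iff_lt_rowLen, mem_removeCol, YoungDiagram.mem_iff_lt_rowLen] at h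
    omega
  · have h1 : (i, (removeCol Y).rowLen i) ∈ removeCol Y := by
      rw [mem_removeCol, YoungDiagram.mem_iff_lt_rowLen]
      omega
    exact lt_irrefl _ (YoungDiagram.mem_iff_lt_rowLen.mp h1)

theorem colLen_removeCol (Y : YoungDiagram) (j : ℕ) :
    (removeCol Y).colLen j = Y.colLen (j + 1) := by
  refine le_antisymm (Nat.le_of_not_lt fun h => ?_) (Nat.le_of_not_lt fun h => ?_)
  · rw [← YoungDiagram.mem_iff_lt_colLen, mem_removeCol, YoungDiagram.mem_iff_lt_colLen] at h
    exact lt_irrefl _ h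
  · rw [← YoungDiagram.mem_iff_lt_colLen, ← mem_removeCol, YoungDiagram.mem_iff_lt_colLen] at h
    exact lt_irrefl _ h

theorem colLen_removeCol_le (Y : YoungDiagram) : (removeCol Y).colLen 0 ≤ Y.colLen 0 := by
  rw [colLen_removeCol]
  exact Y.colLen_anti 0 1 (Nat.zero_le 1)

theorem rowLen_eq_succ (Y : YoungDiagram) {i : ℕ} (hi : i < Y.colLen 0) :
    Y.rowLen i = (removeCol Y).rowLen i + 1 := by
  rw [rowLen_removeCol]
  rw [← YoungDiagram.mem_iff_lt_colLen, YoungDiagram.mem_iff_lt_rowLen] at hi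
  omega

@[to_additive]
theorem prod_cells_removeCol {M : Type*} [CommMonoid M] (Y : YoungDiagram) (f : ℕ × ℕ → M) :
    ∏ s ∈ Y.cells, f s =
      (∏ i ∈ Finset.range (Y.colLen 0), f (i, 0)) * ∏ s ∈ (removeCol Y).cells, f (s.1, s.2 + 1) := by
  rw [prod_cells Y le_rfl, prod_cells (removeCol Y) (colLen_removeCol_le Y),
    ← Finset.prod_mul_distrib]
  refine Finset.prod_congr rfl fun i hi => ?_
  rw [rowLen_eq_succ Y (Finset.mem_range.mp hi), Finset.prod_range_succ', mul_comm]

theorem prod_cells_eq_mul_last {M : Type*} [CommMonoid M] (Y : YoungDiagram) (f : ℕ × ℕ → M) :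
    ∏ s ∈ Y.cells, f s = (∏ s ∈ (removeCol Y).cells, f s) *
      ∏ i ∈ Finset.range (Y.colLen 0), f (i, (removeCol Y).rowLen i) := by
  rw [prod_cells Y le_rfl, prod_cells (removeCol Y) (colLen_removeCol_le Y),
    ← Finset.prod_mul_distrib]
  refine Finset.prod_congr rfl fun i hi => ?_
  rw [rowLen_eq_succ Y (Finset.mem_range.mp hi), Finset.prod_range_succ]

theorem card_removeCol (Y : YoungDiagram) : Y.colLen 0 + (removeCol Y).card = Y.card := by
  have := sum_cells_removeCol Y fun _ => 1
  simp only [Finset.sum_const, smul_eq_mul, mul_one, Finset.card_range] at this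
  exact this.symm

theorem sum_rowLen_removeCol (Y : YoungDiagram) :
    ∑ i ∈ Finset.range (Y.colLen 0), (removeCol Y).rowLen i = (removeCol Y).card :=
  (card_eq_sum_rowLen _ (colLen_removeCol_le Y)).symm

/-- `n(λ')` is the sum of the column indices of the boxes. -/
theorem nStat_transpose (Y : YoungDiagram) : nStat Y.transpose = ∑ s ∈ Y.cells, s.2 := by
  have h1 : ∑ s ∈ Y.transpose.cells, s.1 = nStat Y.transpose := by
    rw [sum_cells Y.transpose le_rfl, nStat]
    refine Finset.sum_congr rfl fun i _ => ?_
    rw [Finset.sum_const, Finset.card_range, smul_eq_mul, mul_comm]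
  rw [← h1]
  refine Finset.sum_nbij' Prod.swap Prod.swap ?_ ?_ ?_ ?_ ?_ <;> simp

theorem eq_of_verticalStrip {Y Z : YoungDiagram} (h : VerticalStrip (removeCol Y) Z)
    (hcol : Z.colLen 0 ≤ Y.colLen 0) (hcard : Z.card = Y.card) : Z = Y := by
  have hle : ∀ i ∈ Finset.range (Y.colLen 0), Z.rowLen i ≤ Y.rowLen i := by
    intro i hi
    rw [rowLen_eq_succ Y (Finset.mem_range.mp hi)]
    by_contra hlt
    have h1 : (i, (removeCol Y).rowLen i + 1) ∈ Z := YoungDiagram.mem_iff_lt_rowLen.mpr (by omega)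
    exact lt_irrefl _ (YoungDiagram.mem_iff_lt_rowLen.mp (h.2 _ _ h1))
  rw [card_eq_sum_rowLen Z hcol, card_eq_sum_rowLen Y le_rfl] at hcard
  have heq := (Finset.sum_eq_sum_iff_of_le hle).mp hcard
  apply rowLen_injective
  funext i
  by_cases hi : i < Y.colLen 0
  · exact heq i (Finset.mem_range.mpr hi)
  · rw [rowLen_eq_zero Y (not_lt.mp hi), rowLen_eq_zero Z (hcol.trans (not_lt.mp hi))]

/-! ### The normalization of the specializations -/

section

variable [CharZero F]

theorem evalVars_eFun (N : ℕ) : evalVars N (eFun F N) = ∏ i, MvPolynomial.X i := by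
  have h1 := isPowerExp_evalVars_hSeries (F := F) N (fun n => -(-1) ^ n)
  have h2 := IsPowerExp.prod Finset.univ fun (i : Fin N) _ =>
    isPowerExp_one_sub (-(MvPolynomial.X i) : MvPolynomial (Fin N) F)
  have h3 := (h2.congr (b := fun n => ∑ i : Fin N, MvPolynomial.C (-(-1 : F) ^ n) *
    MvPolynomial.X i ^ n) fun n => Finset.sum_congr rfl fun i _ => by
      rw [neg_pow (MvPolynomial.X i : MvPolynomial (Fin N) F), map_neg, map_pow, map_neg, map_one]
      ring).unique h1
  have h4 := congrArg (PowerSeries.coeff N) h3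
  rw [PowerSeries.coeff_mk] at h4
  rw [eFun, ← h4]
  set p : Fin N → Polynomial (MvPolynomial (Fin N) F) := fun i =>
    1 - Polynomial.C (-MvPolynomial.X i) * Polynomial.X with hp
  have h5 : ∏ i : Fin N, (1 - PowerSeries.C (-(MvPolynomial.X i) : MvPolynomial (Fin N) F) *
      PowerSeries.X) = ((∏ i, p i : Polynomial (MvPolynomial (Fin N) F)) : PowerSeries _) := by
    rw [← Polynomial.coeToPowerSeries.ringHom_apply, map_prod]
    refine Finset.prod_congr rfl fun i _ => ?_
    simp [hp]
  have h6 := Polynomial.coeff_prod_of_natDegree_le Finset.univ p 1 fun i _ => by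
    refine (Polynomial.natDegree_sub_le _ _).trans (max_le (by simp) ?_)
    exact (Polynomial.natDegree_C_mul_le _ _).trans Polynomial.natDegree_X_le
  rw [Finset.card_univ, Fintype.card_fin, mul_one] at h6
  rw [h5, Polynomial.coeff_coe, h6]
  refine Finset.prod_congr rfl fun i _ => ?_
  simp [hp, Polynomial.coeff_one]

variable {q t : F}

/-- In as many variables as `Y` has rows, `P_Y` is divisible by the product of the variables. -/
theorem evalVars_macP_removeCol (h : Generic q t) (Y : YoungDiagram) :
    evalVars (Y.colLen 0) (macP q t Y) =
      (∏ i, MvPolynomial.X i) * evalVars (Y.colLen 0) (macP q t (removeCol Y)) := by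
  set N := Y.colLen 0 with hN
  have hhom : eFun F N * macP q t (removeCol Y) ∈ homog F Y.card := by
    rw [← card_removeCol Y]
    exact mul_mem_homog (hSeries_mem_homog _ _) (macP_mem_homog h _)
  -- By the Pieri rule only `P_Y` survives in `N` variables.
  obtain ⟨a, ha⟩ : ∃ a : F, evalVars N (eFun F N * macP q t (removeCol Y)) =
      a • evalVars N (macP q t Y) := by
    rw [eq_sum_macP h hhom, map_sum, Finset.sum_eq_single Y]
    · exact ⟨_, map_smul _ _ _⟩
    · intro Z hZ hne
      rw [map_smul]
      by_cases hcol : Z.colLen 0 ≤ N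
      · by_cases h0 : macForm q t (eFun F N * macP q t (removeCol Y)) (macP q t Z) = 0
        · rw [h0, zero_div, zero_smul]
        · exact absurd (eq_of_verticalStrip (pieri h N h0) hcol (mem_diagrams.mp hZ)) hne
      · rw [evalVars_macP_eq_zero h (not_le.mp hcol), smul_zero]
    · exact fun hn => absurd (mem_diagrams.mpr rfl) hn
  rw [map_mul, evalVars_eFun] at ha
  set α : Fin N →₀ ℕ := Finsupp.equivFunOnFinite.symm fun i => Y.rowLen i with hα
  set β : Fin N →₀ ℕ := Finsupp.equivFunOnFinite.symm fun _ => 1 with hβ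
  have hX : ∏ i, (MvPolynomial.X i : MvPolynomial (Fin N) F) = MvPolynomial.monomial β 1 := by
    rw [MvPolynomial.monomial_eq, map_one, one_mul, Finsupp.prod_fintype _ _ (by simp)]
    exact Finset.prod_congr rfl fun i _ => (pow_one _).symm
  have hβα : β ≤ α := fun i => by
    change 1 ≤ Y.rowLen i
    have := rowLen_eq_succ Y i.isLt
    omega
  have hc := congrArg (MvPolynomial.coeff α) ha
  rw [hX, MvPolynomial.coeff_monomial_mul', if_pos hβα, one_mul,
    coeff_evalVars_of_perm h.q_pow_ne_one h.t_pow_ne_one (σ := 1) (colLen_removeCol_le Y) (fun i => by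
      change Y.rowLen i - 1 = _
      rw [rowLen_removeCol]; rfl), mCoeff_macP_self h, MvPolynomial.coeff_smul,
    coeff_evalVars_of_perm h.q_pow_ne_one h.t_pow_ne_one (σ := 1) hN.ge (fun i => rfl),
    mCoeff_macP_self h, smul_eq_mul, mul_one] at hc
  rw [ha, ← hc, one_smul]

theorem macP_of_card_eq_zero (h : Generic q t) {Y : YoungDiagram} (hY : Y.card = 0) :
    macP q t Y = 1 := by
  have h1 : (1 : SymFun F) ∈ homog F 0 := C_mem_homog 1
  have h2 : macP q t Y ∈ homog F 0 := hY ▸ macP_mem_homog h Y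
  have h3 : (⟨macP q t Y, h2⟩ : homog F 0) = ⟨1, h1⟩ := by
    apply mCoeffs_injective h 0
    funext Z
    have hZ : (Z : YoungDiagram) = Y := by
      have e1 : (Z : YoungDiagram).cells = ∅ := Finset.card_eq_zero.mp (mem_diagrams.mp Z.2)
      have e2 : Y.cells = ∅ := Finset.card_eq_zero.mp hY
      exact YoungDiagram.ext (e1.trans e2.symm)
    change mCoeff q t Z (macP q t Y) = mCoeff q t Z 1
    have h0 : Y.colLen 0 = 0 := Nat.le_zero.mp (hY ▸ colLen_le_card Y)
    rw [hZ, mCoeff_macP_self h, mCoeff_apply, macForm_one_left, gProd, h0, Finset.prod_range_zero,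
      map_one]
  exact congrArg Subtype.val h3

/-- The specialization `p_k ↦ (-1) ^ (k - 1) / (1 - t ^ k)` of the integral form of `P_Y`. -/
theorem specInf_macP (h : Generic q t) (Y : YoungDiagram) : specInf t (macP q t Y) *
    ∏ s ∈ Y.cells, (1 - q ^ arm Y s * t ^ (leg Y s + 1)) = q ^ nStat Y.transpose := by
  have hq := h.q_ne_zero
  have ht := h.t_ne_zero
  rw [nStat_transpose]
  induction hm : Y.card using Nat.strong_induction_on generalizing Y with
  | _ m ih =>
  by_cases h0 : Y.card = 0
  · have hc : Y.cells = ∅ := Finset.card_eq_zero.mp h0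
    rw [macP_of_card_eq_zero h h0, map_one, hc]
    simp
  have hN : 0 < Y.colLen 0 := by
    obtain ⟨s, hs⟩ := Finset.card_pos.mp (Nat.pos_of_ne_zero h0)
    rw [← YoungDiagram.mem_iff_lt_colLen]
    exact Y.up_left_mem (Nat.zero_le s.1) (Nat.zero_le s.2) hs
  have hcard := card_removeCol Y
  have hih := ih (removeCol Y).card (by omega) (removeCol Y) rfl
  set N := Y.colLen 0 with hNdef
  set Z := removeCol Y with hZ
  -- Compare the principal specializations in `N` variables.
  have h1 : specAt t (t ^ N) (macP q t Y) =
      (∏ i ∈ Finset.range N, t ^ i) * specAt t (t ^ N) (macP q t Z) := by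
    rw [specAt_pow t h.t_pow_ne_one, specAt_pow t h.t_pow_ne_one, hNdef, evalVars_macP_removeCol h,
      map_mul, map_prod, Finset.prod_range, hZ]
    simp only [MvPolynomial.eval_X]
  rw [specAt_macP h, specAt_macP h, prod_cells_eq_mul_last, ← hZ, ← hNdef] at h1
  simp only at h1
  have hne : ∏ s ∈ Z.cells, (t ^ N - q⁻¹ ^ s.2 * t ^ s.1) ≠ 0 := by
    refine Finset.prod_ne_zero_iff.mpr fun s hs => sub_ne_zero.mpr fun he => ?_
    have h2 := h.monomial_inj (a := 0) (b := N) (c := -(s.2 : ℤ)) (d := s.1) (by simpa using he)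
    have h3 : s.1 < Z.colLen 0 := by
      rw [← YoungDiagram.mem_iff_lt_colLen]
      exact Z.up_left_mem le_rfl (Nat.zero_le s.2) hs
    have h4 : Z.colLen 0 ≤ N := colLen_removeCol_le Y
    omega
  have hlast : (-1 : F) ^ N * ∏ i ∈ Finset.range N, (t ^ N - q⁻¹ ^ Z.rowLen i * t ^ i) =
      (∏ i ∈ Finset.range N, (1 - q ^ Z.rowLen i * t ^ (N - i))) *
        (q⁻¹ ^ Z.card * ∏ i ∈ Finset.range N, t ^ i) := by
    have h2 : ∀ i ∈ Finset.range N, -1 * (t ^ N - q⁻¹ ^ Z.rowLen i * t ^ i) =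
        (1 - q ^ Z.rowLen i * t ^ (N - i)) * (q⁻¹ ^ Z.rowLen i * t ^ i) := by
      intro i hi
      have h3 : t ^ N = t ^ (N - i) * t ^ i := by
        rw [← pow_add, Nat.sub_add_cancel (Finset.mem_range.mp hi).le]
      have h4 : q ^ Z.rowLen i * q⁻¹ ^ Z.rowLen i = 1 := by
        rw [← mul_pow, mul_inv_cancel₀ hq, one_pow]
      rw [h3]
      linear_combination (t ^ (N - i) * t ^ i) * h4
    have h5 : ∏ i ∈ Finset.range N, q⁻¹ ^ Z.rowLen i = q⁻¹ ^ Z.card := by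
      rw [Finset.prod_pow_eq_pow_sum, hZ, hNdef, sum_rowLen_removeCol]
    rw [← h5, ← Finset.prod_mul_distrib, ← Finset.prod_mul_distrib, ← Finset.prod_congr rfl h2,
      Finset.prod_mul_distrib, Finset.prod_const, Finset.card_range]
  have htN : ∏ i ∈ Finset.range N, t ^ i ≠ 0 :=
    Finset.prod_ne_zero_iff.mpr fun i _ => pow_ne_zero _ ht
  have hrec : specInf t (macP q t Y) * ∏ i ∈ Finset.range N, (1 - q ^ Z.rowLen i * t ^ (N - i)) =
      q ^ Z.card * specInf t (macP q t Z) := by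
    have hsign : ((-1 : F) ^ Z.card) * (-1) ^ Z.card = 1 := by rw [← mul_pow]; simp
    have hqq : q ^ Z.card * q⁻¹ ^ Z.card = 1 := by rw [← mul_pow, mul_inv_cancel₀ hq, one_pow]
    have h2 : (-1 : F) ^ Y.card = (-1) ^ N * (-1) ^ Z.card := by rw [← hcard, pow_add]
    refine mul_right_cancel₀ (b := (-1) ^ Z.card * (∏ i ∈ Finset.range N, t ^ i) *
      ∏ s ∈ Z.cells, (t ^ N - q⁻¹ ^ s.2 * t ^ s.1))
      (mul_ne_zero (mul_ne_zero (pow_ne_zero _ (by simp)) htN) hne) ?_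
    rw [h2] at h1
    generalize (∏ s ∈ Z.cells, (t ^ N - q⁻¹ ^ s.2 * t ^ s.1)) = A at h1 ⊢
    generalize (∏ i ∈ Finset.range N, (1 - q ^ Z.rowLen i * t ^ (N - i))) = B at hlast ⊢
    generalize (∏ i ∈ Finset.range N, t ^ i) = T at h1 hlast ⊢
    generalize (∏ i ∈ Finset.range N, (t ^ N - q⁻¹ ^ Z.rowLen i * t ^ i)) = L at h1 hlast
    linear_combination q ^ Z.card * h1 -
      (-1) ^ Z.card * specInf t (macP q t Y) * A * q ^ Z.card * hlast -
      (-1) ^ Z.card * specInf t (macP q t Y) * A * B * T * hqq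
  have hcol : ∏ i ∈ Finset.range N, (1 - q ^ arm Y (i, 0) * t ^ (leg Y (i, 0) + 1)) =
      ∏ i ∈ Finset.range N, (1 - q ^ Z.rowLen i * t ^ (N - i)) := by
    refine Finset.prod_congr rfl fun i hi => ?_
    have h2 := Finset.mem_range.mp hi
    have h3 : arm Y (i, 0) = Z.rowLen i := by rw [hZ, rowLen_removeCol, arm]
    have h4 : leg Y (i, 0) + 1 = N - i := by
      rw [leg, ← hNdef]
      change N - (i + 1) + 1 = N - i
      omega
    rw [h3, h4]
  have hrest : ∏ s ∈ Z.cells, (1 - q ^ arm Y (s.1, s.2 + 1) * t ^ (leg Y (s.1, s.2 + 1) + 1)) =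
      ∏ s ∈ Z.cells, (1 - q ^ arm Z s * t ^ (leg Z s + 1)) := by
    refine Finset.prod_congr rfl fun s _ => ?_
    have h3 : arm Y (s.1, s.2 + 1) = arm Z s := by
      rw [arm, arm, hZ, rowLen_removeCol]
      simp only
      omega
    have h4 : leg Y (s.1, s.2 + 1) = leg Z s := by rw [leg, leg, hZ, colLen_removeCol]
    rw [h3, h4]
  rw [prod_cells_removeCol, sum_cells_removeCol, hcol, hrest, ← mul_assoc, hrec, mul_assoc, hih,
    ← pow_add]
  congr 1
  simp only [Finset.sum_const_zero, zero_add, Finset.sum_add_distrib, Finset.sum_const, smul_eq_mul,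
    mul_one]
  rw [add_comm]

end

end

/-! ### The vectors `v0` as a power exponential -/

section

variable {F : Type*} [Field F] [CharZero F] {q t : F}

/-- The `n`-th coefficient of `exp (∑ (-1) ^ (k - 1) / (1 - q ^ k) * p_k * w ^ k / k)`. -/
def wFun (q : F) (n : ℕ) : SymFun F := hSeries (fun k => -(-1) ^ k * (1 - q ^ k)⁻¹) n

theorem macForm_wFun (h : Generic q t) {n : ℕ} {f : SymFun F} (hf : f ∈ homog F n) :
    macForm q t (wFun q n) f = specInf t f := by
  set d : ℕ → F := fun k => -(-1) ^ k * (1 - q ^ k)⁻¹ * kap q t k with hd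
  -- Summing over all degrees turns the shift into an evaluation.
  have hspec : (Polynomial.eval₂RingHom (MvPolynomial.constantCoeff : SymFun F →+* F) 1).comp
      (shift d : SymFun F →+* Polynomial (SymFun F)) = (specInf t : SymFun F →+* F) := by
    apply MvPolynomial.ringHom_ext
    · intro a
      have h1 : shift d (MvPolynomial.C a) = Polynomial.C (MvPolynomial.C a) := by
        rw [← MvPolynomial.algebraMap_eq, AlgHom.commutes,
          IsScalarTower.algebraMap_apply F (SymFun F) (Polynomial (SymFun F))]
        rfl
      simp only [RingHom.comp_apply, RingHom.coe_coe, h1, Polynomial.coe_eval₂RingHom,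
        Polynomial.eval₂_C, MvPolynomial.constantCoeff_C]
      rw [← MvPolynomial.algebraMap_eq, AlgHom.commutes]
      rfl
    · intro k
      have h1 : 1 - q ^ (k : ℕ) ≠ 0 := sub_ne_zero.mpr (h.q_pow_ne_one k k.pos).symm
      have h2 : specInf t (MvPolynomial.X k) = -(-1) ^ (k : ℕ) * (1 - t ^ (k : ℕ))⁻¹ := by
        simp [specInf]
      simp only [RingHom.comp_apply, RingHom.coe_coe, shift_X, Polynomial.coe_eval₂RingHom,
        Polynomial.eval₂_add, Polynomial.eval₂_mul, Polynomial.eval₂_C, Polynomial.eval₂_X_pow, h2,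
        MvPolynomial.constantCoeff_C, MvPolynomial.constantCoeff_X, one_pow, mul_one, zero_add]
      rw [hd]
      simp only [kap]
      rw [div_eq_mul_inv, ← mul_assoc, mul_assoc (-(-1) ^ (k : ℕ)), inv_mul_cancel₀ h1, mul_one]
  have h1 := RingHom.congr_fun hspec f
  simp only [RingHom.comp_apply, RingHom.coe_coe, Polynomial.coe_eval₂RingHom] at h1
  set K := max ((shift d f).natDegree + 1) (n + 1) with hK
  rw [← h1, Polynomial.eval₂_eq_sum_range' _ (n := K) (by omega), Finset.sum_eq_single n]
  · rw [wFun, macForm_hSeries_one, one_pow, mul_one]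
    rfl
  · intro r _ hr
    rw [one_pow, mul_one]
    refine (macForm_hSeries_one q t (fun k => -(-1) ^ k * (1 - q ^ k)⁻¹) r f).symm.trans ?_
    exact macForm_homog q t hr (hSeries_mem_homog _ _) hf
  · intro hn
    exact absurd (Finset.mem_range.mpr (by omega)) hn

theorem wFun_eq_v0 (h : Generic q t) (n : ℕ) : wFun q n = v0 q t n := by
  rw [eq_sum_macP h (f := wFun q n) (n := n) (hSeries_mem_homog _ _), sum_diagrams, v0]
  refine Finset.sum_congr rfl fun lam _ => ?_
  have h1 : macP q t (diagram lam) ∈ homog F n := by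
    have := macP_mem_homog h (diagram lam)
    rwa [card_diagram] at this
  have h2 := specInf_macP h (diagram lam)
  have h3 : cCoeff q t lam ≠ 0 :=
    Finset.prod_ne_zero_iff.mpr fun s _ => h.one_sub_ne_zero _ _
  have h4 := macForm_macP_self_ne_zero h (diagram lam)
  rw [macForm_wFun h h1, macdonaldJ, macdonaldP_eq h, ← h2, ← macForm_apply, map_smul, map_smul,
    LinearMap.smul_apply, smul_smul, smul_eq_mul, smul_eq_mul]
  congr 1
  change _ = specInf t (macP q t (diagram lam)) * cCoeff q t lam / _ * cCoeff q t lam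
  field_simp

/-! ### The formal exponential -/

theorem coeff_pow_eq_zero {R : Type*} [CommRing R] {B : PowerSeries R}
    (hB : PowerSeries.constantCoeff B = 0) {d k : ℕ} (hdk : d < k) :
    PowerSeries.coeff d (B ^ k) = 0 :=
  PowerSeries.X_pow_dvd_iff.mp (pow_dvd_pow_of_dvd (PowerSeries.X_dvd_iff.mpr hB) k) d hdk

theorem coeff_formalExp {F : Type*} [Field F] {B : PowerSeries F} (hB : PowerSeries.constantCoeff B = 0) {d K : ℕ}
    (hdK : d ≤ K) : PowerSeries.coeff d (formalExp F B) =
      ∑ k ∈ Finset.range (K + 1), (k.factorial : F)⁻¹ * PowerSeries.coeff d (B ^ k) := by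
  rw [formalExp, PowerSeries.coeff_mk]
  simp only [smul_eq_mul]
  refine Finset.sum_subset (Finset.range_subset_range.mpr (by omega)) fun k _ hk => ?_
  rw [coeff_pow_eq_zero hB (by simpa using hk), mul_zero]

theorem isPowerExp_formalExp {B : PowerSeries F} (hB : PowerSeries.constantCoeff B = 0) :
    IsPowerExp (fun n => (n : F) * PowerSeries.coeff n B) (formalExp F B) := by
  rw [isPowerExp_iff]
  refine ⟨by simp [formalExp], fun n => ?_⟩
  have hder : ∀ k : ℕ, PowerSeries.coeff (n + 1) (B ^ (k + 1)) * ((n : F) + 1) =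
      (k + 1) * ∑ x ∈ antidiagonal n, ((x.1 + 1 : ℕ) : F) * PowerSeries.coeff (x.1 + 1) B *
        PowerSeries.coeff x.2 (B ^ k) := by
    intro k
    have h1 := congrArg (PowerSeries.coeff n) (Derivation.leibniz_pow (PowerSeries.derivative F) B (k + 1))
    rw [PowerSeries.coeff_derivative, Nat.add_sub_cancel, map_nsmul, smul_eq_mul, mul_comm (B ^ k),
      PowerSeries.coeff_mul, nsmul_eq_mul] at h1
    rw [h1, Nat.cast_succ]
    congr 1
    refine Finset.sum_congr rfl fun x _ => ?_
    rw [PowerSeries.coeff_derivative, Nat.cast_succ]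
    ring
  rw [coeff_formalExp hB le_rfl, Finset.sum_range_succ', pow_zero, PowerSeries.coeff_one,
    if_neg (Nat.succ_ne_zero n), mul_zero, add_zero, Finset.sum_mul]
  have hfac : ∀ k : ℕ, ((k + 1).factorial : F)⁻¹ * (k + 1) = (k.factorial : F)⁻¹ := fun k => by
    have h1 : ((k : F) + 1) ≠ 0 := by exact_mod_cast Nat.succ_ne_zero k
    rw [Nat.factorial_succ, Nat.cast_mul, Nat.cast_succ, mul_inv, mul_right_comm,
      inv_mul_cancel₀ h1, one_mul]
  have hterm : ∀ k ∈ Finset.range (n + 1), ((k + 1).factorial : F)⁻¹ *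
      PowerSeries.coeff (n + 1) (B ^ (k + 1)) * ((n : F) + 1) =
      ∑ x ∈ antidiagonal n, ((x.1 + 1 : ℕ) : F) * PowerSeries.coeff (x.1 + 1) B *
        ((k.factorial : F)⁻¹ * PowerSeries.coeff x.2 (B ^ k)) := by
    intro k _
    rw [mul_assoc, hder, ← mul_assoc, hfac, Finset.mul_sum]
    exact Finset.sum_congr rfl fun x _ => by ring
  rw [Finset.sum_congr rfl hterm, Finset.sum_comm]
  refine Finset.sum_congr rfl fun x hx => ?_
  rw [Finset.HasAntidiagonal.mem_antidiagonal] at hx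
  rw [← Finset.mul_sum, coeff_formalExp hB (K := n) (by omega)]

/-! ### The action of the operators `D` -/

/-- The function `wFun q (n - m)`, understood as zero when `n < m`. -/
def wSub (q : F) (n m : ℕ) : SymFun F := if m ≤ n then wFun q (n - m) else 0

/-- The power series `log (1 + X)`. -/
def logSeries (F : Type*) [Field F] : PowerSeries F := PowerSeries.mk fun k => -(-1) ^ k / (k : F)

theorem coeff_logD_wSub (h : Generic q t) (n i j : ℕ) :
    PowerSeries.coeff i (logD q) (wSub q n j) =
      PowerSeries.coeff i (logSeries F) • wSub q n (i + j) := by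
  rw [logD, logSeries, PowerSeries.coeff_mk, PowerSeries.coeff_mk]
  split_ifs with hi
  · have h1 : 1 - q ^ i ≠ 0 := sub_ne_zero.mpr (h.q_pow_ne_one i hi).symm
    obtain ⟨k, rfl⟩ : ∃ k : ℕ+, (k : ℕ) = i := ⟨⟨i, hi⟩, rfl⟩
    change (1 - q ^ (k : ℕ)) • MvPolynomial.pderiv k (wSub q n j) = _
    rw [wSub]
    by_cases hj : j ≤ n
    · rw [if_pos hj, wFun, pderiv_hSeries]
      by_cases hij : (k : ℕ) ≤ n - j
      · rw [if_pos hij, wSub, if_pos (by omega), wFun, MvPolynomial.C_mul', smul_smul, Nat.sub_sub,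
          add_comm j k]
        congr 1
        field_simp
      · rw [if_neg hij, wSub, if_neg (by omega), smul_zero, smul_zero]
    · rw [if_neg hj, wSub, if_neg (by omega), map_zero, smul_zero, smul_zero]
  · obtain rfl : i = 0 := by omega
    simp

theorem coeff_logD_pow_wSub (h : Generic q t) (n k m : ℕ) :
    PowerSeries.coeff m (logD q ^ k) (wSub q n 0) =
      PowerSeries.coeff m (logSeries F ^ k) • wSub q n m := by
  induction k generalizing m with
  | zero =>
    rw [pow_zero, pow_zero, PowerSeries.coeff_one, PowerSeries.coeff_one]
    split_ifs with hm
    · rw [hm, one_smul]; rfl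
    · rw [zero_smul]; rfl
  | succ k ih =>
    rw [pow_succ', pow_succ', PowerSeries.coeff_mul, PowerSeries.coeff_mul, LinearMap.sum_apply,
      Finset.sum_smul]
    refine Finset.sum_congr rfl fun x hx => ?_
    rw [Finset.HasAntidiagonal.mem_antidiagonal] at hx
    rw [Module.End.mul_apply, ih, map_smul, coeff_logD_wSub h, hx, smul_smul, mul_comm]

theorem formalExp_logSeries : formalExp F (logSeries F) = 1 + PowerSeries.X := by
  have h0 : PowerSeries.constantCoeff (logSeries F) = 0 := by
    rw [← PowerSeries.coeff_zero_eq_constantCoeff_apply, logSeries, PowerSeries.coeff_mk]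
    simp
  have h1 : IsPowerExp (fun n => -(-1 : F) ^ n) (1 + PowerSeries.X) := by
    have := isPowerExp_one_sub (-1 : F)
    rwa [map_neg, map_one, neg_mul, one_mul, sub_neg_eq_add] at this
  refine ((isPowerExp_formalExp h0).congr fun n => ?_).unique h1
  have hn : ((n : F) + 1) ≠ 0 := by exact_mod_cast Nat.succ_ne_zero n
  rw [logSeries, PowerSeries.coeff_mk, Nat.cast_succ, mul_div_cancel₀ _ hn]

theorem D_wFun (h : Generic q t) (d n : ℕ) :
    D q d (wFun q n) = PowerSeries.coeff d (1 + PowerSeries.X : PowerSeries F) • wSub q n d := by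
  have h1 : wFun q n = wSub q n 0 := by rw [wSub, if_pos (Nat.zero_le n), Nat.sub_zero]
  rw [h1, D, formalExp, PowerSeries.coeff_mk, LinearMap.sum_apply, ← formalExp_logSeries, formalExp,
    PowerSeries.coeff_mk, Finset.sum_smul]
  refine Finset.sum_congr rfl fun k _ => ?_
  rw [LinearMap.smul_apply, coeff_logD_pow_wSub h, smul_smul, smul_eq_mul]

end

end

end MacdonaldFock

theorem proposition4p4 {F : Type*} [Field F] [CharZero F] (q t : F)
    (hqt : AlgebraicIndependent ℚ ![q, t]) (n : ℕ) :
    MacdonaldFock.D q 1 (MacdonaldFock.v0 q t (n + 1)) = MacdonaldFock.v0 q t n ∧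
      ∀ d : ℕ, 2 ≤ d → MacdonaldFock.D q d (MacdonaldFock.v0 q t n) = 0 := by
  have h := MacdonaldFock.generic_of_algebraicIndependent hqt
  rw [← MacdonaldFock.wFun_eq_v0 h, ← MacdonaldFock.wFun_eq_v0 h]
  refine ⟨?_, fun d hd => ?_⟩
  · rw [MacdonaldFock.D_wFun h, MacdonaldFock.wSub, if_pos (Nat.le_add_left 1 n),
      Nat.add_sub_cancel]
    simp [PowerSeries.coeff_one]
  · rw [MacdonaldFock.D_wFun h, map_add, PowerSeries.coeff_one, if_neg (by omega),
      PowerSeries.coeff_X, if_neg (by omega), add_zero, zero_smul]
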